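/- **Theorem.** Let $G$ be a finite solvable group with an automorphism $\alpha$ that is fixed-point-free (that is, $\alpha(g)=g$ only for $g=1$). Let $f(x)=a_0+a_1x+\cdots+a_dx^d\in\mathbb Z[x]$ be an ordered identity of $\alpha$, that is, $g^{a_0}\cdot\alpha(g)^{a_1}\cdot\alpha^2(g)^{a_2}\cdots\alpha^d(g)^{a_d}=1$ for all $g\in G$ (the product in this order). Suppose that $f$ is Higman-solvable and that $\gcd(|G|,\operatorname{inv}(f))=1$. Then the Fitting height of $G$ (the least length of a normal series of $G$ with nilpotent factors) is at most $\operatorname{irr}(f)$, the number of irreducible factors of $f$ of positive degree in $\mathbb Z[x]$, counted with multiplicity. Here the following definitions are used. Divisors, quotients and gcd's of integer polynomials are taken in $\mathbb Z[x]$, gcd's with non-negative leading coefficient; $\operatorname{lc}$ is the leading coefficient; root sets are taken in $\overline{\mathbb Q}$, without multiplicities. *Higman-solvable polynomials.* A polynomial is powerful if it lies in $\mathbb Z[x^n]$ for some $n\ge 2$. A divisor $a$ of $b$, with root sets $A$ and $B$, is a closed divisor of $b$ if every powerful divisor of $b$ divides $a$, $(A\cdot A)\cap B\subseteq A$, and $\gcd(a,b/a)=1$.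 If $f$ is constant, put $\|f\|=0$ and $\overline f=f_*=f$. Otherwise, $\|f\|$ is the largest $n$ with $f\in\mathbb Z[x^n]$, $\overline f$ is the polynomial with $f(x)=\overline f(x^{\|f\|})$, and $f_*$ is the gcd of all closed divisors of $\overline f$. Put $\Delta(f)=f_*$. The polynomial $f$ is Higman-solvable if $f(0)\cdot f(1)\ne0$ and $\Delta^l(f)$ is constant for some $l\ge0$; the least such $l$ is $\operatorname{len}(f)$. *The invariant $\operatorname{inv}(f)$.* If $\operatorname{len}(f)=0$, then $\operatorname{inv}(f)=f\in\mathbb Z$. Otherwise, recursively, $$\operatorname{inv}(f)=f(1)\cdot\operatorname{lc}(f)\cdot\rho_1(f)\cdot\rho_2(f)\cdot\rho_3(f)\cdot\operatorname{discr}_*(f)\cdot\operatorname{prod}(f)\cdot\operatorname{inv}(\Delta(f)),$$ where: - $\rho_1(f)$ is the least integer $\rho\ge1$ such that, for all $n\ge2$, $\rho f_*$ lies in the ideal of $\mathbb Z[x]$ generated by $\overline f_{n,0},\dots,\overline f_{n,n-1}$, where $\overline f_{n,i}$ is the sum of the terms of $\overline f$ whose degree is congruent to $i$ modulo $n$. -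 $\rho_2(f)=f_*$ if $f_*$ is constant; otherwise $\rho_2(f)=\overline f/f_*$ if this is constant; otherwise $\rho_2(f)=\operatorname{Res}(f_*,\overline f/f_*)$. - $f_*^2=f_*$ if $f_*$ is constant; otherwise $f_*^2=\operatorname{lc}(f_*)^{k^{2k}}\chi_{C\otimes C}(x)\in\mathbb Z[x]$, where $k=\deg f_*$, $C$ is the companion matrix of the monic polynomial $\operatorname{lc}(f_*)^{-1}f_*$ and $\chi_{C\otimes C}$ is the characteristic polynomial of its Kronecker square. Let $u=\gcd(f_*^2,\overline f)$. Then $\rho_3(f)=\overline f/u$ if this is constant; otherwise $\rho_3(f)=f_*^2/u$ if this is constant; otherwise $\rho_3(f)=\operatorname{Res}(f_*^2/u,\overline f/u)$. - With $d=\deg f$ and $X$ the root set of $f$, $$\operatorname{discr}_*(f)=\operatorname{lc}(f)^{d^2}\prod_{\lambda,\mu\in X,\ \lambda\ne\mu}(\lambda-\mu),\qquad \operatorname{prod}(f)=\operatorname{lc}(f)^{2d^3}\prod_{\lambda,\mu\in X,\ f(\lambda\mu)\ne0}f(\lambda\mu),$$ the products running over ordered pairs; both are integers. -/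

import Mathlib

open Polynomial
open scoped Polynomial Pointwise

namespace HigmanSolvable

/-! ## Groups -/

section Groups

variable {G : Type*} [Group G]

/-- `f = a₀ + a₁ x + ⋯ + aₙ xⁿ` is an ordered identity of the endomorphism `γ`:
`h ^ a₀ * γ h ^ a₁ * γ² h ^ a₂ * ⋯ * γⁿ h ^ aₙ = 1` for all `h`, the product being taken
in this order. -/
def IsOrderedIdentity (γ : G →* G) (f : ℤ[X]) : Prop :=
  ∀ h : G, ((List.range (f.natDegree + 1)).map fun i => (γ^[i] h) ^ f.coeff i).prod = 1

/-- A series `1 = N 0 ≤ N 1 ≤ ⋯ ≤ N n = G` of normal subgroups of `G` with nilpotent factors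
`N (i + 1) / N i`. -/
def HasNilpotentSeries (G : Type*) [Group G] (n : ℕ) : Prop :=
  ∃ N : ℕ → Subgroup G, ∃ hN : ∀ i, (N i).Normal,
    N 0 = ⊥ ∧ N n = ⊤ ∧ ∀ i < n, N i ≤ N (i + 1) ∧
      (haveI := hN i; Group.IsNilpotent (N (i + 1) ⧸ (N i).subgroupOf (N (i + 1))))

/-- The Fitting height: the least length of a normal series with nilpotent factors
(`⊤` if there is no such series). -/
noncomputable def fittingHeight (G : Type*) [Group G] : ℕ∞ :=
  sInf {m : ℕ∞ | ∃ n : ℕ, m = n ∧ HasNilpotentSeries G n}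

end Groups

/-! ## Greatest common divisors and quotients in `ℤ[x]` -/

theorem exists_setGcd (S : Set ℤ[X]) :
    ∃ d : ℤ[X], (∀ a ∈ S, d ∣ a) ∧ ∀ e, (∀ a ∈ S, e ∣ a) → e ∣ d := by
  classical
  have hfg : (Submodule.span ℤ[X] S).FG := IsNoetherian.noetherian _
  obtain ⟨T, hTS, hT⟩ := (Submodule.fg_span_iff_fg_span_finset_subset S).1 hfg
  refine ⟨T.gcd id, fun a ha => ?_, fun e he => Finset.dvd_gcd fun b hb => he b (hTS hb)⟩
  have h1 : a ∈ Submodule.span ℤ[X] (T : Set ℤ[X]) := hT ▸ Submodule.subset_span ha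
  have h2 : Submodule.span ℤ[X] (T : Set ℤ[X]) ≤ Ideal.span {T.gcd id} := by
    refine Submodule.span_le.2 fun b hb => ?_
    exact Ideal.mem_span_singleton.2 (Finset.gcd_dvd (f := id) hb)
  exact Ideal.mem_span_singleton.1 (h2 h1)

/-- The greatest common divisor in `ℤ[x]` of the members of `S`, with non-negative leading
coefficient. -/
noncomputable def setGcd (S : Set ℤ[X]) : ℤ[X] := normalize (exists_setGcd S).choose

theorem setGcd_dvd {S : Set ℤ[X]} {a : ℤ[X]} (ha : a ∈ S) : setGcd S ∣ a :=
  normalize_dvd_iff.2 ((exists_setGcd S).choose_spec.1 a ha)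

theorem dvd_setGcd {S : Set ℤ[X]} {e : ℤ[X]} (he : ∀ a ∈ S, e ∣ a) : e ∣ setGcd S :=
  dvd_normalize_iff.2 ((exists_setGcd S).choose_spec.2 e he)

open Classical in
/-- The quotient `b / a` in `ℤ[x]`; it is used only for divisors `a ≠ 0` of `b`. -/
noncomputable def quo (b a : ℤ[X]) : ℤ[X] := if h : a ∣ b then h.choose else 0

theorem mul_quo {a b : ℤ[X]} (h : a ∣ b) : a * quo b a = b := by
  rw [quo, dif_pos h]
  exact h.choose_spec.symm

/-! ## Higman-solvable polynomials -/

/-- The field in which the roots are taken. -/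
abbrev Qbar : Type := AlgebraicClosure ℚ

/-- `a` is a polynomial in `x ^ n` for some `n ≥ 2`. -/
def IsPowerful (a : ℤ[X]) : Prop := ∃ n : ℕ, 2 ≤ n ∧ ∃ g : ℤ[X], a = expand ℤ n g

/-- The root set in an algebraic closure of `ℚ`. -/
noncomputable def roots (a : ℤ[X]) : Set Qbar := a.rootSet Qbar

/-- `a` is a closed divisor of `b`. -/
structure IsClosedDivisor (a b : ℤ[X]) : Prop where
  dvd : a ∣ b
  powerful_dvd : ∀ u : ℤ[X], IsPowerful u → u ∣ b → u ∣ a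
  roots_mul : (roots a * roots a) ∩ roots b ⊆ roots a
  relPrime : IsRelPrime a (quo b a)

open Classical in
/-- `‖f‖`: zero for a constant `f`, and otherwise the largest `n` such that `f` is a polynomial
in `x ^ n`. -/
noncomputable def norm (f : ℤ[X]) : ℕ :=
  if f.natDegree = 0 then 0 else sSup {n : ℕ | ∃ g : ℤ[X], f = expand ℤ n g}

open Classical in
/-- `f̄`: `f` itself for a constant `f`, and otherwise the polynomial with `f = f̄ (x ^ ‖f‖)`. -/
noncomputable def bar (f : ℤ[X]) : ℤ[X] :=
  if f.natDegree = 0 then f else contract (norm f) f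

theorem norm_spec {f : ℤ[X]} (hf : f.natDegree ≠ 0) :
    norm f ≠ 0 ∧ ∃ g : ℤ[X], f = expand ℤ (norm f) g := by
  have hne : {n : ℕ | ∃ g : ℤ[X], f = expand ℤ n g}.Nonempty := ⟨1, f, by simp⟩
  have hle : ∀ n ∈ {n : ℕ | ∃ g : ℤ[X], f = expand ℤ n g}, n ≤ f.natDegree := by
    rintro n ⟨g, hg⟩
    have h1 := natDegree_expand n g
    rw [← hg] at h1
    rw [h1] at hf ⊢
    exact Nat.le_mul_of_pos_left n (Nat.pos_of_ne_zero fun h => hf (by simp [h]))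
  have hmem := Nat.sSup_mem hne ⟨_, hle⟩
  have h1 : 1 ≤ sSup {n : ℕ | ∃ g : ℤ[X], f = expand ℤ n g} :=
    le_csSup ⟨_, hle⟩ ⟨f, by simp⟩
  rw [norm, if_neg hf]
  exact ⟨by omega, hmem⟩

theorem expand_norm_bar {f : ℤ[X]} (hf : f.natDegree ≠ 0) : expand ℤ (norm f) (bar f) = f := by
  obtain ⟨h0, g, hg⟩ := norm_spec hf
  rw [bar, if_neg hf]
  conv_lhs => rw [hg]
  rw [← hg]
  have h1 : contract (norm f) f = g := by
    conv_lhs => rw [hg]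
    rw [← hg]
    have := contract_expand (R := ℤ) (p := norm f) (f := g) h0
    rwa [← hg] at this
  rw [h1, ← hg]

theorem bar_natDegree_ne_zero {f : ℤ[X]} (hf : f.natDegree ≠ 0) : (bar f).natDegree ≠ 0 := by
  intro h
  have h1 := natDegree_expand (norm f) (bar f)
  rw [expand_norm_bar hf, h, zero_mul] at h1
  exact hf h1

open Classical in
/-- `f_*`: `f` itself for a constant `f`, and otherwise the gcd of all closed divisors of `f̄`. -/
noncomputable def star (f : ℤ[X]) : ℤ[X] :=
  if f.natDegree = 0 then f else setGcd {a | IsClosedDivisor a (bar f)}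

/-- The map `Δ`. -/
noncomputable def Delta (f : ℤ[X]) : ℤ[X] := star f

/-- `f` is Higman-solvable: `f(0) f(1) ≠ 0` and some iterate `Δ^l(f)` is a constant. -/
def IsHigmanSolvable (f : ℤ[X]) : Prop :=
  f.eval 0 * f.eval 1 ≠ 0 ∧ ∃ l : ℕ, (Delta^[l] f).natDegree = 0

/-- The least `l` such that `Δ^l(f)` is a constant. -/
noncomputable def len (f : ℤ[X]) : ℕ := sInf {l : ℕ | (Delta^[l] f).natDegree = 0}

open Classical in
/-- The number of irreducible factors of positive degree, counted with multiplicity. -/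
noncomputable def irr (f : ℤ[X]) : ℕ :=
  ((UniqueFactorizationMonoid.factors f).filter fun p => 0 < p.natDegree).card

/-! ## The auxiliary invariants -/

/-- The part of `b` consisting of the terms of degree congruent to `i` modulo `n`. -/
noncomputable def part (b : ℤ[X]) (n i : ℕ) : ℤ[X] :=
  ∑ j ∈ (Finset.range (b.natDegree + 1)).filter fun j => j ≡ i [MOD n], monomial j (b.coeff j)

/-- The least `ρ ≥ 1` such that, for all `n ≥ 2`, `ρ f_*` is in the ideal generated by
the polynomials `part f̄ n 0, …, part f̄ n (n - 1)`. -/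
noncomputable def rho₁ (f : ℤ[X]) : ℤ :=
  ((sInf {ρ : ℕ | 1 ≤ ρ ∧ ∀ n : ℕ, 2 ≤ n →
    (ρ : ℤ[X]) * star f ∈ Ideal.span {q | ∃ i < n, q = part (bar f) n i}} : ℕ) : ℤ)

open Classical in
/-- The resultant of `f_*` and `f̄ / f_*`, with separate values if one of these is constant. -/
noncomputable def rho₂ (f : ℤ[X]) : ℤ :=
  if (star f).natDegree = 0 then (star f).coeff 0
  else if (quo (bar f) (star f)).natDegree = 0 then (quo (bar f) (star f)).coeff 0
  else resultant (star f) (quo (bar f) (star f))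

/-- The companion matrix of the monic polynomial `p`. -/
def companion (p : ℚ[X]) : Matrix (Fin p.natDegree) (Fin p.natDegree) ℚ :=
  fun i j => if (j : ℕ) + 1 = p.natDegree then -p.coeff i
    else if (i : ℕ) = j + 1 then 1 else 0

/-- For `p ∈ ℤ[x]` with leading coefficient `a`, the characteristic polynomial of `C ⊗ C`,
where `C` is the companion matrix of `a⁻¹ p`. -/
noncomputable def kroneckerSquare (p : ℤ[X]) : ℚ[X] :=
  (Matrix.kronecker
    (companion (C (p.leadingCoeff : ℚ)⁻¹ * p.map (Int.castRingHom ℚ)))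
    (companion (C (p.leadingCoeff : ℚ)⁻¹ * p.map (Int.castRingHom ℚ)))).charpoly

theorem natDegree_monicMultiple {p : ℤ[X]} (hp : p ≠ 0) :
    (C (p.leadingCoeff : ℚ)⁻¹ * p.map (Int.castRingHom ℚ)).natDegree = p.natDegree := by
  rw [natDegree_C_mul (inv_ne_zero (by exact_mod_cast leadingCoeff_ne_zero.2 hp)),
    natDegree_map_eq_of_injective (RingHom.injective_int _)]

theorem charpoly_smul_coeff {n : Type*} [Fintype n] [DecidableEq n] (M : Matrix n n ℚ) (c : ℚ)
    (k : ℕ) (hk : k ≤ Fintype.card n) :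
    (c • M).charpoly.coeff (Fintype.card n - k) =
      c ^ k * M.charpoly.coeff (Fintype.card n - k) := by
  rw [Matrix.charpoly_coeff_eq_sum_minors _ _ hk, Matrix.charpoly_coeff_eq_sum_minors _ _ hk]
  have : ∀ s ∈ Finset.powersetCard k (Finset.univ : Finset n),
      ((c • M).submatrix (Subtype.val : s → n) Subtype.val).det =
        c ^ k * (M.submatrix (Subtype.val : s → n) Subtype.val).det := by
    intro s hs
    rw [Matrix.submatrix_smul, Pi.smul_apply, Pi.smul_apply, Matrix.det_smul, Fintype.card_coe,
      (Finset.mem_powersetCard.1 hs).2]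
  rw [Finset.sum_congr rfl this, ← Finset.mul_sum]
  ring

/-- The leading coefficient times the companion matrix is an integer matrix. -/
theorem exists_int_companion {p : ℤ[X]} (hp : p ≠ 0) :
    ∃ M : Matrix _ _ ℤ, (p.leadingCoeff : ℚ) •
      companion (C (p.leadingCoeff : ℚ)⁻¹ * p.map (Int.castRingHom ℚ)) =
        M.map (Int.castRingHom ℚ) := by
  have h0 : (p.leadingCoeff : ℚ) ≠ 0 := by exact_mod_cast leadingCoeff_ne_zero.2 hp
  refine ⟨Matrix.of fun i j => if (j : ℕ) + 1 = (C (p.leadingCoeff : ℚ)⁻¹ *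
    p.map (Int.castRingHom ℚ)).natDegree then -p.coeff i
    else if (i : ℕ) = j + 1 then p.leadingCoeff else 0, ?_⟩
  ext i j
  simp only [Matrix.smul_apply, companion, Matrix.map_apply, Matrix.of_apply, smul_eq_mul]
  split_ifs
  · rw [coeff_C_mul, coeff_map, eq_intCast, eq_intCast, Int.cast_neg, mul_neg,
      mul_inv_cancel_left₀ h0]
  · simp
  · simp

theorem exists_kroneckerSquare {p : ℤ[X]} (hp : 2 ≤ p.natDegree) :
    ∃ q : ℤ[X], q.map (Int.castRingHom ℚ) =
      C ((p.leadingCoeff : ℚ) ^ (p.natDegree ^ (2 * p.natDegree))) * kroneckerSquare p := by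
  have hp0 : p ≠ 0 := fun h => by simp [h] at hp
  obtain ⟨M, hM⟩ := exists_int_companion hp0
  have hp1 := natDegree_monicMultiple hp0
  rw [kroneckerSquare]
  generalize ha : (p.leadingCoeff : ℚ) = a at *
  set D := companion (C a⁻¹ * p.map (Int.castRingHom ℚ)) with hD
  have hcard : Fintype.card (Fin (C a⁻¹ * p.map (Int.castRingHom ℚ)).natDegree ×
      Fin (C a⁻¹ * p.map (Int.castRingHom ℚ)).natDegree) = p.natDegree * p.natDegree := by
    rw [Fintype.card_prod, Fintype.card_fin, hp1]
  have hMM : (a ^ 2) • Matrix.kronecker D D = (Matrix.kronecker M M).map (Int.castRingHom ℚ) := by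
    ext ⟨i, i'⟩ ⟨j, j'⟩
    have h1 := congrFun (congrFun hM i) j
    have h2 := congrFun (congrFun hM i') j'
    simp only [Matrix.smul_apply, Matrix.map_apply, smul_eq_mul] at h1 h2
    simp only [Matrix.smul_apply, Matrix.map_apply, smul_eq_mul, Matrix.kronecker,
      Matrix.kroneckerMap_apply, map_mul, ← h1, ← h2]
    ring
  have hexp : 2 * (p.natDegree * p.natDegree) ≤ p.natDegree ^ (2 * p.natDegree) := by
    calc 2 * (p.natDegree * p.natDegree) ≤ p.natDegree * (p.natDegree * p.natDegree) :=
          Nat.mul_le_mul_right _ hp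
      _ = p.natDegree ^ 3 := by ring
      _ ≤ p.natDegree ^ (2 * p.natDegree) := Nat.pow_le_pow_right (by omega) (by omega)
  have hlift : C (a ^ (p.natDegree ^ (2 * p.natDegree))) * (Matrix.kronecker D D).charpoly ∈
      Polynomial.lifts (Int.castRingHom ℚ) := by
    rw [Polynomial.lifts_iff_coeff_lifts]
    intro i
    rw [coeff_C_mul]
    by_cases hi : i ≤ p.natDegree * p.natDegree
    · obtain ⟨k, hk, rfl⟩ : ∃ k ≤ p.natDegree * p.natDegree, i = p.natDegree * p.natDegree - k :=
        ⟨p.natDegree * p.natDegree - i, by omega, by omega⟩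
      have h1 := charpoly_smul_coeff (Matrix.kronecker D D) (a ^ 2) k (by omega)
      rw [hMM, Matrix.charpoly_map, coeff_map, hcard] at h1
      refine ⟨p.leadingCoeff ^ (p.natDegree ^ (2 * p.natDegree) - 2 * k) *
        (Matrix.kronecker M M).charpoly.coeff (p.natDegree * p.natDegree - k), ?_⟩
      rw [map_mul, h1, map_pow, ← pow_mul, ← mul_assoc, eq_intCast, ha,
        ← pow_add, Nat.sub_add_cancel (by omega)]
    · refine ⟨0, ?_⟩
      rw [coeff_eq_zero_of_natDegree_lt, mul_zero, map_zero]
      rw [Matrix.charpoly_natDegree_eq_dim, hcard]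
      omega
  exact (Polynomial.mem_lifts _).1 hlift

theorem setGcd_closedDivisor_natDegree {b : ℤ[X]} (hb : b.natDegree ≠ 0)
    (h : (setGcd {a | IsClosedDivisor a b}).natDegree ≠ 0) :
    2 ≤ (setGcd {a | IsClosedDivisor a b}).natDegree := by
  have hb0 : b ≠ 0 := fun h => by simp [h] at hb
  set d := setGcd {a | IsClosedDivisor a b} with hd
  have hd0 : d ≠ 0 := fun h' => by simp [h'] at h
  by_contra hlt
  have hpow : ∀ u, IsPowerful u → u ∣ b → u.natDegree = 0 := by
    intro u hu hub
    have h1 : u ∣ d := dvd_setGcd fun a ha => ha.powerful_dvd u hu hub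
    have h2 := natDegree_le_of_dvd h1 hd0
    obtain ⟨n, hn, g, rfl⟩ := hu
    rw [natDegree_expand] at h2 ⊢
    rcases Nat.eq_zero_or_pos g.natDegree with h3 | h3
    · simp [h3]
    · have := Nat.mul_le_mul h3 hn
      omega
  have hc0 : (C b.content : ℤ[X]) ≠ 0 := by simpa using (content_eq_zero_iff.not.2 hb0)
  have hcl : IsClosedDivisor (C b.content) b := by
    refine ⟨C_content_dvd b, ?_, ?_, ?_⟩
    · intro u hu hub
      obtain ⟨c, rfl⟩ := natDegree_eq_zero.1 (hpow u hu hub)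
      exact map_dvd C ((dvd_content_iff_C_dvd).2 hub)
    · have h0 : roots (C b.content) = ∅ := rootSet_C _
      rw [h0, Set.empty_mul, Set.empty_inter]
    · have h1 : quo b (C b.content) = b.primPart :=
        mul_left_cancel₀ hc0 ((mul_quo (C_content_dvd b)).trans b.eq_C_content_mul_primPart)
      rw [h1]
      intro e he1 he2
      have h3 := natDegree_le_of_dvd he1 hc0
      rw [natDegree_C] at h3
      obtain ⟨c, rfl⟩ := natDegree_eq_zero.1 (Nat.le_zero.1 h3)
      exact isUnit_C.2 (b.isPrimitive_primPart c he2)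
  have h4 := natDegree_le_of_dvd
    (setGcd_dvd (S := {a | IsClosedDivisor a b}) (a := C b.content) hcl) hc0
  rw [natDegree_C] at h4
  exact h (Nat.le_zero.1 h4)

theorem two_le_natDegree_star {f : ℤ[X]} (h : (star f).natDegree ≠ 0) :
    2 ≤ (star f).natDegree := by
  by_cases hf : f.natDegree = 0
  · rw [star, if_pos hf] at h
    exact absurd hf h
  · rw [star, if_neg hf] at h ⊢
    exact setGcd_closedDivisor_natDegree (bar_natDegree_ne_zero hf) h

open Classical in
/-- `f_*²`: it is `f_*` if that is a constant, and otherwise the multiple by `a ^ (k ^ (2 k))` of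
the characteristic polynomial of `C ⊗ C`, where `a` and `k` are the leading coefficient and the
degree of `f_*` and `C` is the companion matrix of `a⁻¹ f_*`. -/
noncomputable def starSq (f : ℤ[X]) : ℤ[X] :=
  if h : (star f).natDegree = 0 then star f
  else (exists_kroneckerSquare (two_le_natDegree_star h)).choose

/-- `u`, the greatest common divisor of `f_*²` and `f̄`. -/
noncomputable def gcdStarSq (f : ℤ[X]) : ℤ[X] := setGcd {starSq f, bar f}

open Classical in
/-- The resultant of `f_*² / u` and `f̄ / u`, with separate values if one of these is constant. -/
noncomputable def rho₃ (f : ℤ[X]) : ℤ :=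
  if (quo (bar f) (gcdStarSq f)).natDegree = 0 then (quo (bar f) (gcdStarSq f)).coeff 0
  else if (quo (starSq f) (gcdStarSq f)).natDegree = 0 then
    (quo (starSq f) (gcdStarSq f)).coeff 0
  else resultant (quo (starSq f) (gcdStarSq f)) (quo (bar f) (gcdStarSq f))

open Classical in
/-- The finite set of the distinct roots of `f`. -/
noncomputable def rootFinset (f : ℤ[X]) : Finset Qbar := (f.aroots Qbar).toFinset

theorem mem_rootFinset {f : ℤ[X]} {x : Qbar} : x ∈ rootFinset f ↔ f ≠ 0 ∧ aeval x f = 0 := by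
  classical
  rw [rootFinset, Multiset.mem_toFinset, mem_aroots]

theorem card_rootFinset_le (f : ℤ[X]) : (rootFinset f).card ≤ f.natDegree := by
  classical
  refine (Multiset.toFinset_card_le _).trans ((card_roots' _).trans natDegree_map_le)

/-- An integral element of `ℚ̄` that is fixed by all automorphisms is an integer. -/
theorem exists_int_of_fixed (x : Qbar) (hx : IsIntegral ℤ x) (h : ∀ σ : Gal(Qbar/ℚ), σ x = x) :
    ∃ n : ℤ, (n : Qbar) = x := by
  have : IsGalois ℚ Qbar := by
    have h0 : @IsAlgClosure ℚ (AlgebraicClosure ℚ) _ _ (AlgebraicClosure.instAlgebra ℚ) _ := by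
      infer_instance
    convert @IsAlgClosure.isGalois ℚ (AlgebraicClosure ℚ) _ _ (AlgebraicClosure.instAlgebra ℚ)
      h0 _
    exact Subsingleton.elim _ _
  obtain ⟨r, rfl⟩ := IntermediateField.mem_bot.1 ((InfiniteGalois.mem_bot_iff_fixed x).2 h)
  have hr : IsIntegral ℤ r :=
    (isIntegral_algebraMap_iff (algebraMap ℚ Qbar).injective).1 hx
  obtain ⟨n, rfl⟩ := IsIntegrallyClosed.isIntegral_iff.1 hr
  exact ⟨n, by simp⟩

theorem isIntegral_lc_mul {f : ℤ[X]} {x : Qbar} (hx : x ∈ rootFinset f) :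
    IsIntegral ℤ ((f.leadingCoeff : Qbar) * x) := by
  have := isIntegral_leadingCoeff_smul f x (mem_rootFinset.1 hx).2
  simpa [zsmul_eq_mul] using this

theorem gal_mem_rootFinset {f : ℤ[X]} (σ : Gal(Qbar/ℚ)) {x : Qbar} (hx : x ∈ rootFinset f) :
    σ x ∈ rootFinset f := by
  rw [mem_rootFinset] at hx ⊢
  refine ⟨hx.1, ?_⟩
  have := aeval_algHom_apply (σ.toAlgHom.restrictScalars ℤ) x f
  rw [hx.2, map_zero] at this
  exact this

theorem gal_aeval {f : ℤ[X]} (σ : Gal(Qbar/ℚ)) (x : Qbar) : aeval (σ x) f = σ (aeval x f) :=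
  aeval_algHom_apply (σ.toAlgHom.restrictScalars ℤ) x f

theorem exists_int_prod (T : Finset (Qbar × Qbar)) (φ : Qbar × Qbar → Qbar) (a : ℤ) (m N : ℕ)
    (hT : ∀ σ : Gal(Qbar/ℚ), ∀ t ∈ T, (σ t.1, σ t.2) ∈ T)
    (hφ : ∀ σ : Gal(Qbar/ℚ), ∀ t ∈ T, φ (σ t.1, σ t.2) = σ (φ t))
    (hint : ∀ t ∈ T, IsIntegral ℤ ((a : Qbar) ^ m * φ t)) (hN : m * T.card ≤ N) :
    ∃ n : ℤ, (n : Qbar) = (a : Qbar) ^ N * ∏ t ∈ T, φ t := by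
  have hai : IsIntegral ℤ (a : Qbar) := by
    simpa using isIntegral_algebraMap (R := ℤ) (A := Qbar) (x := a)
  refine exists_int_of_fixed _ ?_ ?_
  · have h1 : (a : Qbar) ^ N * ∏ t ∈ T, φ t =
        (a : Qbar) ^ (N - m * T.card) * ∏ t ∈ T, ((a : Qbar) ^ m * φ t) := by
      rw [Finset.prod_mul_distrib, Finset.prod_const, ← pow_mul, ← mul_assoc, ← pow_add,
        Nat.sub_add_cancel hN]
    rw [h1]
    exact (hai.pow _).mul (IsIntegral.prod _ hint)
  · intro σ
    rw [map_mul, map_pow, map_intCast, map_prod]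
    congr 1
    refine Finset.prod_bij (fun t _ => (σ t.1, σ t.2)) (hT σ) ?_ ?_ fun t ht => (hφ σ t ht).symm
    · intro s _ t _ hst
      rw [Prod.mk.injEq] at hst
      exact Prod.ext (σ.injective hst.1) (σ.injective hst.2)
    · intro t ht
      refine ⟨(σ.symm t.1, σ.symm t.2), hT σ.symm t ht, ?_⟩
      simp

open Classical in
theorem exists_discrStar (f : ℤ[X]) :
    ∃ n : ℤ, (n : Qbar) = (f.leadingCoeff : Qbar) ^ (f.natDegree ^ 2) *
      ∏ t ∈ (rootFinset f).offDiag, (t.1 - t.2) := by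
  refine exists_int_prod _ (fun t => t.1 - t.2) f.leadingCoeff 1 _ ?_ ?_ ?_ ?_
  · intro σ t ht
    rw [Finset.mem_offDiag] at ht ⊢
    exact ⟨gal_mem_rootFinset σ ht.1, gal_mem_rootFinset σ ht.2.1, fun h => ht.2.2 (σ.injective h)⟩
  · intro σ t _
    simp
  · intro t ht
    rw [Finset.mem_offDiag] at ht
    rw [pow_one, mul_sub]
    exact (isIntegral_lc_mul ht.1).sub (isIntegral_lc_mul ht.2.1)
  · rw [Finset.offDiag_card, one_mul, sq]
    exact (Nat.sub_le _ _).trans (Nat.mul_le_mul (card_rootFinset_le f) (card_rootFinset_le f))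

open Classical in
/-- The product of the differences `λ - μ` over all ordered pairs of distinct roots of `f`, made
integral by a power of the leading coefficient. -/
noncomputable def discrStar (f : ℤ[X]) : ℤ := (exists_discrStar f).choose

theorem isIntegral_lc_pow_aeval_mul {f : ℤ[X]} {x y : Qbar} (hx : x ∈ rootFinset f)
    (hy : y ∈ rootFinset f) :
    IsIntegral ℤ ((f.leadingCoeff : Qbar) ^ (2 * f.natDegree) * aeval (x * y) f) := by
  have hint : ∀ n : ℤ, IsIntegral ℤ (n : Qbar) := fun n => by
    simpa using isIntegral_algebraMap (R := ℤ) (A := Qbar) (x := n)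
  rw [aeval_eq_sum_range, Finset.mul_sum]
  refine IsIntegral.sum _ fun i hi => ?_
  have hi' : i ≤ f.natDegree := Nat.lt_succ_iff.1 (Finset.mem_range.1 hi)
  obtain ⟨k, hk⟩ := Nat.exists_eq_add_of_le hi'
  have h1 : (f.leadingCoeff : Qbar) ^ (2 * f.natDegree) * (f.coeff i • (x * y) ^ i) =
      (f.leadingCoeff : Qbar) ^ (2 * k) * (f.coeff i : Qbar) *
        ((f.leadingCoeff : Qbar) * x) ^ i * ((f.leadingCoeff : Qbar) * y) ^ i := by
    rw [zsmul_eq_mul, hk]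
    ring
  rw [h1]
  exact ((((hint _).pow _).mul (hint _)).mul ((isIntegral_lc_mul hx).pow _)).mul
    ((isIntegral_lc_mul hy).pow _)

open Classical in
theorem exists_prodant (f : ℤ[X]) :
    ∃ n : ℤ, (n : Qbar) = (f.leadingCoeff : Qbar) ^ (2 * f.natDegree ^ 3) *
      ∏ t ∈ (rootFinset f ×ˢ rootFinset f).filter (fun t => aeval (t.1 * t.2) f ≠ 0),
        aeval (t.1 * t.2) f := by
  refine exists_int_prod _ (fun t => aeval (t.1 * t.2) f) f.leadingCoeff (2 * f.natDegree) _
    ?_ ?_ ?_ ?_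
  · intro σ t ht
    rw [Finset.mem_filter, Finset.mem_product] at ht ⊢
    refine ⟨⟨gal_mem_rootFinset σ ht.1.1, gal_mem_rootFinset σ ht.1.2⟩, ?_⟩
    rw [← map_mul, gal_aeval]
    exact fun h => ht.2 ((map_eq_zero σ).1 h)
  · intro σ t _
    simp only [← map_mul, gal_aeval]
  · intro t ht
    rw [Finset.mem_filter, Finset.mem_product] at ht
    exact isIntegral_lc_pow_aeval_mul ht.1.1 ht.1.2
  · have h1 := Finset.card_filter_le (rootFinset f ×ˢ rootFinset f)
      (fun t => aeval (t.1 * t.2) f ≠ 0)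
    rw [Finset.card_product] at h1
    have h2 := Nat.mul_le_mul (card_rootFinset_le f) (card_rootFinset_le f)
    calc _ ≤ 2 * f.natDegree * (f.natDegree * f.natDegree) :=
          Nat.mul_le_mul_left _ (h1.trans h2)
      _ = _ := by ring

open Classical in
/-- The product of the values `f (λ μ) ≠ 0` over all ordered pairs `(λ, μ)` of roots of `f` for
which this value is not zero, made integral by a power of the leading coefficient. -/
noncomputable def prodant (f : ℤ[X]) : ℤ := (exists_prodant f).choose

/-! ## The main invariant -/

/-- `inv` for a polynomial of Higman-length `l`, by recursion on `l`. -/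
noncomputable def invAux : ℕ → ℤ[X] → ℤ
  | 0, f => f.coeff 0
  | l + 1, f =>
    f.eval 1 * f.leadingCoeff * rho₁ f * rho₂ f * rho₃ f * discrStar f * prodant f *
      invAux l (Delta f)

/-- The invariant `inv(f)` of a Higman-solvable polynomial `f`. -/
noncomputable def inv (f : ℤ[X]) : ℤ := invAux (len f) f

end HigmanSolvable

/-!
Write `b = f̄`, `s = f_*`, `t = b / s`. An ordered identity of `α` says that `f(α)` vanishes on every
`α`-invariant abelian section of `G`, and only this consequence (`Kills`) is used. It is inherited
by invariant subgroups and quotients, and since `f(x) = b(x ^ ‖f‖)` it is a statement about `b` and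
a power of `α`. The proof shows that on the sections of the nilpotent residual `K` of `G`, the last
term of its lower central series, already `s` vanishes. As `s = Δ(f)` has fewer irreducible factors
than `f` (`irr_star_lt`), recursion yields a series of `K` of length at most `irr s`, to which the
nilpotent factor `G / K` is added (`hasCharacteristicSeries_irr`). The recursion ends with a
constant prime to `|G|` that annihilates all sections, so that the group reached is trivial.

For the vanishing of `s` a prime `p` is fixed, and `K` is replaced by the larger subgroup `R`
generated by the elements of order prime to `p` (`kills_pResidual`). One climbs along a chief series.
That `s` may be tested on the factors holds because `s t` vanishes everywhere and `s`, `t` are coprime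
modulo `p`, which is what `ρ₂` provides (`Kills.trans`). For a `p`-chief factor `N` there are two
cases.

* `N` is not central (`orderedEval_eq_one_of_noncentral`). A chief factor of `G / C(N)` is an abelian
  `q`-group, `q ≠ p`, that decomposes `N`, over an algebraically closed field, into weight spaces. These
  are permuted by the power of `α` in question in orbits of length at least `2`, as `b(1)` is prime
  to `q`. On an orbit of length `n` the relation given by `b` splits into those given by the parts of
  `b` modulo `n`, and by the definition of `ρ₁` the polynomial `s` is up to a factor prime to `p`
  a combination of these parts (`aeval_eq_zero_of_weights`).
* `N` is central (`orderedEval_eq_one_of_central`). There is an invariant Sylow `p`-subgroup `P` of `R`,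
  and the transfer from `R` to `P / P'` is trivial, whence `N ≤ P'`. By induction `s` vanishes on the
  sections of `P / P'`. The factors of the lower central series of `P` are equivariant images of tensor
  products, so that the eigenvalues on them are products of roots of `s` modulo `p`. Such a product is
  never a root of `t` modulo `p`: the root set of `s` is closed in that of `b`, and this survives the
  reduction modulo `p` because `p` does not divide `prodant f` (`hasProductPolynomial_star`). Hence `s`
  vanishes on all sections of `P` (`Kills.of_commutator`).
-/

open scoped TensorProduct

namespace HigmanSolvable

/-! ### The polynomials `f̄` and `f_*` -/

theorem isClosedDivisor_self {b : ℤ[X]} (hb : b ≠ 0) : IsClosedDivisor b b := by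
  have h1 : quo b b = 1 := mul_left_cancel₀ hb ((mul_quo dvd_rfl).trans (mul_one b).symm)
  exact ⟨dvd_rfl, fun _ _ h => h, Set.inter_subset_right, h1 ▸ isRelPrime_one_right⟩

theorem bar_ne_zero {f : ℤ[X]} (hf : f.natDegree ≠ 0) : bar f ≠ 0 := fun h =>
  bar_natDegree_ne_zero hf (by rw [h, natDegree_zero])

theorem star_eq {f : ℤ[X]} (hf : f.natDegree ≠ 0) :
    star f = setGcd {a | IsClosedDivisor a (bar f)} := by
  rw [star, if_neg hf]

theorem star_dvd_bar {f : ℤ[X]} (hf : f.natDegree ≠ 0) : star f ∣ bar f := by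
  rw [star_eq hf]
  exact setGcd_dvd (S := {a | IsClosedDivisor a (bar f)}) (isClosedDivisor_self (bar_ne_zero hf))

theorem star_mul_quo {f : ℤ[X]} (hf : f.natDegree ≠ 0) :
    star f * quo (bar f) (star f) = bar f := mul_quo (star_dvd_bar hf)

theorem eval_one_bar {f : ℤ[X]} (hf : f.natDegree ≠ 0) : (bar f).eval 1 = f.eval 1 := by
  conv_rhs => rw [← expand_norm_bar hf, expand_eval, one_pow]

theorem leadingCoeff_bar {f : ℤ[X]} (hf : f.natDegree ≠ 0) :
    (bar f).leadingCoeff = f.leadingCoeff := by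
  conv_rhs => rw [← expand_norm_bar hf]
  rw [leadingCoeff_expand (Nat.pos_of_ne_zero (norm_spec hf).1)]

/-- An irreducible factor of `b` that vanishes at `x` divides every polynomial vanishing at `x`. -/
theorem exists_dvd_of_aeval_eq_zero {b : ℤ[X]} (hb : b ≠ 0) {x : Qbar} (hx : aeval x b = 0) :
    ∃ π : ℤ[X], aeval x π = 0 ∧ ∀ a : ℤ[X], aeval x a = 0 → π ∣ a := by
  classical
  obtain ⟨π, hπ, hπx⟩ : ∃ π : ℤ[X], Irreducible π ∧ aeval x π = 0 := by
    revert hx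
    induction b using WfDvdMonoid.induction_on_irreducible with
    | zero => exact absurd rfl hb
    | unit u hu =>
      intro hx
      exact absurd hx (hu.map (aeval x)).ne_zero
    | mul a i ha hi ih =>
      intro hx
      rw [map_mul, mul_eq_zero] at hx
      rcases hx with hx | hx
      · exact ⟨i, hi, hx⟩
      · exact ih ha hx
  refine ⟨π, hπx, fun a ha => ?_⟩
  have hdeg : π.natDegree ≠ 0 := by
    intro h
    obtain ⟨c, rfl⟩ := natDegree_eq_zero.1 h
    have h0 : c = 0 := by simpa using hπx
    exact hπ.ne_zero (by rw [h0, C_0])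
  have hprim : π.IsPrimitive := hπ.isPrimitive hdeg
  have hmap : ∀ q : ℤ[X], aeval x q = 0 →
      aeval x (q.map (Int.castRingHom ℚ)) = 0 := by
    intro q hq
    rw [aeval_def, eval₂_map]
    rw [aeval_def] at hq
    rw [← hq]
    congr 1
  rw [IsPrimitive.Int.dvd_iff_map_cast_dvd_map_cast π a hprim]
  have hirr := (IsPrimitive.Int.irreducible_iff_irreducible_map_cast hprim).1 hπ
  by_contra hnd
  obtain ⟨u, v, huv⟩ := (hirr.coprime_iff_not_dvd).2 hnd
  have := congrArg (aeval x) huv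
  rw [map_add, map_mul, map_mul, hmap π hπx, hmap a ha, mul_zero, mul_zero, add_zero,
    map_one] at this
  exact zero_ne_one this

/-- The root set of `f_*` is closed under those products that are roots of `f̄`: the irreducible
polynomial of such a product divides every closed divisor. -/
theorem aeval_mul_star_eq_zero {f : ℤ[X]} (hf : f.natDegree ≠ 0) {x y : Qbar}
    (hx : aeval x (star f) = 0) (hy : aeval y (star f) = 0)
    (hxy : aeval (x * y) (bar f) = 0) : aeval (x * y) (star f) = 0 := by
  have hb := bar_ne_zero hf
  obtain ⟨π, hπ, hdvd⟩ := exists_dvd_of_aeval_eq_zero hb hxy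
  refine aeval_eq_zero_of_dvd_aeval_eq_zero (?_ : π ∣ star f) hπ
  rw [star_eq hf]
  refine dvd_setGcd fun a ha => hdvd a ?_
  have ha0 : a ≠ 0 := fun h => hb (zero_dvd_iff.1 (h ▸ ha.dvd))
  have hsa : star f ∣ a := by
    rw [star_eq hf]
    exact setGcd_dvd ha
  have hmem : x * y ∈ roots a := by
    refine ha.roots_mul ⟨Set.mul_mem_mul ?_ ?_, ?_⟩
    · exact (mem_rootSet.2 ⟨ha0, aeval_eq_zero_of_dvd_aeval_eq_zero hsa hx⟩)
    · exact (mem_rootSet.2 ⟨ha0, aeval_eq_zero_of_dvd_aeval_eq_zero hsa hy⟩)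
    · exact (mem_rootSet.2 ⟨hb, hxy⟩)
  exact (mem_rootSet.1 hmem).2

/-! ### Reduction modulo a prime -/

/-- Reduction of an integer polynomial modulo `p`. -/
noncomputable abbrev red (p : ℕ) (g : ℤ[X]) : (ZMod p)[X] := g.map (Int.castRingHom (ZMod p))

theorem isUnit_C_of_not_dvd {p : ℕ} [Fact p.Prime] {c : ℤ} (hc : ¬ (p : ℤ) ∣ c) :
    IsUnit (C (Int.castRingHom (ZMod p) c)) := by
  rw [isUnit_C, isUnit_iff_ne_zero, eq_intCast, Ne, ZMod.intCast_zmod_eq_zero_iff_dvd]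
  exact hc

theorem isCoprime_red_of_resultant {p : ℕ} [Fact p.Prime] {a c : ℤ[X]} (ha : a.natDegree ≠ 0)
    (h : ¬ (p : ℤ) ∣ resultant a c) : IsCoprime (red p a) (red p c) := by
  obtain ⟨u, v, -, -, huv⟩ := exists_mul_add_mul_eq_C_resultant a c le_rfl le_rfl (Or.inl ha)
  have h1 := congrArg (red p) huv
  simp only [red, Polynomial.map_add, Polynomial.map_mul, map_C] at h1
  obtain ⟨w, hw⟩ := (isUnit_C_of_not_dvd h).exists_left_inv
  refine ⟨w * red p u, w * red p v, ?_⟩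
  rw [← hw, ← h1]
  ring

theorem isCoprime_red_of_natDegree {p : ℕ} [Fact p.Prime] {a : ℤ[X]} (c : (ZMod p)[X])
    (ha : a.natDegree = 0) (h : ¬ (p : ℤ) ∣ a.coeff 0) : IsCoprime (red p a) c := by
  have hu : IsUnit (red p a) := by
    rw [eq_C_of_natDegree_eq_zero ha, red, map_C]
    exact isUnit_C_of_not_dvd h
  obtain ⟨w, hw⟩ := hu.exists_left_inv
  exact ⟨w, 0, by rw [hw, zero_mul, add_zero]⟩

theorem isCoprime_red_star_quo {p : ℕ} [Fact p.Prime] {f : ℤ[X]} (h : ¬ (p : ℤ) ∣ rho₂ f) :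
    IsCoprime (red p (star f)) (red p (quo (bar f) (star f))) := by
  rw [rho₂] at h
  split_ifs at h with h1 h2
  · exact isCoprime_red_of_natDegree _ h1 h
  · exact (isCoprime_red_of_natDegree _ h2 h).symm
  · exact isCoprime_red_of_resultant h1 h

theorem exists_rho₁ {p : ℕ} {f : ℤ[X]} (h : ¬ (p : ℤ) ∣ rho₁ f) (n : ℕ) (hn : 2 ≤ n) :
    ∃ r : ℤ, ¬ (p : ℤ) ∣ r ∧
      C r * star f ∈ Ideal.span {q | ∃ i < n, q = part (bar f) n i} := by
  refine ⟨rho₁ f, h, ?_⟩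
  have hne : {ρ : ℕ | 1 ≤ ρ ∧ ∀ n : ℕ, 2 ≤ n →
      (ρ : ℤ[X]) * star f ∈ Ideal.span {q | ∃ i < n, q = part (bar f) n i}}.Nonempty := by
    by_contra hne
    rw [Set.not_nonempty_iff_eq_empty] at hne
    -- `sInf ∅ = 0` is divisible by `p`
    rw [rho₁, hne, Nat.sInf_empty] at h
    exact h (by simp)
  have := (Nat.sInf_mem hne).2 n hn
  rw [rho₁]
  simpa using this

/-! ### A place of `ℚ̄` over a prime -/

/-- There is a valuation ring of `ℚ̄` over `p`, with a map to an algebraically closed field of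
characteristic `p`. -/
theorem exists_place (p : ℕ) [Fact p.Prime] :
    ∃ (V : ValuationSubring Qbar) (k : Type) (_ : Field k) (_ : IsAlgClosed k) (_ : CharP k p)
      (_ : V →+* k), ∀ c : ℤ, ¬ (p : ℤ) ∣ c → ((c : Qbar)⁻¹) ∈ V := by
  let A : Subring Qbar := (Int.castRingHom Qbar).range
  have hinj : ∀ m n : ℤ, (m : Qbar) = n → m = n := fun m n h => by exact_mod_cast h
  let pA : A := ⟨((p : ℤ) : Qbar), ⟨(p : ℤ), rfl⟩⟩
  have hI : Ideal.span {pA} ≠ ⊤ := by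
    rw [Ne, Ideal.span_singleton_eq_top]
    intro hu
    obtain ⟨⟨y, n, hy⟩, hyp⟩ := hu.exists_right_inv
    have h1 : ((p : ℤ) : Qbar) * y = 1 := congrArg Subtype.val hyp
    have h2 : (((p : ℤ) * n : ℤ) : Qbar) = ((1 : ℤ) : Qbar) := by
      rw [← hy] at h1
      push_cast
      simpa using h1
    have h3 := hinj _ _ h2
    have h4 : (p : ℤ) ∣ 1 := ⟨n, h3.symm⟩
    have h5 : p ∣ 1 := by exact_mod_cast h4
    exact (Fact.out : p.Prime).one_lt.ne' (Nat.dvd_one.1 h5)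
  obtain ⟨V, -, hV⟩ := Ideal.image_subset_nonunits_valuationSubring _ hI
  have hpV : ((p : ℤ) : Qbar) ∈ V.nonunits := hV ⟨pA, Ideal.mem_span_singleton_self _, rfl⟩
  have hpV' : ((p : ℤ) : V) ∈ IsLocalRing.maximalIdeal V := by
    rw [ValuationSubring.mem_nonunits_iff_exists_mem_maximalIdeal] at hpV
    obtain ⟨ha, hm⟩ := hpV
    rwa [show ((p : ℤ) : V) = ⟨((p : ℤ) : Qbar), ha⟩ from Subtype.ext (by simp)]
  let κ := IsLocalRing.ResidueField V
  let k := AlgebraicClosure κ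
  let φ : V →+* k := (algebraMap κ k).comp (IsLocalRing.residue V)
  have hp0 : (p : k) = 0 := by
    have : φ ((p : ℤ) : V) = 0 := by
      change algebraMap κ k (IsLocalRing.residue V _) = 0
      rw [(IsLocalRing.residue_eq_zero_iff _).2 hpV', map_zero]
    simpa using this
  refine ⟨V, k, inferInstance, inferInstance,
    (CharP.charP_iff_prime_eq_zero (Fact.out : p.Prime)).2 hp0, φ, fun c hc => ?_⟩
  have hcop : IsCoprime c (p : ℤ) := by
    have hp : Prime (p : ℤ) := Nat.prime_iff_prime_int.1 Fact.out
    exact (hp.coprime_iff_not_dvd.2 hc).symm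
  obtain ⟨u, v, huv⟩ := hcop
  have hunit : IsUnit ((c : ℤ) : V) := by
    by_contra hnu
    have hm : ((c : ℤ) : V) ∈ IsLocalRing.maximalIdeal V :=
      (IsLocalRing.mem_maximalIdeal _).2 hnu
    have h1 : ((u * c + v * p : ℤ) : V) ∈ IsLocalRing.maximalIdeal V := by
      rw [Int.cast_add, Int.cast_mul, Int.cast_mul]
      exact Ideal.add_mem _ (Ideal.mul_mem_left _ _ hm) (Ideal.mul_mem_left _ _ hpV')
    rw [huv, Int.cast_one] at h1
    exact (Ideal.ne_top_iff_one _).1 (IsLocalRing.maximalIdeal.isMaximal V).ne_top h1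
  obtain ⟨d, hd⟩ := hunit.exists_right_inv
  have h2 : (c : Qbar) * (d : Qbar) = 1 := congrArg Subtype.val hd
  rw [← eq_inv_of_mul_eq_one_right h2]
  exact d.2

theorem mem_of_isIntegral_int {V : ValuationSubring Qbar} {x : Qbar} (hx : IsIntegral ℤ x) :
    x ∈ V := by
  have h1 : IsIntegral V x := hx.tower_top
  obtain ⟨y, rfl⟩ := IsIntegrallyClosed.isIntegral_iff.1 h1
  exact y.2

/-- The roots of the reduction of an integer polynomial lift to roots in `ℚ̄`, as long as the
leading coefficient is a unit at the place. -/
theorem exists_lift_root {V : ValuationSubring Qbar} {k : Type} [Field k] (φ : V →+* k)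
    {s : ℤ[X]} (hs : s ≠ 0) (hlc : ((s.leadingCoeff : Qbar)⁻¹) ∈ V) {l : k}
    (hl : s.eval₂ (Int.castRingHom k) l = 0) :
    ∃ x : V, aeval (x : Qbar) s = 0 ∧ φ x = l := by
  have hlc0 : (s.leadingCoeff : Qbar) ≠ 0 := by exact_mod_cast leadingCoeff_ne_zero.2 hs
  have hmem : ∀ x : Qbar, aeval x s = 0 → x ∈ V := by
    intro x hx
    have h1 := isIntegral_lc_mul (mem_rootFinset.2 ⟨hs, hx⟩)
    have h2 := V.mul_mem _ _ hlc (mem_of_isIntegral_int h1)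
    rwa [inv_mul_cancel_left₀ hlc0] at h2
  let R : Multiset Qbar := (s.map (Int.castRingHom Qbar)).roots
  have hR : ∀ x ∈ R, x ∈ V := by
    intro x hx
    refine hmem x ?_
    have := (mem_roots'.1 hx).2
    rw [IsRoot.def, eval_map] at this
    exact this
  obtain ⟨R', hR'⟩ : ∃ R' : Multiset V, R'.map (Subtype.val) = R :=
    ⟨R.attach.map fun x => ⟨x.1, hR x.1 x.2⟩, by
      rw [Multiset.map_map]
      exact Multiset.attach_map_val R⟩
  have hsplit : s.map (Int.castRingHom Qbar) =
      C (s.leadingCoeff : Qbar) * (R.map fun x => X - C x).prod := by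
    have h1 := (IsAlgClosed.splits (s.map (Int.castRingHom Qbar))).eq_prod_roots
    rw [leadingCoeff_map_of_injective (RingHom.injective_int _)] at h1
    exact h1
  have hsplitV : s.map (Int.castRingHom V) =
      C (s.leadingCoeff : V) * (R'.map fun x => X - C x).prod := by
    apply map_injective V.subtype Subtype.val_injective
    rw [Polynomial.map_map, Polynomial.map_mul, map_C, Polynomial.map_multiset_prod,
      Multiset.map_map]
    have h1 : V.subtype.comp (Int.castRingHom V) = Int.castRingHom Qbar := RingHom.ext_int _ _
    rw [h1, hsplit, map_intCast, ← hR', Multiset.map_map]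
    congr 3
    funext x
    simp
  have h0 : eval₂ φ l (s.map (Int.castRingHom V)) = 0 := by
    rw [eval₂_map]
    convert hl using 2
    exact RingHom.ext_int _ _
  have hlcφ : φ (s.leadingCoeff : V) ≠ 0 := by
    intro h
    have h1 : (s.leadingCoeff : V) * ⟨_, hlc⟩ = 1 := Subtype.ext (by
      simpa using mul_inv_cancel₀ hlc0)
    have h2 := congrArg φ h1
    rw [map_mul, h, zero_mul, map_one] at h2
    exact zero_ne_one h2
  rw [hsplitV, eval₂_mul, eval₂_C, mul_eq_zero] at h0
  have h1 := h0.resolve_left hlcφ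
  rw [← coe_eval₂RingHom, map_multiset_prod, Multiset.prod_eq_zero_iff, Multiset.mem_map] at h1
  obtain ⟨q, hq, hq0⟩ := h1
  obtain ⟨x, hx, rfl⟩ := Multiset.mem_map.1 hq
  refine ⟨x, ?_, ?_⟩
  · have hxR : (x : Qbar) ∈ R := hR' ▸ Multiset.mem_map_of_mem _ hx
    have := (mem_roots'.1 hxR).2
    rw [IsRoot.def, eval_map] at this
    exact this
  · rw [coe_eval₂RingHom, eval₂_sub, eval₂_X, eval₂_C, sub_eq_zero] at hq0
    exact hq0.symm

theorem place_aeval {V : ValuationSubring Qbar} {k : Type} [Field k] (φ : V →+* k) (g : ℤ[X])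
    (x : V) : ((aeval x g : V) : Qbar) = aeval (x : Qbar) g ∧
      φ (aeval x g) = g.eval₂ (Int.castRingHom k) (φ x) := by
  constructor
  · have := hom_eval₂ g (algebraMap ℤ V) V.subtype x
    rw [aeval_def, aeval_def]
    refine this.trans ?_
    congr 1
  · rw [aeval_def, hom_eval₂]
    congr 1
    exact RingHom.ext_int _ _

/-- A product of two roots of `f_*` modulo `p` is a root of `f_*` modulo `p` if it is a root of `f̄`
modulo `p`. The two roots lift to `ℚ̄`; the product of the lifts is a root of `f̄`, since otherwise
the value of `f̄` there is a factor of `prodant f` that vanishes modulo `p`. -/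
theorem eval₂_mul_star_eq_zero {p : ℕ} [Fact p.Prime] {f : ℤ[X]} (hf : f.natDegree ≠ 0)
    (hprod : ¬ (p : ℤ) ∣ prodant f) {V : ValuationSubring Qbar} {k : Type} [Field k]
    [CharP k p] (φ : V →+* k) (hV : ((f.leadingCoeff : Qbar)⁻¹) ∈ V) {x y : k}
    (hx : (star f).eval₂ (Int.castRingHom k) x = 0) (hy : (star f).eval₂ (Int.castRingHom k) y = 0)
    (hxy : (bar f).eval₂ (Int.castRingHom k) (x * y) = 0) :
    (star f).eval₂ (Int.castRingHom k) (x * y) = 0 := by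
  classical
  have hb0 := bar_ne_zero hf
  have hf0 : f ≠ 0 := fun h => by simp [h] at hf
  have hsq := star_mul_quo hf
  have hs0 : star f ≠ 0 := fun h => hb0 (by rw [← hsq, h, zero_mul])
  have hint : ∀ n : ℤ, (n : Qbar) ∈ V := fun n => by
    simp
  have hslc : (((star f).leadingCoeff : Qbar)⁻¹) ∈ V := by
    have h1 : f.leadingCoeff = (star f).leadingCoeff * (quo (bar f) (star f)).leadingCoeff := by
      rw [← leadingCoeff_mul, hsq, leadingCoeff_bar hf]
    have hq0 : ((quo (bar f) (star f)).leadingCoeff : Qbar) ≠ 0 := by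
      have : quo (bar f) (star f) ≠ 0 := fun h => hb0 (by rw [← hsq, h, mul_zero])
      exact_mod_cast leadingCoeff_ne_zero.2 this
    have h2 := V.mul_mem _ _ hV (hint (quo (bar f) (star f)).leadingCoeff)
    rw [h1, Int.cast_mul, mul_inv, mul_assoc, inv_mul_cancel₀ hq0, mul_one] at h2
    exact h2
  obtain ⟨x', hx', rfl⟩ := exists_lift_root φ hs0 hslc hx
  obtain ⟨y', hy', rfl⟩ := exists_lift_root φ hs0 hslc hy
  have key : aeval ((x' : Qbar) * y') (bar f) = 0 := by
    by_contra hne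
    -- `prodant f` runs over the roots of `f`, which are the `norm f`-th roots of those of `f̄`
    have hm := (norm_spec hf).1
    obtain ⟨x₁, hx₁⟩ := IsAlgClosed.exists_pow_nat_eq (x' : Qbar) (Nat.pos_of_ne_zero hm)
    obtain ⟨y₁, hy₁⟩ := IsAlgClosed.exists_pow_nat_eq (y' : Qbar) (Nat.pos_of_ne_zero hm)
    have hfb : ∀ z : Qbar, aeval z f = aeval (z ^ norm f) (bar f) := by
      intro z
      conv_lhs => rw [← expand_norm_bar hf, expand_aeval]
    have hroot : ∀ z : Qbar, aeval z (star f) = 0 → aeval z (bar f) = 0 := by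
      intro z hz
      rw [← hsq, map_mul, hz, zero_mul]
    have hmem : ∀ z : Qbar, aeval z f = 0 → z ∈ V := by
      intro z hz
      have h1 := isIntegral_lc_mul (mem_rootFinset.2 ⟨hf0, hz⟩)
      have h2 := V.mul_mem _ _ hV (mem_of_isIntegral_int h1)
      rwa [inv_mul_cancel_left₀ (by exact_mod_cast leadingCoeff_ne_zero.2 hf0)] at h2
    have hvalmem : ∀ z ∈ V, aeval z f ∈ V := by
      intro z hz
      rw [← (place_aeval φ f ⟨z, hz⟩).1]
      exact Subtype.property _
    have hx₁f : aeval x₁ f = 0 := by rw [hfb, hx₁]; exact hroot _ hx'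
    have hy₁f : aeval y₁ f = 0 := by rw [hfb, hy₁]; exact hroot _ hy'
    have hval : aeval (x₁ * y₁) f = aeval ((x' : Qbar) * y') (bar f) := by
      rw [hfb, mul_pow, hx₁, hy₁]
    have hT : (x₁, y₁) ∈ (rootFinset f ×ˢ rootFinset f).filter
        (fun t => aeval (t.1 * t.2) f ≠ 0) := by
      rw [Finset.mem_filter, Finset.mem_product]
      exact ⟨⟨mem_rootFinset.2 ⟨hf0, hx₁f⟩, mem_rootFinset.2 ⟨hf0, hy₁f⟩⟩, hval ▸ hne⟩
    have hspec : ((prodant f : ℤ) : Qbar) = _ := (exists_prodant f).choose_spec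
    rw [← Finset.mul_prod_erase _ _ hT, hval] at hspec
    obtain ⟨hrest, hrest'⟩ : ∃ r : V, (r : Qbar) =
        ∏ t ∈ ((rootFinset f ×ˢ rootFinset f).filter
          (fun t => aeval (t.1 * t.2) f ≠ 0)).erase (x₁, y₁), aeval (t.1 * t.2) f := by
      refine ⟨⟨_, V.toSubring.prod_mem fun t ht => ?_⟩, rfl⟩
      have h1 := Finset.mem_product.1 (Finset.mem_filter.1 (Finset.mem_of_mem_erase ht)).1
      exact hvalmem _ (V.mul_mem _ _ (hmem _ (mem_rootFinset.1 h1.1).2)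
        (hmem _ (mem_rootFinset.1 h1.2).2))
    have hV1 : ((prodant f : ℤ) : V) = (f.leadingCoeff : V) ^ (2 * f.natDegree ^ 3) *
        (aeval (x' * y') (bar f) * hrest) := by
      apply Subtype.ext
      push_cast
      rw [hrest', (place_aeval φ (bar f) (x' * y')).1]
      exact_mod_cast hspec
    have h3 := congrArg φ hV1
    rw [map_mul, map_mul, (place_aeval φ (bar f) (x' * y')).2, map_mul, hxy, zero_mul, mul_zero,
      map_intCast] at h3
    exact hprod ((CharP.intCast_eq_zero_iff k p _).1 h3)
  have h1 := aeval_mul_star_eq_zero hf hx' hy' key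
  have h2 := place_aeval φ (star f) (x' * y')
  have h3 : aeval (x' * y') (star f) = 0 := Subtype.ext (by rw [h2.1]; exact h1)
  rw [← map_mul, ← h2.2, h3, map_zero]

/-- There is an integer polynomial `h` that vanishes modulo `p` at all products of two roots
of `s` and is coprime modulo `p` to `t`; the vanishing is stated for nilpotent values in an arbitrary
commutative ring. -/
def HasProductPolynomial.{u} (p : ℕ) (s t : ℤ[X]) : Prop :=
  ∃ h : ℤ[X], IsCoprime (red p h) (red p t) ∧ ∀ {S : Type u} [CommRing S] (x y : S),
    IsNilpotent (p : S) → IsNilpotent (aeval x s) → IsNilpotent (aeval y s) →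
      IsNilpotent (aeval (x * y) h)

/-- If no product of two roots of `s` modulo `p` is a root of `t` modulo `p`, then a lift of
the product of the minimal polynomials of these products is as required: nilpotency can be tested
in the residue fields of the prime ideals. -/
theorem hasProductPolynomial_of_forall {p : ℕ} [Fact p.Prime] {s t : ℤ[X]} (hs : red p s ≠ 0)
    (k : Type) [Field k] [IsAlgClosed k] [CharP k p]
    (H : ∀ x y : k, s.eval₂ (Int.castRingHom k) x = 0 → s.eval₂ (Int.castRingHom k) y = 0 →
      t.eval₂ (Int.castRingHom k) (x * y) ≠ 0) : HasProductPolynomial.{u} p s t := by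
  classical
  let _ := ZMod.algebra k p
  have hred : ∀ (F : Type u) [Field F] [Algebra (ZMod p) F] (g : ℤ[X]) (x : F),
      aeval x (red p g) = g.eval₂ (Int.castRingHom F) x := by
    intro F _ _ g x
    rw [aeval_def, red, eval₂_map]
    congr 1
    exact RingHom.ext_int _ _
  have hredk : ∀ (g : ℤ[X]) (x : k), aeval x (red p g) = g.eval₂ (Int.castRingHom k) x := by
    intro g x
    rw [aeval_def, red, eval₂_map]
    congr 1
    exact RingHom.ext_int _ _
  let R : Finset k := ((red p s).aroots k).toFinset
  have hR : ∀ x : k, x ∈ R ↔ aeval x (red p s) = 0 := by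
    intro x
    rw [Multiset.mem_toFinset, mem_aroots]
    exact ⟨fun h => h.2, fun h => ⟨hs, h⟩⟩
  have hint : ∀ x ∈ R, IsIntegral (ZMod p) x := fun x hx =>
    (isAlgebraic_iff_isIntegral).1 ⟨red p s, hs, (hR x).1 hx⟩
  let h₀ : (ZMod p)[X] := ∏ z ∈ R ×ˢ R, minpoly (ZMod p) (z.1 * z.2)
  obtain ⟨h, hh⟩ := map_surjective (Int.castRingHom (ZMod p)) (ZMod.ringHom_surjective _) h₀
  refine ⟨h, ?_, ?_⟩
  · rw [red, hh]
    refine IsCoprime.prod_left fun z hz => ?_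
    rw [Finset.mem_product] at hz
    rw [(minpoly.irreducible ((hint _ hz.1).mul (hint _ hz.2))).coprime_iff_not_dvd]
    intro hd
    refine H z.1 z.2 ?_ ?_ ?_
    · rw [← hredk]; exact (hR _).1 hz.1
    · rw [← hredk]; exact (hR _).1 hz.2
    · rw [← hredk]
      exact (minpoly.dvd_iff).1 hd
  · intro S _ x y hp hx hy
    rw [nilpotent_iff_mem_prime] at hp hx hy ⊢
    intro J hJ
    let F := J.ResidueField
    let ψ : S →+* F := algebraMap S F
    have hψ : ∀ z : S, ψ z = 0 ↔ z ∈ J := fun z => Ideal.algebraMap_residueField_eq_zero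
    have hpF : (p : F) = 0 := by
      rw [← map_natCast ψ, hψ]
      exact hp J hJ
    have : CharP F p := (CharP.charP_iff_prime_eq_zero (Fact.out : p.Prime)).2 hpF
    let _ := ZMod.algebra F p
    have hψev : ∀ (g : ℤ[X]) (z : S), ψ (aeval z g) = aeval (ψ z) (red p g) := by
      intro g z
      rw [hred, aeval_def, hom_eval₂]
      congr 1
      exact RingHom.ext_int _ _
    rw [← hψ, hψev, map_mul]
    have hx0 : aeval (ψ x) (red p s) = 0 := by rw [← hψev, hψ]; exact hx J hJ
    have hy0 : aeval (ψ y) (red p s) = 0 := by rw [← hψev, hψ]; exact hy J hJ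
    let E := IntermediateField.adjoin (ZMod p) {ψ x, ψ y}
    have : Algebra.IsAlgebraic (ZMod p) E := by
      refine IntermediateField.isAlgebraic_adjoin ?_
      rintro z (rfl | rfl)
      · exact (isAlgebraic_iff_isIntegral).1 ⟨red p s, hs, hx0⟩
      · exact (isAlgebraic_iff_isIntegral).1 ⟨red p s, hs, hy0⟩
    let θ : E →ₐ[ZMod p] k := IsAlgClosed.lift
    let xE : E := ⟨ψ x, IntermediateField.subset_adjoin _ _ (Or.inl rfl)⟩
    let yE : E := ⟨ψ y, IntermediateField.subset_adjoin _ _ (Or.inr rfl)⟩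
    have hE : ∀ (z : E) (g : (ZMod p)[X]), aeval (z : F) g = 0 ↔ aeval z g = 0 := by
      intro z g
      have h1 : aeval (E.val z) g = E.val (aeval z g) := aeval_algHom_apply E.val z g
      rw [show ((z : E) : F) = E.val z from rfl, h1, map_eq_zero]
    have hθ : ∀ (z : E) (g : (ZMod p)[X]), aeval (θ z) g = 0 ↔ aeval z g = 0 := by
      intro z g
      rw [aeval_algHom_apply, map_eq_zero]
    have hxR : θ xE ∈ R := (hR _).2 ((hθ _ _).2 ((hE xE _).1 hx0))
    have hyR : θ yE ∈ R := (hR _).2 ((hθ _ _).2 ((hE yE _).1 hy0))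
    refine (hE (xE * yE) _).2 ((hθ _ _).1 ?_)
    rw [red, hh, map_mul]
    exact aeval_eq_zero_of_dvd_aeval_eq_zero
      (Finset.dvd_prod_of_mem (fun z : k × k => minpoly (ZMod p) (z.1 * z.2))
        (Finset.mk_mem_product hxR hyR)) (minpoly.aeval _ _)

/-- Modulo `p`, a product of two roots of `f_*` that is a root of `f̄ / f_*` would be a common root
of `f_*` and `f̄ / f_*`, which are coprime. -/
theorem hasProductPolynomial_star {p : ℕ} [Fact p.Prime] {f : ℤ[X]} (hf : f.natDegree ≠ 0)
    (hlc : ¬ (p : ℤ) ∣ f.leadingCoeff) (h₂ : ¬ (p : ℤ) ∣ rho₂ f)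
    (hprod : ¬ (p : ℤ) ∣ prodant f) :
    HasProductPolynomial.{u} p (star f) (quo (bar f) (star f)) := by
  obtain ⟨V, k, _, _, _, φ, hV⟩ := exists_place p
  have hsq := star_mul_quo hf
  have hs : red p (star f) ≠ 0 := by
    intro h
    have h1 : ((bar f).map (Int.castRingHom (ZMod p))).coeff (bar f).natDegree = 0 := by
      rw [← hsq, Polynomial.map_mul]
      rw [red] at h
      rw [h, zero_mul, coeff_zero]
    rw [coeff_map, coeff_natDegree, leadingCoeff_bar hf, eq_intCast,
      ZMod.intCast_zmod_eq_zero_iff_dvd] at h1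
    exact hlc h1
  refine hasProductPolynomial_of_forall hs k fun x y hx hy hxy => ?_
  have hb : (bar f).eval₂ (Int.castRingHom k) (x * y) = 0 := by
    rw [← hsq, eval₂_mul, hxy, mul_zero]
  have h0 := eval₂_mul_star_eq_zero hf hprod φ (hV _ hlc) hx hy hb
  obtain ⟨u, v, huv⟩ := isCoprime_red_star_quo h₂
  let _ := ZMod.algebra k p
  have hred : ∀ (g : ℤ[X]) (x : k), aeval x (red p g) = g.eval₂ (Int.castRingHom k) x := by
    intro g x
    rw [aeval_def, red, eval₂_map]
    congr 1
    exact RingHom.ext_int _ _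
  have h1 := congrArg (aeval (x * y)) huv
  rw [map_add, map_mul, map_mul, hred, hred, h0, hxy, mul_zero, mul_zero, add_zero, map_one] at h1
  exact zero_ne_one h1

/-! ### The number of irreducible factors -/

theorem irr_eq_of_associated_prod {f : ℤ[X]} {m : Multiset ℤ[X]} (hm : ∀ q ∈ m, Irreducible q)
    (h : Associated m.prod f) :
    irr f = Multiset.card (m.filter fun q => 0 < q.natDegree) := by
  classical
  have hf : f ≠ 0 := by
    rintro rfl
    rw [associated_zero_iff_eq_zero, Multiset.prod_eq_zero_iff] at h
    exact (hm 0 h).ne_zero rfl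
  have hrel := UniqueFactorizationMonoid.factors_unique
    (fun q hq => UniqueFactorizationMonoid.irreducible_of_factor q hq) hm
    ((UniqueFactorizationMonoid.factors_prod hf).trans h.symm)
  rw [irr]
  clear h hf hm
  generalize UniqueFactorizationMonoid.factors f = m' at hrel ⊢
  induction hrel with
  | zero => simp
  | cons hab _ ih =>
    have hd : Polynomial.natDegree _ = Polynomial.natDegree _ :=
      natDegree_eq_of_degree_eq (degree_eq_degree_of_associated hab)
    rw [Multiset.filter_cons, Multiset.filter_cons, Multiset.card_add, Multiset.card_add, ih, hd]
    split_ifs <;> simp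

theorem irr_mul {f g : ℤ[X]} (hf : f ≠ 0) (hg : g ≠ 0) : irr (f * g) = irr f + irr g := by
  classical
  have h := irr_eq_of_associated_prod (f := f * g)
    (m := UniqueFactorizationMonoid.factors f + UniqueFactorizationMonoid.factors g)
    (fun q hq => (Multiset.mem_add.1 hq).elim (UniqueFactorizationMonoid.irreducible_of_factor q)
      (UniqueFactorizationMonoid.irreducible_of_factor q))
    (by
      rw [Multiset.prod_add]
      exact (UniqueFactorizationMonoid.factors_prod hf).mul_mul
        (UniqueFactorizationMonoid.factors_prod hg))
  rw [h, Multiset.filter_add, Multiset.card_add]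
  rfl

theorem irr_pos {f : ℤ[X]} (hf : f.natDegree ≠ 0) : 0 < irr f := by
  classical
  have hf0 : f ≠ 0 := fun h => by simp [h] at hf
  by_contra h
  rw [irr, Nat.not_lt, Nat.le_zero, Multiset.card_eq_zero, Multiset.filter_eq_nil] at h
  apply hf
  rw [← natDegree_eq_of_degree_eq (degree_eq_degree_of_associated
    (UniqueFactorizationMonoid.factors_prod hf0)), natDegree_multiset_prod]
  · refine Multiset.sum_eq_zero fun n hn => ?_
    obtain ⟨q, hq, rfl⟩ := Multiset.mem_map.1 hn
    exact Nat.le_zero.1 (Nat.not_lt.1 (h q hq))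
  · exact fun h0 => (UniqueFactorizationMonoid.irreducible_of_factor _ h0).ne_zero rfl

theorem irr_le_irr_expand {g : ℤ[X]} (hg : g ≠ 0) {n : ℕ} (hn : 0 < n) :
    irr g ≤ irr (expand ℤ n g) := by
  classical
  induction g using WfDvdMonoid.induction_on_irreducible with
  | zero => exact absurd rfl hg
  | unit u hu =>
    have : u.natDegree = 0 := natDegree_eq_zero_of_isUnit hu
    obtain ⟨c, rfl⟩ := natDegree_eq_zero.1 this
    rw [expand_C]
  | mul a i ha hi ih =>
    have hea : expand ℤ n a ≠ 0 := (expand_ne_zero hn).2 ha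
    have hei : expand ℤ n i ≠ 0 := (expand_ne_zero hn).2 hi.ne_zero
    rw [map_mul, irr_mul hi.ne_zero ha, irr_mul hei hea]
    refine Nat.add_le_add ?_ (ih ha)
    have h1 : irr i = Multiset.card (({i} : Multiset ℤ[X]).filter fun q => 0 < q.natDegree) :=
      irr_eq_of_associated_prod (fun q hq => by rwa [Multiset.mem_singleton.1 hq])
        (by rw [Multiset.prod_singleton])
    by_cases hd : i.natDegree = 0
    · rw [h1, Multiset.filter_singleton, if_neg (by omega)]
      simp
    · have h2 : 0 < irr (expand ℤ n i) := irr_pos (by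
        rw [natDegree_expand]
        exact Nat.mul_ne_zero hd hn.ne')
      rw [h1, Multiset.filter_singleton, if_pos (Nat.pos_of_ne_zero hd), Multiset.card_singleton]
      exact h2

/-! ### `Δ` lowers the number of irreducible factors -/

/-- A polynomial, not constant and not a polynomial in a higher power of `x`, whose closed divisors
all have full degree. -/
structure HasNoProperClosedDivisor (b : ℤ[X]) : Prop where
  natDegree_ne_zero : b.natDegree ≠ 0
  eq_one_of_expand : ∀ (n : ℕ) (g : ℤ[X]), b = expand ℤ n g → n = 1
  natDegree_eq : ∀ a, IsClosedDivisor a b → a.natDegree = b.natDegree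

theorem norm_eq_one {b : ℤ[X]} (hb : b.natDegree ≠ 0)
    (h : ∀ (n : ℕ) (g : ℤ[X]), b = expand ℤ n g → n = 1) : norm b = 1 := by
  obtain ⟨-, g, hg⟩ := norm_spec hb
  exact h _ g hg

theorem bar_eq_self {b : ℤ[X]} (hb : b.natDegree ≠ 0)
    (h : ∀ (n : ℕ) (g : ℤ[X]), b = expand ℤ n g → n = 1) : bar b = b := by
  have h1 := expand_norm_bar hb
  rwa [norm_eq_one hb h, expand_one] at h1

theorem eq_one_of_bar_eq_expand {f : ℤ[X]} (hf : f.natDegree ≠ 0) (n : ℕ) (g : ℤ[X])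
    (h : bar f = expand ℤ n g) : n = 1 := by
  have hn0 : n ≠ 0 := by
    rintro rfl
    have h1 := bar_natDegree_ne_zero hf
    rw [h, natDegree_expand, mul_zero] at h1
    exact h1 rfl
  have h1 : f = expand ℤ (norm f * n) g := by
    rw [expand_mul, ← h, expand_norm_bar hf]
  have hle : ∀ n ∈ {n : ℕ | ∃ g : ℤ[X], f = expand ℤ n g}, n ≤ f.natDegree := by
    rintro n ⟨g, hg⟩
    have h1 := natDegree_expand n g
    rw [← hg] at h1
    have h2 := hf
    rw [h1] at h2 ⊢
    exact Nat.le_mul_of_pos_left n (Nat.pos_of_ne_zero fun h => h2 (by simp [h]))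
  have h2 : norm f * n ≤ norm f := by
    conv_rhs => rw [norm, if_neg hf]
    exact le_csSup ⟨_, hle⟩ ⟨g, h1⟩
  have h3 := Nat.pos_of_ne_zero (norm_spec hf).1
  have h4 : n ≤ 1 := by
    by_contra hlt
    have : norm f * 2 ≤ norm f * n := Nat.mul_le_mul_left _ (by omega)
    omega
  omega

theorem primPart_dvd_of_natDegree_eq {a b : ℤ[X]} (hb : b ≠ 0) (h : a ∣ b)
    (hd : a.natDegree = b.natDegree) : b.primPart ∣ a := by
  obtain ⟨c, hc⟩ := h
  have ha0 : a ≠ 0 := fun h => hb (by rw [hc, h, zero_mul])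
  have hc0 : c ≠ 0 := fun h => hb (by rw [hc, h, mul_zero])
  have hcd : c.natDegree = 0 := by
    have := natDegree_mul ha0 hc0
    rw [← hc] at this
    omega
  have h1 : a.primPart ∣ b.primPart :=
    (a.isPrimitive_primPart.dvd_primPart_iff_dvd hb).2
      ((primPart_dvd a).trans ⟨c, hc⟩)
  obtain ⟨e, he⟩ := h1
  have hp0 : b.primPart ≠ 0 := b.isPrimitive_primPart.ne_zero
  have hed : e.natDegree = 0 := by
    have h2 : a.primPart ≠ 0 := fun h => hp0 (by rw [he, h, zero_mul])
    have h3 : e ≠ 0 := fun h => hp0 (by rw [he, h, mul_zero])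
    have h4 := natDegree_mul h2 h3
    rw [← he, natDegree_primPart, natDegree_primPart] at h4
    omega
  obtain ⟨r, rfl⟩ := natDegree_eq_zero.1 hed
  have hu : IsUnit (C r : ℤ[X]) := isUnit_C.2
    (b.isPrimitive_primPart r ⟨a.primPart, by rw [he, mul_comm]⟩)
  rw [he]
  exact (hu.mul_right_dvd).2 (primPart_dvd a)

theorem dvd_of_isPrimitive_of_dvd_C_mul {d q : ℤ[X]} {c : ℤ} (hc : c ≠ 0) (hd : d.IsPrimitive)
    (h : d ∣ C c * q) : d ∣ q := by
  rw [IsPrimitive.Int.dvd_iff_map_cast_dvd_map_cast _ _ hd] at h ⊢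
  rw [Polynomial.map_mul, map_C] at h
  have hu : IsUnit (C (Int.castRingHom ℚ c)) := by
    rw [isUnit_C, isUnit_iff_ne_zero]
    simpa using hc
  exact (hu.dvd_mul_left).1 h

theorem HasNoProperClosedDivisor.natDegree_setGcd {b : ℤ[X]} (h : HasNoProperClosedDivisor b) :
    (setGcd {a | IsClosedDivisor a b}).natDegree = b.natDegree := by
  have hb0 : b ≠ 0 := fun h0 => h.natDegree_ne_zero (by rw [h0, natDegree_zero])
  have hs : setGcd {a | IsClosedDivisor a b} ∣ b :=
    setGcd_dvd (S := {a | IsClosedDivisor a b}) (isClosedDivisor_self hb0)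
  refine le_antisymm (natDegree_le_of_dvd hs hb0) ?_
  have h1 : b.primPart ∣ setGcd {a | IsClosedDivisor a b} :=
    dvd_setGcd fun a ha => primPart_dvd_of_natDegree_eq hb0 ha.dvd (h.natDegree_eq a ha)
  rw [← natDegree_primPart b]
  exact natDegree_le_of_dvd h1 fun h0 => hb0 (zero_dvd_iff.1 (h0 ▸ hs))

/-- If all closed divisors of `b` have full degree, then so have those of their gcd. -/
theorem HasNoProperClosedDivisor.star {b : ℤ[X]} (h : HasNoProperClosedDivisor b) :
    HasNoProperClosedDivisor (star b) := by
  have hb0 : b ≠ 0 := fun h0 => h.natDegree_ne_zero (by rw [h0, natDegree_zero])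
  have hstar : HigmanSolvable.star b = setGcd {a | IsClosedDivisor a b} := by
    rw [star_eq h.natDegree_ne_zero, bar_eq_self h.natDegree_ne_zero h.eq_one_of_expand]
  have hsdeg := h.natDegree_setGcd
  rw [← hstar] at hsdeg
  set s := HigmanSolvable.star b with hs
  have hsb : s ∣ b := by
    rw [hstar]
    exact setGcd_dvd (S := {a | IsClosedDivisor a b}) (isClosedDivisor_self hb0)
  obtain ⟨c, hc⟩ := hsb
  have hs0 : s ≠ 0 := fun h => hb0 (by rw [hc, h, zero_mul])
  have hc0 : c ≠ 0 := fun h => hb0 (by rw [hc, h, mul_zero])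
  have hcd : c.natDegree = 0 := by
    have := natDegree_mul hs0 hc0
    rw [← hc] at this
    omega
  obtain ⟨r, rfl⟩ := natDegree_eq_zero.1 hcd
  refine ⟨hsdeg ▸ h.natDegree_ne_zero, fun n g hg => ?_, fun a ha => ?_⟩
  · refine h.eq_one_of_expand n (g * C r) ?_
    rw [map_mul, expand_C, ← hg, hc]
  · have ha0 : a ≠ 0 := fun h => hs0 (zero_dvd_iff.1 (h ▸ ha.dvd))
    have hab : a ∣ b := ha.dvd.trans ⟨_, hc⟩
    -- `C b.content * a.primPart` has the degree of `a` and is a closed divisor of `b`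
    have hcont : (C b.content : ℤ[X]) ≠ 0 := by simpa using (content_eq_zero_iff.not.2 hb0)
    have hprim : a.primPart ∣ b.primPart :=
      (a.isPrimitive_primPart.dvd_primPart_iff_dvd hb0).2 ((primPart_dvd a).trans hab)
    obtain ⟨e, he⟩ := hprim
    have ha'b : C b.content * a.primPart * e = b := by
      rw [mul_assoc, ← he]
      exact b.eq_C_content_mul_primPart.symm
    have hcontdvd : a.content ∣ b.content := by
      obtain ⟨q, rfl⟩ := hab
      exact ⟨q.content, content_mul⟩
    have haa' : a ∣ C b.content * a.primPart := by
      conv_lhs => rw [a.eq_C_content_mul_primPart]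
      exact mul_dvd_mul (map_dvd C hcontdvd) dvd_rfl
    have ha'0 : C b.content * a.primPart ≠ 0 :=
      mul_ne_zero hcont a.isPrimitive_primPart.ne_zero
    have hda' : (C b.content * a.primPart).natDegree = a.natDegree := by
      rw [natDegree_C_mul (content_eq_zero_iff.not.2 hb0), natDegree_primPart]
    have hroots : ∀ g : ℤ[X], ∀ d : ℤ, d ≠ 0 → roots (C d * g) = roots g := by
      intro g d hd
      ext x
      rw [roots, roots, mem_rootSet, mem_rootSet, map_mul, aeval_C]
      simp [hd]
    rw [hsdeg, ← hda']
    refine h.natDegree_eq _ ⟨⟨e, ha'b.symm⟩, fun u hu hub => ?_, ?_, ?_⟩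
    · refine (ha.powerful_dvd u hu ?_).trans haa'
      rw [hstar]
      exact dvd_setGcd fun a' ha' => ha'.powerful_dvd u hu hub
    · have h1 : roots (C b.content * a.primPart) = roots a := by
        rw [hroots _ _ (content_eq_zero_iff.not.2 hb0)]
        conv_rhs => rw [a.eq_C_content_mul_primPart, hroots _ _ (content_eq_zero_iff.not.2 ha0)]
      have h2 : roots b = roots s := by
        rw [hc, mul_comm, hroots _ _ fun h => hc0 (by rw [h, C_0])]
      rw [h1, h2]
      exact ha.roots_mul
    · have h1 : quo b (C b.content * a.primPart) = e :=
        mul_left_cancel₀ ha'0 ((mul_quo ⟨e, ha'b.symm⟩).trans ha'b.symm)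
      rw [h1]
      intro d hda hde
      have hdprim : d.IsPrimitive :=
        isPrimitive_of_dvd b.isPrimitive_primPart (hde.trans ⟨_, by rw [he, mul_comm]⟩)
      refine ha.relPrime ((dvd_of_isPrimitive_of_dvd_C_mul (content_eq_zero_iff.not.2 hb0)
        hdprim hda).trans (primPart_dvd a)) ?_
      have hr0 : r ≠ 0 := fun h => hc0 (by rw [h, C_0])
      refine dvd_of_isPrimitive_of_dvd_C_mul (mul_ne_zero (content_eq_zero_iff.not.2 ha0) hr0)
        hdprim ((hde.trans (Dvd.intro_left (C b.content) rfl)).trans (dvd_of_eq ?_))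
      refine mul_left_cancel₀ a.isPrimitive_primPart.ne_zero ?_
      calc a.primPart * (C b.content * e) = C b.content * a.primPart * e := by ring
        _ = b := ha'b
        _ = a * quo s a * C r := by rw [mul_quo ha.dvd, hc]
        _ = C a.content * a.primPart * quo s a * C r := by
          rw [← a.eq_C_content_mul_primPart]
        _ = _ := by rw [C_mul]; ring

theorem natDegree_iterate_Delta_ne_zero {b : ℤ[X]} (h : HasNoProperClosedDivisor b) (l : ℕ) :
    (Delta^[l] b).natDegree ≠ 0 := by
  induction l generalizing b with
  | zero => exact h.natDegree_ne_zero
  | succ l ih =>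
    rw [Function.iterate_succ_apply]
    exact ih h.star

/-- If `f_*` has the degree of `f̄`, then `f̄` has no closed divisors of smaller degree, and this
property is inherited by all `Δ^l(f)`, none of which can be constant. -/
theorem irr_star_lt {f : ℤ[X]} (hf : f.natDegree ≠ 0) (hsolv : ∃ l, (Delta^[l] f).natDegree = 0) :
    irr (star f) < irr f := by
  have hb := bar_ne_zero hf
  have hsq := star_mul_quo hf
  have hs0 : star f ≠ 0 := fun h => hb (by rw [← hsq, h, zero_mul])
  have hq0 : quo (bar f) (star f) ≠ 0 := fun h => hb (by rw [← hsq, h, mul_zero])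
  have h1 : irr (bar f) ≤ irr f := by
    conv_rhs => rw [← expand_norm_bar hf]
    exact irr_le_irr_expand hb (Nat.pos_of_ne_zero (norm_spec hf).1)
  refine lt_of_lt_of_le ?_ h1
  conv_rhs => rw [← hsq, irr_mul hs0 hq0]
  refine Nat.lt_add_of_pos_right (irr_pos fun hq => ?_)
  have hdeg : (star f).natDegree = (bar f).natDegree := by
    rw [← hsq, natDegree_mul hs0 hq0, hq, add_zero]
  have hno : HasNoProperClosedDivisor (bar f) := by
    refine ⟨bar_natDegree_ne_zero hf, eq_one_of_bar_eq_expand hf, fun a ha => ?_⟩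
    have ha0 : a ≠ 0 := fun h => hb (zero_dvd_iff.1 (h ▸ ha.dvd))
    refine le_antisymm (natDegree_le_of_dvd ha.dvd hb) ?_
    rw [← hdeg, star_eq hf]
    exact natDegree_le_of_dvd (setGcd_dvd ha) ha0
  obtain ⟨l, hl⟩ := hsolv
  cases l with
  | zero => exact hf hl
  | succ l =>
    rw [Function.iterate_succ_apply] at hl
    have h2 : Delta f = Delta (bar f) := by
      rw [Delta, Delta, star_eq hf, star_eq (bar_natDegree_ne_zero hf),
        bar_eq_self (bar_natDegree_ne_zero hf) (eq_one_of_bar_eq_expand hf)]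
    rw [h2, ← Function.iterate_succ_apply] at hl
    exact natDegree_iterate_Delta_ne_zero hno _ hl

/-! ### Permuted weight spaces -/

theorem sum_part (b : ℤ[X]) {n : ℕ} (hn : 0 < n) : ∑ i ∈ Finset.range n, part b n i = b := by
  conv_rhs => rw [b.as_sum_range]
  rw [← Finset.sum_fiberwise_of_maps_to (s := Finset.range (b.natDegree + 1))
    (t := Finset.range n) (g := fun j => j % n)
    (fun j _ => Finset.mem_range.2 (Nat.mod_lt j hn))]
  refine Finset.sum_congr rfl fun i hi => ?_
  rw [part]
  refine Finset.sum_congr (Finset.filter_congr fun j _ => ?_) fun _ _ => rfl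
  rw [Nat.ModEq, Nat.mod_eq_of_lt (Finset.mem_range.1 hi)]

section Weights

variable {k V L : Type*} [Field k] [AddCommGroup V] [Module k V] [Group L]

/-- The joint generalised eigenspace of a family of endomorphisms. -/
def weightSpace (ρ : L →* Module.End k V) (χ : L → k) : Submodule k V :=
  ⨅ l, (ρ l).maxGenEigenspace (χ l)

theorem weightSpace_map {ρ : L →* Module.End k V} {σ : L ≃* L} {B : Module.End k V}
    (hB : ∀ l, ρ (σ l) * B = B * ρ l) (χ : L → k) {v : V} (hv : v ∈ weightSpace ρ χ) :
    B v ∈ weightSpace ρ fun l => χ (σ.symm l) := by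
  rw [weightSpace, Submodule.mem_iInf] at hv ⊢
  intro l
  have h1 := hv (σ.symm l)
  rw [Module.End.mem_maxGenEigenspace] at h1 ⊢
  obtain ⟨n, hn⟩ := h1
  refine ⟨n, ?_⟩
  have hc : SemiconjBy B (ρ (σ.symm l) - χ (σ.symm l) • 1) (ρ l - χ (σ.symm l) • 1) := by
    have h2 := hB (σ.symm l)
    rw [σ.apply_symm_apply] at h2
    rw [SemiconjBy, mul_sub, sub_mul, ← h2]
    simp
  have h3 := congrArg (fun T => T v) (hc.pow_right n).eq
  simp only [Module.End.mul_apply] at h3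
  rw [← h3, hn, map_zero]

theorem weightSpace_iterate {ρ : L →* Module.End k V} {σ : L ≃* L} {B : Module.End k V}
    (hB : ∀ l, ρ (σ l) * B = B * ρ l) (χ : L → k) {v : V} (hv : v ∈ weightSpace ρ χ) (j : ℕ) :
    (B ^ j) v ∈ weightSpace ρ ((fun (ψ : L → k) l => ψ (σ.symm l))^[j] χ) := by
  induction j with
  | zero => simpa using hv
  | succ j ih =>
    rw [pow_succ', Function.iterate_succ_apply']
    exact weightSpace_map hB _ ih

/-- Let a finite group act on `V` by commuting semisimple operators without common fixed points,
and let `B` normalize this action, inducing an automorphism for which every group element acts as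
a commutator `l⁻¹ σ(l)`. Then every orbit of `B` on the weights has some length `n ≥ 2`, so
a relation `b(B) = 0` splits into the relations given by the parts of `b` modulo `n`. -/
theorem aeval_eq_zero_of_weights [IsAlgClosed k] [FiniteDimensional k V] [Finite L]
    (ρ : L →* Module.End k V) (hcomm : ∀ a b, Commute (ρ a) (ρ b))
    (hss : ∀ l, (ρ l).IsSemisimple) (hfix : ∀ v, (∀ l, ρ l v = v) → v = 0) (σ : L ≃* L)
    (B : Module.End k V) (hB : ∀ l, ρ (σ l) * B = B * ρ l)
    (hσ : ∀ l, ∃ l', ρ l = ρ (l'⁻¹ * σ l')) {b s : ℤ[X]} (hb : aeval B b = 0)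
    (hr : ∀ n : ℕ, 2 ≤ n → ∃ r : ℤ, (r : k) ≠ 0 ∧
      C r * s ∈ Ideal.span {q | ∃ i < n, q = part b n i}) : aeval B s = 0 := by
  classical
  have htop : ⨆ χ : L → k, weightSpace ρ χ = ⊤ :=
    Module.End.iSup_iInf_maxGenEigenspace_eq_top_of_iSup_maxGenEigenspace_eq_top_of_commute ρ
      (fun i j _ => hcomm i j) fun i => Module.End.iSup_maxGenEigenspace_eq_top (ρ i)
  have hind : iSupIndep fun χ : L → k => weightSpace ρ χ :=
    Module.End.independent_iInf_maxGenEigenspace_of_forall_mapsTo ρ fun i j φ =>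
      Module.End.mapsTo_maxGenEigenspace_of_comm (hcomm j i) φ
  suffices h : ∀ χ : L → k, weightSpace ρ χ ≤ LinearMap.ker (aeval B s) by
    have h1 : (⊤ : Submodule k V) ≤ LinearMap.ker (aeval B s) := htop ▸ iSup_le h
    exact LinearMap.ker_eq_top.1 (top_le_iff.1 h1)
  intro χ v hv
  by_cases hv0 : v = 0
  · rw [hv0]; exact Submodule.zero_mem _
  let e : (L → k) → (L → k) := fun ψ l => ψ (σ.symm l)
  -- the orbit of `χ` is not a single point, since otherwise `v` is a common fixed point
  have hne : e χ ≠ χ := by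
    intro he
    apply hv0
    have heig : ∀ l, ρ l v = χ l • v := by
      intro l
      have h1 := (Submodule.mem_iInf _).1 hv l
      rw [(hss l).isFinitelySemisimple.maxGenEigenspace_eq_eigenspace,
        Module.End.mem_eigenspace_iff] at h1
      exact h1
    refine hfix v fun l => ?_
    obtain ⟨l', hl'⟩ := hσ l
    have h2 : χ (σ l') = χ l' := by
      have := congrFun he (σ l')
      simp only [e, σ.symm_apply_apply] at this
      exact this.symm
    rw [hl', map_mul, Module.End.mul_apply, heig (σ l'), h2, ← heig l', ← Module.End.mul_apply,
      ← map_mul, inv_mul_cancel, map_one, Module.End.one_apply]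
  have hper : χ ∈ Function.periodicPts e := by
    have hinj : Function.Injective e := fun ψ ψ' h => by
      funext l
      have := congrFun h (σ l)
      simpa [e] using this
    have hfin : ∃ n, 0 < n ∧ (σ.symm ^ n : MulAut L) = 1 := by
      have : Finite (MulAut L) := inferInstance
      exact ⟨orderOf (G := MulAut L) σ.symm, orderOf_pos _, pow_orderOf_eq_one _⟩
    obtain ⟨n, hn, hσn⟩ := hfin
    refine ⟨n, hn, ?_⟩
    have hit : ∀ m : ℕ, e^[m] χ = fun l => χ ((σ.symm ^ m : MulAut L) l) := by
      intro m
      induction m with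
      | zero => rfl
      | succ m ih =>
        rw [Function.iterate_succ_apply', ih]
        rfl
    rw [Function.IsPeriodicPt, Function.IsFixedPt, hit, hσn]
    rfl
  set n := Function.minimalPeriod e χ with hn
  have hn0 : 0 < n := Function.minimalPeriod_pos_of_mem_periodicPts hper
  have hn2 : 2 ≤ n := by
    rcases Nat.lt_or_ge n 2 with h | h
    · exfalso
      have h1 : n = 1 := by omega
      exact hne (Function.minimalPeriod_eq_one_iff_isFixedPt.1 h1)
    · exact h
  have hmem : ∀ i, aeval B (part b n i) v ∈ weightSpace ρ (e^[i] χ) := by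
    intro i
    rw [part, map_sum, LinearMap.sum_apply]
    refine Submodule.sum_mem _ fun j hj => ?_
    have hji : j ≡ i [MOD n] := (Finset.mem_filter.1 hj).2
    have h1 := weightSpace_iterate hB χ hv j
    have h2 : e^[j] χ = e^[i] χ := by
      rw [← Function.iterate_mod_minimalPeriod_eq (f := e) (n := j),
        ← Function.iterate_mod_minimalPeriod_eq (f := e) (n := i), ← hn, hji]
    rw [← h2, aeval_monomial, ← Algebra.smul_def]
    have h3 : (b.coeff j • B ^ j) v = b.coeff j • ((B ^ j) v) := rfl
    rw [h3]
    exact zsmul_mem h1 _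
  have hzero : ∀ i ∈ Finset.range n, aeval B (part b n i) v = 0 := by
    have hinjOn : Set.InjOn (fun i => e^[i] χ) (Finset.range n : Set ℕ) := by
      intro i hi j hj hij
      exact Function.iterate_injOn_Iio_minimalPeriod (by simpa using hi) (by simpa using hj) hij
    have hsum : ∑ i ∈ Finset.range n, aeval B (part b n i) v = 0 := by
      rw [← LinearMap.sum_apply, ← map_sum, sum_part b hn0, hb, LinearMap.zero_apply]
    have hind' : iSupIndep fun i : Finset.range n => weightSpace ρ (e^[(i : ℕ)] χ) :=
      hind.comp (f := fun i : Finset.range n => e^[(i : ℕ)] χ)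
        fun i j hij => Subtype.ext (hinjOn i.2 j.2 hij)
    intro i hi
    have h4 := ((iSupIndep_iff_finsetSum_eq_zero_imp_eq_zero _).1 hind') Finset.univ
      (fun i => aeval B (part b n i) v) (fun i _ => hmem i) (by
        rw [Finset.sum_coe_sort (Finset.range n) (fun i => aeval B (part b n i) v)]
        exact hsum)
    exact h4 ⟨i, hi⟩ (Finset.mem_univ _)
  obtain ⟨r, hr0, hrs⟩ := hr n hn2
  have hspan : ∀ q ∈ Ideal.span {q | ∃ i < n, q = part b n i}, aeval B q v = 0 := by
    intro q hq
    induction hq using Submodule.span_induction with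
    | mem q hq =>
      obtain ⟨i, hi, rfl⟩ := hq
      exact hzero i (Finset.mem_range.2 hi)
    | zero => simp
    | add x y _ _ hx hy => rw [map_add, LinearMap.add_apply, hx, hy, add_zero]
    | smul a x _ hx => rw [smul_eq_mul, map_mul, Module.End.mul_apply, hx, map_zero]
  have h5 := hspan _ hrs
  rw [map_mul, aeval_C, Module.End.mul_apply] at h5
  have h6 : (algebraMap ℤ (Module.End k V) r) (aeval B s v) = (r : k) • aeval B s v := by
    rw [Int.cast_smul_eq_zsmul]
    simp
  rw [h6] at h5
  exact (smul_eq_zero.1 h5).resolve_left hr0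

/-- The same statement over a field that is not algebraically closed, for a group acting through
a group of exponent `q` prime to the characteristic. -/
theorem aeval_eq_zero_of_exponent [FiniteDimensional k V] [Finite L]
    (ρ : L →* Module.End k V) (hcomm : ∀ a b, Commute (ρ a) (ρ b)) {q : ℕ} (hq0 : (q : k) ≠ 0)
    (hq : ∀ l, ρ l ^ q = 1) (hfix : ∀ v, (∀ l, ρ l v = v) → v = 0) (σ : L ≃* L)
    (B : Module.End k V) (hB : ∀ l, ρ (σ l) * B = B * ρ l)
    (hσ : ∀ l, ∃ l', ρ l = ρ (l'⁻¹ * σ l')) {b s : ℤ[X]} (hb : aeval B b = 0)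
    (hr : ∀ n : ℕ, 2 ≤ n → ∃ r : ℤ, (r : k) ≠ 0 ∧
      C r * s ∈ Ideal.span {q | ∃ i < n, q = part b n i}) : aeval B s = 0 := by
  classical
  let K := AlgebraicClosure k
  let θ : Module.End k V →ₐ[k] Module.End K (TensorProduct k K V) :=
    Module.End.baseChangeHom k K V
  have hθ : ∀ (T : Module.End k V) (x : K) (v : V), θ T (x ⊗ₜ[k] v) = x ⊗ₜ[k] T v :=
    fun T x v => rfl
  have hinj : ∀ T : Module.End k V, θ T = 0 → T = 0 := by
    intro T hT
    ext v
    have h1 : (1 : K) ⊗ₜ[k] T v = 0 := by rw [← hθ, hT, LinearMap.zero_apply]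
    have h2 := Module.FaithfullyFlat.tensorProduct_mk_injective (A := k) (B := K) V
    exact h2 (by simpa using h1)
  have haeval : ∀ g : ℤ[X], aeval (θ B) g = θ (aeval B g) := fun g =>
    aeval_algHom_apply (θ.restrictScalars ℤ) B g
  apply hinj
  rw [← haeval]
  have hcast : ∀ m : ℤ, (m : k) ≠ 0 → (m : K) ≠ 0 := by
    intro m hm h
    apply hm
    apply (algebraMap k K).injective
    rw [map_intCast, h, map_zero]
  refine aeval_eq_zero_of_weights (θ.toRingHom.toMonoidHom.comp ρ)
    (fun a b => (hcomm a b).map θ) (fun l => ?_) ?_ σ (θ B)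
    (fun l => ?_) (fun l => ?_) (b := b) ?_ ?_
  · refine Module.End.isSemisimple_of_squarefree_aeval_eq_zero (p := (X ^ q - 1 : K[X])) ?_ ?_
    · refine (separable_X_pow_sub_C (1 : K) ?_ one_ne_zero).squarefree
      exact_mod_cast hcast q (by exact_mod_cast hq0)
    · have h1 : (θ (ρ l)) ^ q = 1 := by rw [← map_pow, hq, map_one]
      simp only [map_sub, map_pow, aeval_X, map_one]
      exact sub_eq_zero.2 h1
  · -- the coordinates of a common fixed vector in a basis of `K` over `k` are fixed as well
    intro v hv
    let bK := Module.Basis.ofVectorSpace k K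
    let Φ := TensorProduct.equivFinsuppOfBasisLeft (N := V) bK
    have hΦ : ∀ (T : Module.End k V) (w : TensorProduct k K V) i, Φ (θ T w) i = T (Φ w i) := by
      intro T w i
      induction w with
      | zero => simp
      | add x y hx hy => simp [hx, hy]
      | tmul x y =>
        rw [hθ, TensorProduct.equivFinsuppOfBasisLeft_apply_tmul_apply,
          TensorProduct.equivFinsuppOfBasisLeft_apply_tmul_apply, map_smul]
    apply Φ.injective
    rw [map_zero]
    ext i
    refine hfix _ fun l => ?_
    rw [← hΦ]
    exact congrArg (fun w => Φ w i) (hv l)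
  · exact (map_mul θ _ _).symm.trans ((congrArg θ (hB l)).trans (map_mul θ _ _))
  · obtain ⟨l', hl'⟩ := hσ l
    exact ⟨l', congrArg θ hl'⟩
  · rw [haeval, hb, map_zero]
  · intro n hn
    obtain ⟨r, hr0, hrs⟩ := hr n hn
    exact ⟨r, hcast r hr0, hrs⟩

end Weights

/-! ### Ordered values and abelian sections -/

section Sections

universe u
variable {G : Type u} [Group G]

/-- The ordered product `x ^ a₀ * β x ^ a₁ * ⋯ * βⁿ x ^ aₙ`, for `g = a₀ + a₁ X + ⋯ + aₙ Xⁿ`. -/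
def orderedEval (β : G →* G) (g : ℤ[X]) (x : G) : G :=
  ((List.range (g.natDegree + 1)).map fun i => (β^[i] x) ^ g.coeff i).prod

/-- The subgroup `A` is mapped into itself by `β`. -/
def IsInv (β : G →* G) (A : Subgroup G) : Prop := ∀ a ∈ A, β a ∈ A

theorem IsInv.iterate {β : G →* G} {A : Subgroup G} (h : IsInv β A) {a : G} (ha : a ∈ A) (i : ℕ) :
    β^[i] a ∈ A := by
  induction i with
  | zero => exact ha
  | succ i ih =>
    rw [Function.iterate_succ_apply']
    exact h _ ih

theorem IsInv.inf {β : G →* G} {A B : Subgroup G} (hA : IsInv β A) (hB : IsInv β B) :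
    IsInv β (A ⊓ B) := fun a ha => ⟨hA a ha.1, hB a ha.2⟩

theorem IsInv.bot (β : G →* G) : IsInv β ⊥ := fun a ha => by
  rw [Subgroup.mem_bot] at ha ⊢
  rw [ha, map_one]

theorem IsInv.top (β : G →* G) : IsInv β ⊤ := fun _ _ => Subgroup.mem_top _

theorem isInv_iff_map_le {β : G →* G} {A : Subgroup G} : IsInv β A ↔ A.map β ≤ A :=
  Subgroup.map_le_iff_le_comap.symm

theorem IsInv.sup {β : G →* G} {A B : Subgroup G} (hA : IsInv β A) (hB : IsInv β B) :
    IsInv β (A ⊔ B) := by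
  rw [isInv_iff_map_le] at *
  rw [Subgroup.map_sup]
  exact sup_le_sup hA hB

theorem IsInv.commutator {β : G →* G} {A B : Subgroup G} (hA : IsInv β A) (hB : IsInv β B) :
    IsInv β ⁅A, B⁆ := by
  rw [isInv_iff_map_le] at *
  rw [Subgroup.map_commutator]
  exact Subgroup.commutator_mono hA hB

theorem IsInv.orderedEval_mem {β : G →* G} {A : Subgroup G} (h : IsInv β A) (g : ℤ[X]) {a : G}
    (ha : a ∈ A) : orderedEval β g a ∈ A := by
  refine A.list_prod_mem fun x hx => ?_
  obtain ⟨i, -, rfl⟩ := List.mem_map.1 hx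
  exact A.zpow_mem (h.iterate ha i) _

theorem map_orderedEval {G' : Type*} [Group G'] {β : G →* G} {β' : G' →* G'} (ψ : G →* G')
    (hψ : ∀ x, ψ (β x) = β' (ψ x)) (g : ℤ[X]) (x : G) :
    ψ (orderedEval β g x) = orderedEval β' g (ψ x) := by
  have hit : ∀ i, ψ (β^[i] x) = β'^[i] (ψ x) := by
    intro i
    induction i with
    | zero => rfl
    | succ i ih => rw [Function.iterate_succ_apply', hψ, ih, Function.iterate_succ_apply']
  rw [orderedEval, map_list_prod, List.map_map, orderedEval]
  congr 1
  refine List.map_congr_left fun i _ => ?_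
  rw [Function.comp_apply, map_zpow, hit]

theorem map_iterate_apply {β : G →* G} {A : Subgroup G} {M : Type*} [AddCommGroup M] {φ : G → M}
    {T : Module.End ℤ M} (hA : IsInv β A) (hT : ∀ a ∈ A, φ (β a) = T (φ a)) (i : ℕ) {a : G}
    (ha : a ∈ A) : φ (β^[i] a) = (T ^ i) (φ a) := by
  induction i with
  | zero => rfl
  | succ i ih =>
    rw [Function.iterate_succ_apply', hT _ (hA.iterate ha i), ih, pow_succ']
    rfl

/-- `φ` presents the abelian section `A / B`: it is a homomorphism from `A` onto the
additive group `M`, with kernel `B`. Its values outside `A` are irrelevant. -/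
structure IsSecMap (B A : Subgroup G) {M : Type*} [AddCommGroup M] (φ : G → M) : Prop where
  le : B ≤ A
  map_mul : ∀ a ∈ A, ∀ b ∈ A, φ (a * b) = φ a + φ b
  eq_zero_iff : ∀ a ∈ A, φ a = 0 ↔ a ∈ B
  surj : ∀ m, ∃ a ∈ A, φ a = m

theorem exists_isSecMap {B A : Subgroup G} (hle : B ≤ A) (hc : ⁅A, A⁆ ≤ B) :
    ∃ (M : Type u) (_ : AddCommGroup M) (φ : G → M), IsSecMap B A φ := by
  classical
  have hn : (B.subgroupOf A).Normal := by
    refine ⟨fun b hb a => ?_⟩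
    rw [Subgroup.mem_subgroupOf] at hb ⊢
    have h1 : (a : G) * b * (a : G)⁻¹ * (b : G)⁻¹ ∈ B :=
      hc (Subgroup.commutator_mem_commutator a.2 b.2)
    have h2 := B.mul_mem h1 hb
    rwa [inv_mul_cancel_right] at h2
  have hcomm : ∀ x y : A ⧸ B.subgroupOf A, x * y = y * x := by
    intro x y
    induction x using QuotientGroup.induction_on with | H a =>
    induction y using QuotientGroup.induction_on with | H b =>
    rw [← QuotientGroup.mk_mul, ← QuotientGroup.mk_mul, QuotientGroup.eq,
      Subgroup.mem_subgroupOf]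
    have h1 : (b : G)⁻¹ * (a : G)⁻¹ * (b : G)⁻¹⁻¹ * (a : G)⁻¹⁻¹ ∈ B :=
      hc (Subgroup.commutator_mem_commutator (A.inv_mem b.2) (A.inv_mem a.2))
    simpa [mul_assoc] using h1
  let _ : CommGroup (A ⧸ B.subgroupOf A) := { QuotientGroup.Quotient.group _ with mul_comm := hcomm }
  refine ⟨Additive (A ⧸ B.subgroupOf A), inferInstance,
    fun a => if h : a ∈ A then Additive.ofMul (QuotientGroup.mk ⟨a, h⟩) else 0,
    hle, ?_, ?_, ?_⟩
  · intro a ha b hb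
    rw [dif_pos ha, dif_pos hb, dif_pos (A.mul_mem ha hb)]
    rfl
  · intro a ha
    rw [dif_pos ha]
    exact (QuotientGroup.eq_one_iff _).trans Subgroup.mem_subgroupOf
  · intro m
    obtain ⟨a, ha⟩ := QuotientGroup.mk_surjective m.toMul
    exact ⟨a, a.2, by rw [dif_pos a.2]; exact congrArg Additive.ofMul ha⟩

namespace IsSecMap

variable {B A : Subgroup G} {M : Type*} [AddCommGroup M] {φ : G → M}

theorem map_one (h : IsSecMap B A φ) : φ 1 = 0 := (h.eq_zero_iff 1 A.one_mem).2 B.one_mem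

theorem map_inv (h : IsSecMap B A φ) {a : G} (ha : a ∈ A) : φ a⁻¹ = -φ a := by
  rw [eq_neg_iff_add_eq_zero, ← h.map_mul _ (A.inv_mem ha) _ ha, inv_mul_cancel, h.map_one]

theorem map_pow (h : IsSecMap B A φ) {a : G} (ha : a ∈ A) (n : ℕ) : φ (a ^ n) = n • φ a := by
  induction n with
  | zero => rw [pow_zero, h.map_one, zero_smul]
  | succ n ih => rw [pow_succ, h.map_mul _ (A.pow_mem ha n) _ ha, ih, succ_nsmul]

theorem map_zpow (h : IsSecMap B A φ) {a : G} (ha : a ∈ A) (n : ℤ) : φ (a ^ n) = n • φ a := by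
  obtain ⟨n, rfl | rfl⟩ := n.eq_nat_or_neg
  · rw [zpow_natCast, h.map_pow ha, natCast_zsmul]
  · rw [zpow_neg, zpow_natCast, h.map_inv (A.pow_mem ha n), h.map_pow ha, neg_smul, natCast_zsmul]

theorem eq_iff (h : IsSecMap B A φ) {a b : G} (ha : a ∈ A) (hb : b ∈ A) :
    φ a = φ b ↔ a⁻¹ * b ∈ B := by
  rw [← h.eq_zero_iff _ (A.mul_mem (A.inv_mem ha) hb), h.map_mul _ (A.inv_mem ha) _ hb,
    h.map_inv ha, neg_add_eq_zero]

theorem map_list_prod (h : IsSecMap B A φ) (l : List G) (hl : ∀ x ∈ l, x ∈ A) :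
    φ l.prod = (l.map φ).sum := by
  induction l with
  | nil => simpa using h.map_one
  | cons x l ih =>
    rw [List.prod_cons, List.map_cons, List.sum_cons,
      h.map_mul _ (hl x (by simp)) _ (A.list_prod_mem fun y hy => hl y (by simp [hy])),
      ih fun y hy => hl y (by simp [hy])]

/-- An endomorphism of `G` that preserves `A` and `B` acts on the section `A / B`. -/
theorem exists_end (h : IsSecMap B A φ) {γ : G →* G} (hA : IsInv γ A) (hB : IsInv γ B) :
    ∃ T : Module.End ℤ M, ∀ a ∈ A, φ (γ a) = T (φ a) := by
  choose s hsA hs using h.surj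
  have key : ∀ a ∈ A, φ (γ (s (φ a))) = φ (γ a) := by
    intro a ha
    rw [h.eq_iff (hA _ (hsA _)) (hA _ ha), ← _root_.map_inv, ← _root_.map_mul]
    exact hB _ ((h.eq_iff (hsA _) ha).1 (hs _))
  let T : M →+ M :=
    { toFun := fun m => φ (γ (s m))
      map_zero' := by
        have := key 1 A.one_mem
        rwa [h.map_one, _root_.map_one, h.map_one] at this
      map_add' := by
        intro m n
        have := key (s m * s n) (A.mul_mem (hsA _) (hsA _))
        rwa [h.map_mul _ (hsA _) _ (hsA _), hs, hs, _root_.map_mul,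
          h.map_mul _ (hA _ (hsA _)) _ (hA _ (hsA _))] at this }
  exact ⟨T.toIntLinearMap, fun a ha => (key a ha).symm⟩

theorem ext_end (h : IsSecMap B A φ) {R W : Type*} [Semiring R] [Module R M] [AddCommMonoid W]
    [Module R W] {T U : M →ₗ[R] W}
    (hTU : ∀ a ∈ A, T (φ a) = U (φ a)) : T = U := by
  refine LinearMap.ext fun m => ?_
  obtain ⟨a, ha, rfl⟩ := h.surj m
  exact hTU a ha

theorem map_orderedEval (h : IsSecMap B A φ) {β : G →* G} (hA : IsInv β A) {T : Module.End ℤ M}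
    (hT : ∀ a ∈ A, φ (β a) = T (φ a)) (g : ℤ[X]) {a : G} (ha : a ∈ A) :
    φ (orderedEval β g a) = aeval T g (φ a) := by
  have hit : ∀ i, φ (β^[i] a) = (T ^ i) (φ a) := fun i => map_iterate_apply hA hT i ha
  have hmem : ∀ i, (β^[i] a) ^ g.coeff i ∈ A := fun i => A.zpow_mem (hA.iterate ha i) _
  rw [orderedEval, h.map_list_prod _ (by
    intro x hx
    obtain ⟨i, -, rfl⟩ := List.mem_map.1 hx
    exact hmem i), List.map_map, aeval_eq_sum_range, LinearMap.sum_apply]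
  have hsum : ∀ (n : ℕ) (F : ℕ → M), ((List.range n).map F).sum = ∑ i ∈ Finset.range n, F i :=
    fun _ _ => rfl
  rw [hsum]
  refine Finset.sum_congr rfl fun i _ => ?_
  rw [Function.comp_apply, h.map_zpow (hA.iterate ha i), hit]
  rfl

theorem forall_orderedEval_mem_iff (h : IsSecMap B A φ) {β : G →* G} (hA : IsInv β A)
    {T : Module.End ℤ M} (hT : ∀ a ∈ A, φ (β a) = T (φ a)) (g : ℤ[X]) :
    (∀ a ∈ A, orderedEval β g a ∈ B) ↔ aeval T g = 0 := by
  constructor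
  · intro hg
    refine h.ext_end fun x hx => ?_
    rw [← h.map_orderedEval hA hT g hx, LinearMap.zero_apply,
      h.eq_zero_iff _ (hA.orderedEval_mem g hx)]
    exact hg x hx
  · intro hg x hx
    rw [← h.eq_zero_iff _ (hA.orderedEval_mem g hx), h.map_orderedEval hA hT g hx, hg,
      LinearMap.zero_apply]

theorem nsmul_eq_zero (h : IsSecMap B A φ) {p : ℕ} (hp : ∀ a ∈ A, a ^ p ∈ B) (m : M) :
    p • m = 0 := by
  obtain ⟨x, hx, rfl⟩ := h.surj m
  rw [← h.map_pow hx, h.eq_zero_iff _ (A.pow_mem hx p)]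
  exact hp x hx

/-- The preimage in `A` of a subgroup of the section `A / B`. -/
def comap (h : IsSecMap B A φ) (S : AddSubgroup M) : Subgroup G where
  carrier := {a | a ∈ A ∧ φ a ∈ S}
  one_mem' := ⟨A.one_mem, h.map_one ▸ S.zero_mem⟩
  mul_mem' := fun ha hb => ⟨A.mul_mem ha.1 hb.1, by
    rw [h.map_mul _ ha.1 _ hb.1]
    exact S.add_mem ha.2 hb.2⟩
  inv_mem' := fun ha => ⟨A.inv_mem ha.1, by
    rw [h.map_inv ha.1]
    exact S.neg_mem ha.2⟩

end IsSecMap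

/-- `A / B` is an elementary abelian `p`-section of `G`, invariant under `β`. -/
structure IsSection (p : ℕ) (β : G →* G) (B A : Subgroup G) : Prop where
  le : B ≤ A
  inv_top : IsInv β A
  inv_bot : IsInv β B
  comm : ⁅A, A⁆ ≤ B
  pow : ∀ a ∈ A, a ^ p ∈ B

/-- `g(β)` vanishes on all `β`-invariant elementary abelian `p`-sections of `G` between
`L` and `U`; on an abelian section the order of the factors in `orderedEval` is immaterial, and
its value is that of the endomorphism `g(β)`. -/
def Kills (p : ℕ) (β : G →* G) (g : ℤ[X]) (L U : Subgroup G) : Prop :=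
  ∀ B A : Subgroup G, IsSection p β B A → L ≤ B → A ≤ U → ∀ a ∈ A, orderedEval β g a ∈ B

theorem Kills.mono {p : ℕ} {β : G →* G} {g : ℤ[X]} {L L' U U' : Subgroup G}
    (h : Kills p β g L U) (hL : L ≤ L') (hU : U' ≤ U) : Kills p β g L' U' :=
  fun B A hs hB hA => h B A hs (hL.trans hB) (hA.trans hU)

/-- `Kills` passes to the target along a homomorphism. -/
theorem Kills.map {G' : Type*} [Group G'] {p : ℕ} {β : G →* G} {β' : G' →* G'} {g : ℤ[X]}
    {L U : Subgroup G} (h : Kills p β g L U) (ψ : G →* G') (hψ : ∀ x, ψ (β x) = β' (ψ x))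
    {L' U' : Subgroup G'} (hL : L ≤ L'.comap ψ) (hU : U'.comap ψ ≤ U) (hr : U' ≤ ψ.range) :
    Kills p β' g L' U' := by
  intro B A hs hB hA a ha
  obtain ⟨x, rfl⟩ := hr (hA ha)
  rw [← map_orderedEval ψ hψ]
  refine h (B.comap ψ) (A.comap ψ) ⟨Subgroup.comap_mono hs.le, ?_, ?_, ?_, ?_⟩
    (hL.trans (Subgroup.comap_mono hB)) ((Subgroup.comap_mono hA).trans hU) x ha
  · intro y hy
    rw [Subgroup.mem_comap] at hy ⊢
    rw [hψ]
    exact hs.inv_top _ hy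
  · intro y hy
    rw [Subgroup.mem_comap] at hy ⊢
    rw [hψ]
    exact hs.inv_bot _ hy
  · rw [← Subgroup.map_le_iff_le_comap, Subgroup.map_commutator]
    exact (Subgroup.commutator_mono (Subgroup.map_comap_le _ _)
      (Subgroup.map_comap_le _ _)).trans hs.comm
  · intro y hy
    rw [Subgroup.mem_comap, _root_.map_pow]
    exact hs.pow _ hy

/-- `Kills` passes to the source along a homomorphism. -/
theorem Kills.comap {G' : Type*} [Group G'] {p : ℕ} {β : G →* G} {β' : G' →* G'} {g : ℤ[X]}
    {L' U' : Subgroup G'} (h : Kills p β' g L' U') (ψ : G →* G') (hψ : ∀ x, ψ (β x) = β' (ψ x))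
    {L U : Subgroup G} (hL : L' ≤ L.map ψ) (hU : U.map ψ ≤ U') (hk : ψ.ker ≤ L) :
    Kills p β g L U := by
  intro B A hs hB hA a ha
  have h1 := h (B.map ψ) (A.map ψ) ⟨Subgroup.map_mono hs.le, ?_, ?_, ?_, ?_⟩
    (hL.trans (Subgroup.map_mono hB)) ((Subgroup.map_mono hA).trans hU) (ψ a)
    (Subgroup.mem_map_of_mem ψ ha)
  · rw [← map_orderedEval ψ hψ, ← Subgroup.mem_comap,
      Subgroup.comap_map_eq_self (hk.trans hB)] at h1
    exact h1
  · rintro _ ⟨y, hy, rfl⟩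
    rw [← hψ]
    exact Subgroup.mem_map_of_mem ψ (hs.inv_top _ hy)
  · rintro _ ⟨y, hy, rfl⟩
    rw [← hψ]
    exact Subgroup.mem_map_of_mem ψ (hs.inv_bot _ hy)
  · rw [← Subgroup.map_commutator]
    exact Subgroup.map_mono hs.comm
  · rintro _ ⟨y, hy, rfl⟩
    rw [← _root_.map_pow]
    exact Subgroup.mem_map_of_mem ψ (hs.pow _ hy)

theorem commutator_sup_le (A N : Subgroup G) [N.Normal] : ⁅A ⊔ N, A ⊔ N⁆ ≤ ⁅A, A⁆ ⊔ N := by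
  have h1 : ∀ H : Subgroup G, (H ⊔ N) = (H.map (QuotientGroup.mk' N)).comap
      (QuotientGroup.mk' N) := by
    intro H
    rw [Subgroup.comap_map_eq, QuotientGroup.ker_mk']
  have h2 : ∀ H : Subgroup G, (H ⊔ N).map (QuotientGroup.mk' N) = H.map (QuotientGroup.mk' N) := by
    intro H
    rw [Subgroup.map_sup, (Subgroup.map_eq_bot_iff N).2 (by rw [QuotientGroup.ker_mk']), sup_bot_eq]
  rw [h1 ⁅A, A⁆, ← Subgroup.map_le_iff_le_comap, Subgroup.map_commutator, h2,
    Subgroup.map_commutator]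

/-- Two coprime polynomials modulo `p`: an integral Bézout relation. -/
theorem exists_bezout {p : ℕ} {a b : ℤ[X]} (h : IsCoprime (red p a) (red p b)) :
    ∃ u v w : ℤ[X], u * a + v * b = 1 + C (p : ℤ) * w := by
  obtain ⟨u, v, huv⟩ := h
  obtain ⟨u', rfl⟩ := map_surjective (Int.castRingHom (ZMod p)) (ZMod.ringHom_surjective _) u
  obtain ⟨v', rfl⟩ := map_surjective (Int.castRingHom (ZMod p)) (ZMod.ringHom_surjective _) v
  have h1 : red p (u' * a + v' * b - 1) = 0 := by
    simp only [red, Polynomial.map_sub, Polynomial.map_add, Polynomial.map_mul,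
      Polynomial.map_one]
    exact sub_eq_zero.2 huv
  have h2 : C (p : ℤ) ∣ u' * a + v' * b - 1 := by
    rw [C_dvd_iff_dvd_coeff]
    intro i
    have h3 := congrArg (fun q => q.coeff i) h1
    simp only [red, coeff_map, coeff_zero, eq_intCast] at h3
    exact (ZMod.intCast_zmod_eq_zero_iff_dvd _ _).1 h3
  obtain ⟨w, hw⟩ := h2
  exact ⟨u', v', w, by rw [← hw]; ring⟩

theorem isCoprime_red_expand {p : ℕ} {a b : ℤ[X]} (h : IsCoprime (red p a) (red p b)) (m : ℕ) :
    IsCoprime (red p (expand ℤ m a)) (red p (expand ℤ m b)) := by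
  have h1 := h.map (expand (ZMod p) m).toRingHom
  rw [red, red, map_expand, map_expand]
  exact h1

/-- On a module of exponent `p` on which `a` and `s t` vanish, `s` vanishes as well if
`a` and `t` are coprime modulo `p`. -/
theorem aeval_eq_zero_of_isCoprime {M : Type*} [AddCommGroup M] {p : ℕ} (hp : ∀ m : M, p • m = 0)
    {T : Module.End ℤ M} {a s t : ℤ[X]} (h : IsCoprime (red p a) (red p t))
    (ha : aeval T (a * s) = 0) (hst : aeval T (s * t) = 0) : aeval T s = 0 := by
  obtain ⟨u, v, w, huv⟩ := exists_bezout h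
  have h1 : s = u * (a * s) + v * (s * t) - C (p : ℤ) * (w * s) := by
    linear_combination -s * huv
  have hC : aeval T (C (p : ℤ)) = 0 := by
    refine LinearMap.ext fun m => ?_
    rw [aeval_C]
    simpa using hp m
  rw [h1, map_sub, map_add, map_mul _ u, ha, map_mul _ v, hst, map_mul _ (C (p : ℤ)), hC]
  simp

/-- If `s(β)` vanishes on the sections below `N` and on those above `N`, then it vanishes on all
sections, provided that a multiple `s t` with `s`, `t` coprime modulo `p` vanishes on them. -/
theorem Kills.trans {p : ℕ} {β : G →* G} {s t : ℤ[X]} (hst : IsCoprime (red p s) (red p t))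
    {L N U : Subgroup G} [N.Normal] (hN : IsInv β N) (hLN : L ≤ N) (hNU : N ≤ U)
    (h : Kills p β (s * t) L U) (h₁ : Kills p β s L N) (h₂ : Kills p β s N U) :
    Kills p β s L U := by
  intro B A hs hB hA a ha
  obtain ⟨M, _, φ, hφ⟩ := exists_isSecMap hs.le hs.comm
  obtain ⟨T, hT⟩ := hφ.exists_end hs.inv_top hs.inv_bot
  have hp := hφ.nsmul_eq_zero hs.pow
  have key := hφ.forall_orderedEval_mem_iff hs.inv_top hT
  -- `s(β)` maps `A / B` into the image of `A ⊓ N`, on which it vanishes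
  have h4 : aeval T (s * s) = 0 := by
    refine hφ.ext_end fun x hx => ?_
    rw [map_mul, Module.End.mul_apply, ← hφ.map_orderedEval hs.inv_top hT s hx,
      LinearMap.zero_apply]
    have h5 : orderedEval β s x ∈ B ⊔ N := by
      refine h₂ (B ⊔ N) (A ⊔ N) ⟨sup_le_sup_right hs.le N, hs.inv_top.sup hN, hs.inv_bot.sup hN,
        (commutator_sup_le A N).trans (sup_le_sup_right hs.comm N), ?_⟩ le_sup_right
        (sup_le hA hNU) x (Subgroup.mem_sup_left hx)
      intro y hy
      obtain ⟨z, hz, n, hn, rfl⟩ := Subgroup.mem_sup_of_normal_right.1 hy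
      have h6 : (z * n) ^ p ∈ (B ⊔ N) := by
        have h7 : QuotientGroup.mk' N ((z * n) ^ p) = QuotientGroup.mk' N (z ^ p) := by
          rw [_root_.map_pow, _root_.map_mul,
            show QuotientGroup.mk' N n = 1 from (QuotientGroup.eq_one_iff n).2 hn,
            mul_one, _root_.map_pow]
        have h8 : (z ^ p)⁻¹ * (z * n) ^ p ∈ N := QuotientGroup.eq.1 h7.symm
        have h9 := (B ⊔ N).mul_mem (Subgroup.mem_sup_left (hs.pow z hz))
          (Subgroup.mem_sup_right h8)
        rwa [mul_inv_cancel_left] at h9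
      exact h6
    obtain ⟨y, hy, n, hn, hyn⟩ := Subgroup.mem_sup_of_normal_right.1 h5
    have hnA : n ∈ A := by
      have h6 := A.mul_mem (A.inv_mem (hs.le hy)) (hs.inv_top.orderedEval_mem s hx)
      rwa [← hyn, inv_mul_cancel_left] at h6
    rw [← hyn, hφ.map_mul _ (hs.le hy) _ hnA, (hφ.eq_zero_iff _ (hs.le hy)).2 hy, zero_add,
      ← hφ.map_orderedEval hs.inv_top hT s hnA,
      hφ.eq_zero_iff _ (hs.inv_top.orderedEval_mem s hnA)]
    refine (h₁ (B ⊓ N) (A ⊓ N) ⟨inf_le_inf_right N hs.le, hs.inv_top.inf hN, hs.inv_bot.inf hN,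
      ?_, fun z hz => ⟨hs.pow z hz.1, N.pow_mem hz.2 p⟩⟩ (le_inf hB hLN) inf_le_right n
      ⟨hnA, hn⟩).1
    exact le_inf ((Subgroup.commutator_mono inf_le_left inf_le_left).trans hs.comm)
      ((Subgroup.commutator_mono inf_le_right inf_le_right).trans (Subgroup.commutator_le_left N N))
  have h5 := (key (s * t)).1 fun x hx => h B A hs hB hA x hx
  exact (key s).2 (aeval_eq_zero_of_isCoprime hp hst h4 h5) a ha

end Sections

/-! ### Biadditive maps and `p`-groups -/

/-- If `s` is nilpotent on two modules, then the product polynomial is nilpotent on the values of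
an equivariant biadditive map on them. -/
theorem exists_pow_aeval_eq_zero_of_biadditive.{u} {M₁ M₂ U : Type u} [AddCommGroup M₁]
    [AddCommGroup M₂] [AddCommGroup U] {p : ℕ} {s h : ℤ[X]} (T₁ : Module.End ℤ M₁)
    (T₂ : Module.End ℤ M₂) (T : Module.End ℤ U) (c : M₁ →ₗ[ℤ] M₂ →ₗ[ℤ] U)
    (hc : ∀ x y, c (T₁ x) (T₂ y) = T (c x y))
    (hh : ∀ {S : Type u} [CommRing S] (x y : S), IsNilpotent (p : S) → IsNilpotent (aeval x s) →
      IsNilpotent (aeval y s) → IsNilpotent (aeval (x * y) h))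
    (hp : IsNilpotent (p : Module.End ℤ M₁)) (h₁ : IsNilpotent (aeval T₁ s))
    (h₂ : IsNilpotent (aeval T₂ s)) : ∃ k : ℕ, ∀ x y, aeval T (h ^ k) (c x y) = 0 := by
  let E := Module.End ℤ (M₁ ⊗[ℤ] M₂)
  let f₁ : Module.End ℤ M₁ →ₐ[ℤ] E := Module.End.rTensorAlgHom ℤ M₁ M₂
  let f₂ : Module.End ℤ M₂ →ₐ[ℤ] E := Module.End.lTensorAlgHom ℤ M₂ M₁
  have hcomm : Commute (f₁ T₁) (f₂ T₂) := by
    refine TensorProduct.ext' fun x y => ?_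
    rfl
  let S := Algebra.adjoin ℤ ({f₁ T₁, f₂ T₂} : Set E)
  have hS : IsMulCommutative S := Algebra.isMulCommutative_adjoin ℤ (by
    rintro a (rfl | rfl) b (rfl | rfl)
    · rfl
    · exact hcomm
    · exact hcomm.symm
    · rfl)
  let _ : CommRing S := { (inferInstance : Ring S) with mul_comm := hS.is_comm.comm }
  let x : S := ⟨f₁ T₁, Algebra.subset_adjoin (Or.inl rfl)⟩
  let y : S := ⟨f₂ T₂, Algebra.subset_adjoin (Or.inr rfl)⟩
  have hval : ∀ (z : S) (g : ℤ[X]), ((aeval z g : S) : E) = aeval (z : E) g := fun z g =>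
    (aeval_algHom_apply S.val z g).symm
  have hnil : ∀ z : S, IsNilpotent (z : E) → IsNilpotent z := by
    rintro z ⟨n, hn⟩
    exact ⟨n, Subtype.ext (by simpa using hn)⟩
  obtain ⟨k, hk⟩ := hh x y
    (hnil _ (by simpa using hp.map f₁))
    (hnil _ (by rw [hval]; simpa [x] using (aeval_algHom_apply f₁ T₁ s).symm ▸ h₁.map f₁))
    (hnil _ (by rw [hval]; simpa [y] using (aeval_algHom_apply f₂ T₂ s).symm ▸ h₂.map f₂))
  refine ⟨k, fun m₁ m₂ => ?_⟩
  have h0 : aeval (f₁ T₁ * f₂ T₂) (h ^ k) = 0 := by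
    rw [map_pow]
    have h1 := congrArg (fun z : S => (z : E)) hk
    simpa [hval] using h1
  let Λ : M₁ ⊗[ℤ] M₂ →ₗ[ℤ] U := TensorProduct.lift c
  have hΛ : ∀ z, Λ ((f₁ T₁ * f₂ T₂) z) = T (Λ z) := by
    intro z
    induction z with
    | zero => simp
    | add a b ha hb => rw [map_add, map_add, ha, hb, map_add, map_add]
    | tmul a b => exact hc a b
  have hΛ' : ∀ (g : ℤ[X]) z, Λ (aeval (f₁ T₁ * f₂ T₂) g z) = aeval T g (Λ z) := by
    intro g
    induction g using Polynomial.induction_on' with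
    | add a b ha hb =>
      intro z
      rw [map_add, map_add, LinearMap.add_apply, LinearMap.add_apply, map_add, ha, hb]
    | monomial n r =>
      intro z
      have hn : ∀ w, Λ (((f₁ T₁ * f₂ T₂) ^ n) w) = (T ^ n) (Λ w) := by
        induction n with
        | zero => intro w; rfl
        | succ n ih => intro w; rw [pow_succ', pow_succ', Module.End.mul_apply, hΛ, ih]; rfl
      rw [aeval_monomial, aeval_monomial, ← Algebra.smul_def, ← Algebra.smul_def,
        LinearMap.smul_apply, LinearMap.smul_apply, map_zsmul, hn]
  have h2 := hΛ' (h ^ k) (m₁ ⊗ₜ m₂)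
  rw [h0, LinearMap.zero_apply, map_zero] at h2
  exact h2.symm

section PGroup

universe u
variable {G : Type u} [Group G]

/-- On an abelian section of exponent a power of `p`, a polynomial that vanishes on all elementary
abelian sections is nilpotent. -/
theorem IsSecMap.isNilpotent_aeval {B A : Subgroup G} {M : Type*} [AddCommGroup M] {φ : G → M}
    (h : IsSecMap B A φ) (hc : ⁅A, A⁆ ≤ B) {β : G →* G} (hA : IsInv β A) {T : Module.End ℤ M}
    (hT : ∀ a ∈ A, φ (β a) = T (φ a)) {p e : ℕ} (he : ∀ a ∈ A, a ^ p ^ e = 1) {g : ℤ[X]}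
    (hg : Kills p β g B A) :
    IsNilpotent (p : Module.End ℤ M) ∧ IsNilpotent (aeval T g) := by
  have hM : ∀ m : M, p ^ e • m = 0 := h.nsmul_eq_zero fun a ha => by
    rw [he a ha]; exact B.one_mem
  let S : AddSubgroup M := (zsmulAddGroupHom (p : ℤ)).range
  have hsec : IsSection p β (h.comap S) A := by
    refine ⟨fun a ha => ha.1, hA, ?_, ?_, ?_⟩
    · rintro a ⟨haA, m, hm⟩
      refine ⟨hA a haA, T m, ?_⟩
      rw [hT a haA, ← hm]
      simp
    · refine hc.trans fun b hb => ⟨h.le hb, ?_⟩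
      rw [(h.eq_zero_iff b (h.le hb)).2 hb]
      exact S.zero_mem
    · intro a ha
      refine ⟨A.pow_mem ha p, φ a, ?_⟩
      rw [h.map_pow ha]
      simp
  have hdiv : ∀ m, ∃ m', aeval T g m = p • m' := by
    intro m
    obtain ⟨a, ha, rfl⟩ := h.surj m
    obtain ⟨-, m', hm'⟩ := hg _ _ hsec (fun b hb => ⟨h.le hb, by
      rw [(h.eq_zero_iff b (h.le hb)).2 hb]
      exact S.zero_mem⟩) le_rfl a ha
    refine ⟨m', ?_⟩
    rw [← h.map_orderedEval hA hT g ha, ← hm']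
    simp
  have hpow : ∀ n m, ∃ m', ((aeval T g) ^ n) m = p ^ n • m' := by
    intro n
    induction n with
    | zero => intro m; exact ⟨m, by simp⟩
    | succ n ih =>
      intro m
      obtain ⟨m₁, h₁⟩ := ih m
      obtain ⟨m₂, h₂⟩ := hdiv m₁
      refine ⟨m₂, ?_⟩
      rw [pow_succ', Module.End.mul_apply, h₁, map_nsmul, h₂, pow_succ, mul_smul]
  constructor
  · refine ⟨e, LinearMap.ext fun m => ?_⟩
    rw [← Nat.cast_pow, LinearMap.zero_apply, Module.End.natCast_apply]
    exact hM m
  · refine ⟨e, LinearMap.ext fun m => ?_⟩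
    obtain ⟨m', hm'⟩ := hpow e m
    rw [hm', hM, LinearMap.zero_apply]

theorem isInv_lowerCentralSeries (β : G →* G) (n : ℕ) :
    IsInv β ((⊤ : Subgroup G).lowerCentralSeries n) := by
  induction n with
  | zero => exact IsInv.top β
  | succ n ih => exact ih.commutator (IsInv.top β)

/-- A function that is additive on `A` and vanishes on `B` factors through the section `A / B`. -/
theorem IsSecMap.exists_lift {B A : Subgroup G} {M W : Type*} [AddCommGroup M] [AddCommGroup W]
    {φ : G → M} (h : IsSecMap B A φ) (F : G → W)
    (hF : ∀ a ∈ A, ∀ b ∈ A, F (a * b) = F a + F b) (hB : ∀ b ∈ B, F b = 0) :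
    ∃ f : M →ₗ[ℤ] W, ∀ a ∈ A, f (φ a) = F a := by
  choose s hsA hs using h.surj
  have key : ∀ a ∈ A, F (s (φ a)) = F a := by
    intro a ha
    have h1 := hB _ ((h.eq_iff (hsA _) ha).1 (hs _))
    have h2 := hF _ (hsA (φ a)) _ (A.mul_mem (A.inv_mem (hsA (φ a))) ha)
    rw [mul_inv_cancel_left, h1, add_zero] at h2
    exact h2.symm
  let f : M →+ W :=
    { toFun := fun m => F (s m)
      map_zero' := by
        have := key 1 A.one_mem
        rw [h.map_one] at this
        rw [this]
        exact hB 1 B.one_mem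
      map_add' := fun m n => by
        have := key (s m * s n) (A.mul_mem (hsA _) (hsA _))
        rwa [h.map_mul _ (hsA _) _ (hsA _), hs, hs, hF _ (hsA _) _ (hsA _)] at this }
  exact ⟨f.toIntLinearMap, key⟩

open scoped commutatorElement in
/-- The commutator as a biadditive map `L / ⁅L, G⁆ × G / G' → ⁅L, G⁆ / ⁅L, G, G⁆`. -/
theorem exists_biadditive_commutator {L : Subgroup G} [L.Normal] {M₁ M₂ U : Type*}
    [AddCommGroup M₁] [AddCommGroup M₂] [AddCommGroup U] {φ₁ : G → M₁} {φ₂ : G → M₂} {φ : G → U}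
    (h₁ : IsSecMap ⁅L, (⊤ : Subgroup G)⁆ L φ₁) (h₂ : IsSecMap (commutator G) ⊤ φ₂)
    (h : IsSecMap ⁅⁅L, (⊤ : Subgroup G)⁆, (⊤ : Subgroup G)⁆ ⁅L, (⊤ : Subgroup G)⁆ φ) :
    ∃ c : M₁ →ₗ[ℤ] M₂ →ₗ[ℤ] U, ∀ a ∈ L, ∀ b, c (φ₁ a) (φ₂ b) = φ ⁅a, b⁆ := by
  have hmem : ∀ a ∈ L, ∀ b : G, ⁅a, b⁆ ∈ ⁅L, (⊤ : Subgroup G)⁆ := fun a ha b =>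
    Subgroup.commutator_mem_commutator ha (Subgroup.mem_top b)
  have hmem' : ∀ x ∈ ⁅L, (⊤ : Subgroup G)⁆, ∀ g : G, g * x * g⁻¹ ∈ ⁅L, (⊤ : Subgroup G)⁆ :=
    fun x hx g => Subgroup.Normal.conj_mem inferInstance x hx g
  have hconj : ∀ x ∈ ⁅L, (⊤ : Subgroup G)⁆, ∀ g : G, φ (g * x * g⁻¹) = φ x := by
    intro x hx g
    rw [h.eq_iff (hmem' x hx g) hx]
    have h3 : ⁅g, x⁻¹⁆ ∈ ⁅⁅L, (⊤ : Subgroup G)⁆, (⊤ : Subgroup G)⁆ := by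
      rw [Subgroup.commutator_comm]
      exact Subgroup.commutator_mem_commutator (Subgroup.mem_top g) (Subgroup.inv_mem _ hx)
    rw [commutatorElement_def] at h3
    simpa [mul_assoc] using h3
  have hl : ∀ a ∈ L, ∀ a' ∈ L, ∀ b, φ ⁅a * a', b⁆ = φ ⁅a, b⁆ + φ ⁅a', b⁆ := by
    intro a ha a' ha' b
    have h3 : ⁅a * a', b⁆ = a * ⁅a', b⁆ * a⁻¹ * ⁅a, b⁆ := by
      simp only [commutatorElement_def]; group
    rw [h3, h.map_mul _ (hmem' _ (hmem a' ha' b) a) _ (hmem a ha b), hconj _ (hmem a' ha' b),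
      add_comm]
  have hr : ∀ a ∈ L, ∀ b b', φ ⁅a, b * b'⁆ = φ ⁅a, b⁆ + φ ⁅a, b'⁆ := by
    intro a ha b b'
    have h3 : ⁅a, b * b'⁆ = ⁅a, b⁆ * (b * ⁅a, b'⁆ * b⁻¹) := by
      simp only [commutatorElement_def]; group
    rw [h3, h.map_mul _ (hmem a ha b) _ (hmem' _ (hmem a ha b') b), hconj _ (hmem a ha b')]
  have hf : ∀ a : L, ∃ f : M₂ →ₗ[ℤ] U, ∀ b, f (φ₂ b) = φ ⁅(a : G), b⁆ := by
    intro a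
    -- a homomorphism to an abelian group vanishes on commutators
    let F : G →* Multiplicative U :=
      { toFun := fun b => Multiplicative.ofAdd (φ ⁅(a : G), b⁆)
        map_one' := by rw [commutatorElement_one_right, h.map_one]; rfl
        map_mul' := fun b b' => by rw [hr a a.2]; rfl }
    obtain ⟨f, hf⟩ := h₂.exists_lift (fun b => φ ⁅(a : G), b⁆) (fun b _ b' _ => hr a a.2 b b')
      fun b hb => Abelianization.commutator_subset_ker F hb
    exact ⟨f, fun b => hf b (Subgroup.mem_top b)⟩
  choose f hf using hf
  classical
  obtain ⟨c, hc⟩ := h₁.exists_lift (fun a => if ha : a ∈ L then f ⟨a, ha⟩ else 0) (by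
      intro a ha a' ha'
      rw [dif_pos ha, dif_pos ha', dif_pos (L.mul_mem ha ha')]
      refine h₂.ext_end fun b _ => ?_
      rw [LinearMap.add_apply, hf, hf, hf, hl a ha a' ha']) (by
      intro a ha
      rw [dif_pos (h₁.le ha)]
      refine h₂.ext_end fun b _ => ?_
      rw [hf, LinearMap.zero_apply, h.eq_zero_iff _ (hmem _ (h₁.le ha) _)]
      exact Subgroup.commutator_mem_commutator ha (Subgroup.mem_top b))
  refine ⟨c, fun a ha b => ?_⟩
  rw [hc a ha, dif_pos ha, hf]

/-- In a finite `p`-group the vanishing of `s(β)` on the abelianization implies its vanishing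
on all sections: the factors of the lower central series are images of tensor products, and the
root set of `s` modulo `p` is closed in the sense of `HasProductPolynomial`. -/
theorem Kills.of_commutator {p e : ℕ} (he : ∀ a : G, a ^ p ^ e = 1) [Group.IsNilpotent G]
    {β : G →* G} {s t : ℤ[X]} (hst : IsCoprime (red p s) (red p t))
    (hpp : HasProductPolynomial.{u} p s t) {m : ℕ}
    (h : Kills p β (expand ℤ m s * expand ℤ m t) ⊥ ⊤)
    (h₁ : Kills p β (expand ℤ m s) (commutator G) ⊤) : Kills p β (expand ℤ m s) ⊥ ⊤ := by
  obtain ⟨q, hq, hqn⟩ := hpp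
  let γ : ℕ → Subgroup G := fun n => (⊤ : Subgroup G).lowerCentralSeries n
  have hγ : ∀ n, IsInv β (γ n) := isInv_lowerCentralSeries β
  have hγab : ∀ n, ⁅γ n, γ n⁆ ≤ γ (n + 1) := fun n => Subgroup.commutator_mono le_rfl le_top
  have main : ∀ n, Kills p β (expand ℤ m s) (γ (n + 1)) ⊤ := by
    intro n
    induction n with
    | zero => exact h₁
    | succ n ih =>
      refine Kills.trans (isCoprime_red_expand hst m) (hγ (n + 1))
        (Subgroup.lowerCentralSeries_antitone _ (Nat.le_succ _)) le_top
        (h.mono bot_le le_rfl) ?_ ih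
      obtain ⟨M₁, _, φ₁, hφ₁⟩ := exists_isSecMap
        (Subgroup.lowerCentralSeries_antitone (⊤ : Subgroup G) (Nat.le_succ n)) (hγab n)
      obtain ⟨M₂, _, φ₂, hφ₂⟩ := exists_isSecMap (B := commutator G) (A := ⊤) le_top le_rfl
      obtain ⟨U, _, φ, hφ⟩ := exists_isSecMap
        (Subgroup.lowerCentralSeries_antitone (⊤ : Subgroup G) (Nat.le_succ (n + 1))) (hγab (n + 1))
      have hcomm : IsInv β (commutator G) := hγ 1
      obtain ⟨T₁, hT₁⟩ := hφ₁.exists_end (hγ n) (hγ (n + 1))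
      obtain ⟨T₂, hT₂⟩ := hφ₂.exists_end (IsInv.top β) hcomm
      obtain ⟨T, hT⟩ := hφ.exists_end (hγ (n + 1)) (hγ (n + 2))
      obtain ⟨c, hc⟩ := exists_biadditive_commutator (L := γ n) hφ₁ hφ₂ hφ
      have hcT : ∀ x y, c (T₁ x) (T₂ y) = T (c x y) := by
        intro x y
        obtain ⟨a, ha, rfl⟩ := hφ₁.surj x
        obtain ⟨b, hb, rfl⟩ := hφ₂.surj y
        rw [← hT₁ a ha, ← hT₂ b hb, hc _ (hγ n a ha), hc a ha, ← hT, map_commutatorElement]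
        exact Subgroup.commutator_mem_commutator ha hb
      have hcTm : ∀ (i : ℕ) x y, c ((T₁ ^ i) x) ((T₂ ^ i) y) = (T ^ i) (c x y) := by
        intro i
        induction i with
        | zero => intro x y; rfl
        | succ i ih =>
          intro x y
          rw [pow_succ', pow_succ', pow_succ', Module.End.mul_apply, Module.End.mul_apply,
            Module.End.mul_apply, hcT, ih]
      obtain ⟨hp₁, hn₁⟩ := hφ₁.isNilpotent_aeval (hγab n) (hγ n) hT₁ (fun a _ => he a)
        (ih.mono le_rfl le_top)
      obtain ⟨-, hn₂⟩ := hφ₂.isNilpotent_aeval le_rfl (IsInv.top β) hT₂ (fun a _ => he a) h₁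
      rw [expand_aeval] at hn₁ hn₂
      obtain ⟨k, hk⟩ := exists_pow_aeval_eq_zero_of_biadditive (T₁ ^ m) (T₂ ^ m) (T ^ m) c
        (hcTm m) hqn hp₁ hn₁ hn₂
      have hle : γ (n + 1) ≤ hφ.comap (LinearMap.ker (aeval (T ^ m) (q ^ k))).toAddSubgroup := by
        refine Subgroup.commutator_le.2 fun a ha b hb => ?_
        refine ⟨Subgroup.commutator_mem_commutator ha hb, ?_⟩
        rw [← hc a ha b]
        exact hk _ _
      have hkill := (hφ.forall_orderedEval_mem_iff (hγ (n + 1)) hT (expand ℤ m (q ^ k))).2 (by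
        refine hφ.ext_end fun a ha => ?_
        rw [expand_aeval]
        exact (hle ha).2)
      intro B A hs hB hA
      obtain ⟨M, _, φ', hφ'⟩ := exists_isSecMap hs.le hs.comm
      obtain ⟨T', hT'⟩ := hφ'.exists_end hs.inv_top hs.inv_bot
      have key := hφ'.forall_orderedEval_mem_iff hs.inv_top hT'
      refine (key _).2 (aeval_eq_zero_of_isCoprime (hφ'.nsmul_eq_zero hs.pow)
        (a := expand ℤ m (q ^ k)) (t := expand ℤ m t) (isCoprime_red_expand ?_ m) ?_ ?_)
      · rw [red, Polynomial.map_pow]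
        exact hq.pow_left
      · rw [map_mul, (key _).1 fun a ha => hB (hkill a (hA ha)), zero_mul]
      · exact (key _).1 fun a ha => h B A hs bot_le le_top a ha
  obtain ⟨n, hn⟩ := Subgroup.nilpotent_iff_lowerCentralSeries.1
    (inferInstance : Group.IsNilpotent G)
  refine (main n).mono ?_ le_rfl
  rw [← hn]
  exact Subgroup.lowerCentralSeries_antitone _ (Nat.le_succ n)

end PGroup

/-! ### Invariant subgroups of finite groups -/

section FiniteGroups

universe u
variable {G : Type u} [Group G]

/-- The subgroup generated by the elements of order prime to `p`; in a finite group it is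
the least normal subgroup whose quotient is a `p`-group. -/
def pResidual (p : ℕ) (G : Type*) [Group G] : Subgroup G :=
  Subgroup.closure {x | (orderOf x).Coprime p}

theorem map_pResidual_le {G' : Type*} [Group G'] (p : ℕ) (ψ : G →* G') :
    (pResidual p G).map ψ ≤ pResidual p G' := by
  rw [Subgroup.map_le_iff_le_comap, pResidual, Subgroup.closure_le]
  intro x hx
  exact Subgroup.subset_closure (Nat.Coprime.coprime_dvd_left (orderOf_map_dvd ψ x) hx)

theorem isInv_pResidual (p : ℕ) (β : G →* G) : IsInv β (pResidual p G) :=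
  isInv_iff_map_le.2 (map_pResidual_le p β)

instance normal_pResidual (p : ℕ) : (pResidual p G).Normal :=
  ⟨fun x hx g => isInv_pResidual p (MulAut.conj g).toMonoidHom x hx⟩

theorem exists_pow_mem_pResidual [Finite G] (p : ℕ) [hp : Fact p.Prime] (g : G) :
    ∃ n, g ^ p ^ n ∈ pResidual p G := by
  obtain ⟨n, m, hm, h⟩ := Nat.exists_eq_pow_mul_and_not_dvd (orderOf_pos g).ne' p hp.out.ne_one
  refine ⟨n, Subgroup.subset_closure ?_⟩
  have h1 : orderOf (g ^ p ^ n) = m := by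
    rw [orderOf_pow_of_dvd (pow_ne_zero n hp.out.ne_zero) ⟨m, h⟩, h,
      Nat.mul_div_cancel_left _ (pow_pos hp.out.pos n)]
  rw [Set.mem_ofPred_eq, h1]
  exact ((Nat.Prime.coprime_iff_not_dvd hp.out).2 hm).symm

theorem pResidual_pResidual (p : ℕ) : pResidual p (pResidual p G) = ⊤ := by
  rw [eq_top_iff, ← Subgroup.map_subtype_le_map_subtype, ← MonoidHom.range_eq_map,
    Subgroup.range_subtype]
  conv_lhs => rw [pResidual]
  rw [Subgroup.closure_le]
  intro x hx
  have hx' : x ∈ pResidual p G := Subgroup.subset_closure hx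
  refine ⟨⟨x, hx'⟩, Subgroup.subset_closure ?_, rfl⟩
  rw [Set.mem_ofPred_eq, Subgroup.orderOf_mk]
  exact hx

/-- The last term of the lower central series of a finite group. -/
def nilpotentResidual (G : Type*) [Group G] : Subgroup G :=
  ⨅ n, (⊤ : Subgroup G).lowerCentralSeries n

theorem isInv_nilpotentResidual (β : G →* G) : IsInv β (nilpotentResidual G) := by
  intro a ha
  rw [nilpotentResidual, Subgroup.mem_iInf] at ha ⊢
  exact fun n => isInv_lowerCentralSeries β n a (ha n)

theorem nilpotentResidual_le_pResidual [Finite G] (p : ℕ) [Fact p.Prime] :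
    nilpotentResidual G ≤ pResidual p G := by
  have hP : IsPGroup p (G ⧸ pResidual p G) := by
    intro x
    induction x using QuotientGroup.induction_on with | H g =>
    obtain ⟨n, hn⟩ := exists_pow_mem_pResidual p g
    exact ⟨n, by rw [← QuotientGroup.mk_pow]; exact (QuotientGroup.eq_one_iff _).2 hn⟩
  have hnil := hP.isNilpotent
  obtain ⟨n, hn⟩ := Subgroup.nilpotent_iff_lowerCentralSeries.1 hnil
  refine (iInf_le _ n).trans ?_
  have h1 := Subgroup.map_lowerCentralSeries (⊤ : Subgroup G)
    (QuotientGroup.mk' (pResidual p G)) n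
  rw [Subgroup.map_top_of_surjective _ (QuotientGroup.mk'_surjective _), hn,
    Subgroup.map_eq_bot_iff, QuotientGroup.ker_mk'] at h1
  exact h1

theorem exists_lowerCentralSeries_eq_nilpotentResidual [Finite G] :
    ∃ n, (⊤ : Subgroup G).lowerCentralSeries n = nilpotentResidual G := by
  obtain ⟨n, hn⟩ := WellFoundedGT.monotone_chain_condition (α := (Subgroup G)ᵒᵈ)
    ⟨fun n => OrderDual.toDual ((⊤ : Subgroup G).lowerCentralSeries n), fun _ _ h =>
      Subgroup.lowerCentralSeries_antitone _ h⟩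
  refine ⟨n, le_antisymm (le_iInf fun m => ?_) (iInf_le _ n)⟩
  rcases le_total n m with h | h
  · exact le_of_eq (hn m h)
  · exact Subgroup.lowerCentralSeries_antitone _ h

/-- The restriction of an endomorphism to an invariant subgroup. -/
def restrictEnd (β : G →* G) {A : Subgroup G} (hA : IsInv β A) : A →* A :=
  (β.comp A.subtype).codRestrict A fun a => hA a a.2

theorem subtype_restrictEnd (β : G →* G) {A : Subgroup G} (hA : IsInv β A) (x : A) :
    A.subtype (restrictEnd β hA x) = β (A.subtype x) := rfl

theorem restrictEnd_injective {β : G →* G} (hβ : Function.Injective β) {A : Subgroup G}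
    (hA : IsInv β A) : Function.Injective (restrictEnd β hA) := fun _ _ h =>
  Subtype.ext (hβ (congrArg Subtype.val h))

theorem IsInv.exists_eq [Finite G] {β : G →* G} (hβ : Function.Injective β) {A : Subgroup G}
    (hA : IsInv β A) {a : G} (ha : a ∈ A) : ∃ a' ∈ A, β a' = a := by
  obtain ⟨⟨a', ha'⟩, h⟩ := Finite.surjective_of_injective (restrictEnd_injective hβ hA) ⟨a, ha⟩
  exact ⟨a', ha', congrArg Subtype.val h⟩

theorem IsInv.centralizer [Finite G] {β : G →* G} (hβ : Function.Injective β) {A : Subgroup G}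
    (hA : IsInv β A) : IsInv β (Subgroup.centralizer (A : Set G)) := by
  intro c hc
  rw [Subgroup.mem_centralizer_iff] at hc ⊢
  intro a ha
  obtain ⟨a', ha', rfl⟩ := hA.exists_eq hβ ha
  rw [← map_mul, hc a' ha', map_mul]

theorem list_prod_zpow (x : G) (n : ℕ) (F : ℕ → ℤ) :
    ((List.range n).map fun i => x ^ F i).prod = x ^ ∑ i ∈ Finset.range n, F i := by
  induction n with
  | zero => simp
  | succ n ih =>
    rw [List.range_succ, List.map_append, List.prod_append, ih, Finset.sum_range_succ, zpow_add]
    simp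

theorem orderedEval_of_fixed {β : G →* G} {x : G} (hx : β x = x) (g : ℤ[X]) :
    orderedEval β g x = x ^ g.eval 1 := by
  have hit : ∀ i, β^[i] x = x := fun i => Function.iterate_fixed hx i
  simp only [orderedEval, hit]
  rw [list_prod_zpow, eval_eq_sum_range]
  simp

/-- On the section `⟨x⟩ / ⟨x ^ q⟩` given by a fixed point `x` of `β`, the endomorphism `g(β)` is
multiplication by `g(1)`. -/
theorem eq_one_of_fixed [Finite G] {β : G →* G} {g : ℤ[X]}
    (h : ∀ q : ℕ, q.Prime → Kills q β g ⊥ ⊤)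
    (h1 : ∀ q : ℕ, q.Prime → q ∣ Nat.card G → ¬ (q : ℤ) ∣ g.eval 1) {x : G} (hx : β x = x) :
    x = 1 := by
  by_contra hne
  obtain ⟨q, hq, hqx⟩ := Nat.exists_prime_and_dvd (mt orderOf_eq_one_iff.1 hne)
  refine h1 q hq (hqx.trans (orderOf_dvd_natCard x)) ?_
  have hfix : ∀ n : ℤ, β (x ^ n) = x ^ n := fun n => by rw [map_zpow, hx]
  have h2 := h q hq (Subgroup.zpowers (x ^ q)) (Subgroup.zpowers x)
    ⟨Subgroup.zpowers_le.2 (Subgroup.pow_mem _ (Subgroup.mem_zpowers x) q), ?_, ?_, ?_, ?_⟩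
    bot_le le_top x (Subgroup.mem_zpowers x)
  · rw [orderedEval_of_fixed hx] at h2
    obtain ⟨k, hk⟩ := h2
    have h3 : x ^ (g.eval 1 - q * k) = 1 := by
      rw [zpow_sub, ← hk, mul_inv_eq_one]
      simp [zpow_mul]
    have h4 : (q : ℤ) ∣ g.eval 1 - q * k :=
      (Int.natCast_dvd_natCast.2 hqx).trans (orderOf_dvd_iff_zpow_eq_one.2 h3)
    simpa using (Int.dvd_add h4 (Dvd.intro k rfl))
  · rintro _ ⟨n, rfl⟩
    exact ⟨n, (hfix n).symm⟩
  · rintro _ ⟨n, rfl⟩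
    refine ⟨n, ?_⟩
    have := hfix (q * n)
    simp only [zpow_mul, zpow_natCast] at this
    exact this.symm
  · rw [Subgroup.commutator_le]
    rintro _ ⟨m, rfl⟩ _ ⟨n, rfl⟩
    have : x ^ m * x ^ n * (x ^ m)⁻¹ * (x ^ n)⁻¹ = 1 := by group
    exact (this ▸ Subgroup.one_mem _ : x ^ m * x ^ n * (x ^ m)⁻¹ * (x ^ n)⁻¹ ∈ _)
  · rintro _ ⟨n, rfl⟩
    refine ⟨n, ?_⟩
    simp only [← zpow_natCast, ← zpow_mul]
    rw [mul_comm]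

/-- A fixed-point-free automorphism of a finite group leaves some Sylow subgroup invariant. -/
theorem exists_isInv_sylow [Finite G] (p : ℕ) [Fact p.Prime] {β : G →* G}
    (hβ : Function.Injective β) (hfix : ∀ x, β x = x → x = 1) :
    ∃ P : Sylow p G, IsInv β P := by
  obtain ⟨P⟩ : Nonempty (Sylow p G) := inferInstance
  have hcard : Nat.card ((P : Subgroup G).map β) = Nat.card P :=
    Subgroup.card_map_of_injective hβ
  let Q : Sylow p G := Sylow.ofCard ((P : Subgroup G).map β)
    (hcard.trans (Sylow.card_eq_multiplicity P))
  obtain ⟨y, hy⟩ := MulAction.exists_smul_eq G P Q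
  have hy' : ∀ x ∈ P, y⁻¹ * β x * y ∈ P := by
    intro x hx
    have h1 : β x ∈ Q := Subgroup.mem_map_of_mem β hx
    rw [← hy] at h1
    have h2 := Subgroup.mem_pointwise_smul_iff_inv_smul_mem.1
      (h1 : β x ∈ (MulAut.conj y • (P : Subgroup G)))
    rw [← map_inv, MulAut.smul_def, MulAut.conj_apply, inv_inv] at h2
    exact h2
  -- a suitable conjugate of `P` is invariant, since `y⁻¹` is of the form `h / β h`
  obtain ⟨h, hh⟩ := MonoidHom.FixedPointFree.commutatorMap_surjective (φ := β) hfix y⁻¹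
  rw [MonoidHom.commutatorMap_apply] at hh
  refine ⟨h⁻¹ • P, ?_⟩
  have hmem : ∀ x, x ∈ ((h⁻¹ • P : Sylow p G) : Subgroup G) ↔ h * x * h⁻¹ ∈ P := by
    intro x
    have h2 : x ∈ (MulAut.conj h⁻¹ • (P : Subgroup G)) ↔ _ :=
      Subgroup.mem_pointwise_smul_iff_inv_smul_mem
    rw [← map_inv, MulAut.smul_def, MulAut.conj_apply, inv_inv] at h2
    exact h2
  intro x hx
  rw [hmem] at hx ⊢
  have h3 := hy' _ hx
  rw [← hh, ← inv_inv y, ← hh] at h3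
  simpa [mul_assoc, div_eq_mul_inv] using h3

end FiniteGroups

/-! ### Chief factors -/

section ChiefFactors

universe u
variable {G : Type u} [Group G]

theorem eq_bot_of_le_commutator_sup [Group.IsSolvable G] {L C : Subgroup G} [C.Normal]
    (h : L ≤ ⁅L, L⁆ ⊔ C) : L ≤ C := by
  have key : ∀ n, L ≤ derivedSeries G n ⊔ C := by
    intro n
    induction n with
    | zero => simp
    | succ n ih =>
      rw [derivedSeries_succ]
      refine h.trans (sup_le ?_ le_sup_right)
      exact (Subgroup.commutator_mono ih ih).trans (commutator_sup_le _ C)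
  obtain ⟨n, hn⟩ := (Group.isSolvable_def G).1 inferInstance
  have := key n
  rwa [hn, bot_sup_eq] at this

/-- Above a normal invariant subgroup of a finite solvable group there is a minimal one, and the
factor is elementary abelian. -/
theorem exists_minimal_section [Finite G] [Group.IsSolvable G] {β : G →* G} {C U : Subgroup G}
    [C.Normal] [U.Normal] (hC : IsInv β C) (hU : IsInv β U) (hCU : C < U) :
    ∃ N : Subgroup G, N.Normal ∧ C < N ∧ N ≤ U ∧
      (∀ N' : Subgroup G, N'.Normal → IsInv β N' → C < N' → N' ≤ N → N' = N) ∧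
      ∃ q : ℕ, q.Prime ∧ IsSection q β C N := by
  let S : Set (Subgroup G) := {N | N.Normal ∧ IsInv β N ∧ C < N ∧ N ≤ U}
  obtain ⟨N, ⟨hNn, hNi, hCN, hNU⟩, hmin⟩ :=
    (Set.toFinite S).exists_minimal ⟨U, ‹_›, hU, hCU, le_rfl⟩
  have hmin' : ∀ N' : Subgroup G, N'.Normal → IsInv β N' → C < N' → N' ≤ N → N' = N :=
    fun N' h1 h2 h3 h4 => le_antisymm h4 (hmin ⟨h1, h2, h3, h4.trans hNU⟩ h4)
  have hcomm : ⁅N, N⁆ ≤ C := by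
    by_contra hne
    have hlt : C < ⁅N, N⁆ ⊔ C := lt_of_le_of_ne le_sup_right fun h => hne (h ▸ le_sup_left)
    have h1 := hmin' (⁅N, N⁆ ⊔ C) inferInstance ((hNi.commutator hNi).sup hC) hlt
      (sup_le (Subgroup.commutator_le_left N N) hCN.le)
    exact hCN.not_ge (eq_bot_of_le_commutator_sup h1.ge)
  refine ⟨N, hNn, hCN, hNU, hmin', ?_⟩
  obtain ⟨x, hxN, hxC⟩ := SetLike.exists_of_lt hCN
  have hne : orderOf (x : G ⧸ C) ≠ 1 := fun h =>
    hxC ((QuotientGroup.eq_one_iff x).1 (orderOf_eq_one_iff.1 h))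
  obtain ⟨q, hq, k, hk⟩ := Nat.exists_prime_and_dvd hne
  refine ⟨q, hq, hCN.le, hNi, hC, hcomm, ?_⟩
  obtain ⟨M, _, φ, hφ⟩ := exists_isSecMap hCN.le hcomm
  -- `E / C` consists of the elements of `N / C` of order dividing `q`
  let E : Subgroup G := hφ.comap (zsmulAddGroupHom (q : ℤ) : M →+ M).ker
  have hE : ∀ a, a ∈ E ↔ a ∈ N ∧ a ^ q ∈ C := by
    intro a
    refine and_congr_right fun ha => ?_
    rw [← hφ.eq_zero_iff _ (N.pow_mem ha q), hφ.map_pow ha, AddMonoidHom.mem_ker]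
    simp
  have hEN : E = N := by
    refine hmin' E ⟨fun a ha g => ?_⟩ (fun a ha => ?_) ?_ fun a ha => ((hE a).1 ha).1
    · rw [hE] at ha ⊢
      refine ⟨hNn.conj_mem a ha.1 g, ?_⟩
      rw [conj_pow]
      exact Subgroup.Normal.conj_mem inferInstance _ ha.2 g
    · rw [hE] at ha ⊢
      rw [← map_pow]
      exact ⟨hNi a ha.1, hC _ ha.2⟩
    · refine lt_of_le_of_ne (fun a ha => (hE a).2 ⟨hCN.le ha, C.pow_mem ha q⟩) fun h => ?_
      -- a power of `x` has order `q` modulo `C`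
      have h1 : x ^ k ∈ E := by
        rw [hE, ← pow_mul, mul_comm k q, ← hk]
        exact ⟨N.pow_mem hxN k, (QuotientGroup.eq_one_iff _).1 (pow_orderOf_eq_one (x : G ⧸ C))⟩
      rw [← h] at h1
      have h2 : orderOf (x : G ⧸ C) ∣ k :=
        orderOf_dvd_of_pow_eq_one ((QuotientGroup.eq_one_iff (x ^ k)).2 h1)
      have hk0 : 0 < k := by
        rcases Nat.eq_zero_or_pos k with h3 | h3
        · rw [h3, mul_zero] at hk
          exact absurd hk (orderOf_pos _).ne'
        · exact h3
      have h3 := Nat.le_of_dvd hk0 h2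
      rw [hk] at h3
      have := Nat.mul_le_mul_right k hq.two_le
      omega
  intro a ha
  rw [← hEN] at ha
  exact ((hE a).1 ha).2

/-- The ring homomorphism from additive to `ZMod p`-linear endomorphisms. -/
def zmodEnd (p : ℕ) (M : Type*) [AddCommGroup M] [Module (ZMod p) M] :
    Module.End ℤ M →+* Module.End (ZMod p) M where
  toFun T := AddMonoidHom.toZModLinearMap p T.toAddMonoidHom
  map_one' := rfl
  map_mul' _ _ := rfl
  map_zero' := rfl
  map_add' _ _ := rfl

theorem aeval_zmodEnd {p : ℕ} {M : Type*} [AddCommGroup M] [Module (ZMod p) M]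
    (T : Module.End ℤ M) (g : ℤ[X]) :
    aeval (zmodEnd p M T) g = zmodEnd p M (aeval T g) :=
  aeval_algHom_apply (zmodEnd p M).toIntAlgHom T g

/-- The conjugation action of `G` on an elementary abelian normal subgroup, as a representation. -/
theorem exists_conj_representation {p : ℕ} {N : Subgroup G} [hN : N.Normal] {M : Type u}
    [AddCommGroup M] [Module (ZMod p) M] {φ : G → M} (hφ : IsSecMap ⊥ N φ) :
    ∃ ρ : G →* Module.End (ZMod p) M, ∀ g, ∀ a ∈ N, ρ g (φ a) = φ (g * a * g⁻¹) := by
  have h1 : ∀ g : G, ∃ T : Module.End ℤ M, ∀ a ∈ N, φ (g * a * g⁻¹) = T (φ a) := fun g =>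
    hφ.exists_end (γ := (MulAut.conj g).toMonoidHom) (fun a ha => hN.conj_mem a ha g)
      (IsInv.bot _)
  choose T hT using h1
  refine ⟨(zmodEnd p M).toMonoidHom.comp
    { toFun := T, map_one' := ?_, map_mul' := ?_ }, fun g a ha => (hT g a ha).symm⟩
  · refine hφ.ext_end fun a ha => ?_
    rw [← hT 1 a ha]
    simp
  · intro g g'
    refine hφ.ext_end fun a ha => ?_
    rw [← hT _ a ha, Module.End.mul_apply, ← hT g' a ha, ← hT g _ (hN.conj_mem a ha g')]
    simp [mul_assoc]

/-- A group of exponent `p` acting on a nontrivial elementary abelian `p`-group has nontrivial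
fixed points. -/
theorem exists_fixed_of_pow [Finite G] {p : ℕ} [Fact p.Prime] {N L : Subgroup G}
    [hN : N.Normal] (hNp : ∀ a ∈ N, a ^ p = 1) (hN1 : N ≠ ⊥)
    (hL : ∀ l ∈ L, ∀ a ∈ N, l ^ p * a * (l ^ p)⁻¹ = a) :
    ∃ a ∈ N, a ≠ 1 ∧ ∀ l ∈ L, l * a * l⁻¹ = a := by
  let Λ : Subgroup (MulAut N) := L.map MulAut.conjNormal
  have hΛ : IsPGroup p Λ := by
    rintro ⟨_, l, hl, rfl⟩
    refine ⟨1, Subtype.ext ?_⟩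
    change MulAut.conjNormal l ^ p ^ 1 = 1
    rw [pow_one, ← map_pow]
    ext a
    rw [MulAut.conjNormal_apply]
    exact hL l hl a a.2
  have hNpg : IsPGroup p N := fun a => ⟨1, Subtype.ext (by simpa using hNp a a.2)⟩
  have hdvd : p ∣ Nat.card N := by
    have hne : Nontrivial N := (Subgroup.nontrivial_iff_ne_bot N).2 hN1
    obtain ⟨n, hn0, hn⟩ := hNpg.nontrivial_iff_card.1 hne
    rw [hn]
    exact dvd_pow_self p hn0.ne'
  have h1 : (1 : N) ∈ MulAction.fixedPoints Λ N := fun σ => map_one (σ : MulAut N)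
  obtain ⟨a, ha, ha1⟩ := hΛ.exists_fixed_point_of_prime_dvd_card_of_fixed_point N hdvd h1
  refine ⟨a, a.2, fun h => ha1 (Subtype.ext h.symm), fun l hl => ?_⟩
  have h2 := ha ⟨MulAut.conjNormal l, Subgroup.mem_map_of_mem _ hl⟩
  have h3 := congrArg Subtype.val h2
  exact h3

/-- On a section without fixed points of `σ`, every element has the form `l⁻¹ σ(l)`. -/
theorem exists_eq_inv_mul [Finite G] {q : ℕ} (hq : q.Prime) {β : G →* G} {C L : Subgroup G}
    (hs : IsSection q β C L) {b : ℤ[X]} {m : ℕ} (hb : Kills q β (expand ℤ m b) ⊥ ⊤)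
    (h1 : ¬ (q : ℤ) ∣ b.eval 1) {l : G} (hl : l ∈ L) :
    ∃ l' ∈ L, l⁻¹ * (l'⁻¹ * β^[m] l') ∈ C := by
  obtain ⟨M, _, φ, hφ⟩ := exists_isSecMap hs.le hs.comm
  obtain ⟨T, hT⟩ := hφ.exists_end hs.inv_top hs.inv_bot
  have hTb : aeval (T ^ m) b = 0 := by
    rw [← expand_aeval]
    exact (hφ.forall_orderedEval_mem_iff hs.inv_top hT _).1 fun a ha =>
      hb C L hs bot_le le_top a ha
  have hqM := hφ.nsmul_eq_zero hs.pow
  have hfin : Finite M := Finite.of_surjective (fun a : L => φ a) fun m => by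
    obtain ⟨a, ha, rfl⟩ := hφ.surj m
    exact ⟨⟨a, ha⟩, rfl⟩
  have hinj : Function.Injective (T ^ m - 1 : Module.End ℤ M) := by
    rw [injective_iff_map_eq_zero]
    intro x hx
    have hx' : (T ^ m) x = x := sub_eq_zero.1 hx
    have h2 : ∀ i : ℕ, ((T ^ m) ^ i) x = x := by
      intro i
      induction i with
      | zero => rfl
      | succ i ih => rw [pow_succ', Module.End.mul_apply, ih, hx']
    have h3 : b.eval 1 • x = 0 := by
      have h4 : aeval (T ^ m) b x = b.eval 1 • x := by
        rw [aeval_eq_sum_range, LinearMap.sum_apply, eval_eq_sum_range, Finset.sum_smul]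
        refine Finset.sum_congr rfl fun i _ => ?_
        rw [LinearMap.smul_apply, h2, one_pow, mul_one]
      rw [← h4, hTb, LinearMap.zero_apply]
    have hcop : IsCoprime (b.eval 1) (q : ℤ) :=
      ((Nat.prime_iff_prime_int.1 hq).coprime_iff_not_dvd.2 h1).symm
    obtain ⟨u, v, huv⟩ := hcop
    calc x = (u * b.eval 1 + v * q) • x := by rw [huv, one_smul]
      _ = u • (b.eval 1 • x) + v • ((q : ℤ) • x) := by rw [add_smul, mul_smul, mul_smul]
      _ = 0 := by rw [h3, natCast_zsmul, hqM, smul_zero, smul_zero, add_zero]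
  obtain ⟨y, hy⟩ := Finite.surjective_of_injective hinj (φ l)
  obtain ⟨l', hl', rfl⟩ := hφ.surj y
  refine ⟨l', hl', ?_⟩
  have hm := hs.inv_top.iterate hl' m
  rw [← hφ.eq_iff hl (L.mul_mem (L.inv_mem hl') hm), hφ.map_mul _ (L.inv_mem hl') _ hm,
    hφ.map_inv hl', map_iterate_apply hs.inv_top hT m hl', ← hy, LinearMap.sub_apply,
    Module.End.one_apply, neg_add_eq_sub]

/-- A noncentral chief factor `N`: a minimal normal invariant subgroup `L / C(N)` of `G / C(N)` is
an elementary abelian `q`-group with `q ≠ p` that has no fixed points on `N`. Every element of it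
is a commutator with `β^m`, so that no weight of it on `N` is fixed by `β^m`. -/
theorem orderedEval_eq_one_of_noncentral [Finite G] [Group.IsSolvable G] {p : ℕ} [hp : Fact p.Prime]
    {β : G →* G} (hβ : Function.Injective β) {N : Subgroup G} [hN : N.Normal]
    (hs : IsSection p β ⊥ N) (hN1 : N ≠ ⊥)
    (hmin : ∀ N' : Subgroup G, N'.Normal → IsInv β N' → ⊥ < N' → N' ≤ N → N' = N)
    (hnc : ¬ N ≤ Subgroup.center G) {b s : ℤ[X]} {m : ℕ}
    (hb1 : ∀ q : ℕ, q.Prime → q ∣ Nat.card G → ¬ (q : ℤ) ∣ b.eval 1)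
    (hb : ∀ q : ℕ, q.Prime → Kills q β (expand ℤ m b) ⊥ ⊤)
    (hr : ∀ n : ℕ, 2 ≤ n → ∃ r : ℤ, ¬ (p : ℤ) ∣ r ∧
      C r * s ∈ Ideal.span {q | ∃ i < n, q = part b n i}) :
    ∀ a ∈ N, orderedEval β (expand ℤ m s) a = 1 := by
  let Z : Subgroup G := Subgroup.centralizer (N : Set G)
  have hZi : IsInv β Z := hs.inv_top.centralizer hβ
  have hZmem : ∀ z ∈ Z, ∀ a ∈ N, z * a * z⁻¹ = a := by
    intro z hz a ha
    rw [← Subgroup.mem_centralizer_iff.1 hz a ha, mul_inv_cancel_right]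
  have hZmem' : ∀ z, (∀ a ∈ N, z * a * z⁻¹ = a) → z ∈ Z := by
    intro z h
    refine Subgroup.mem_centralizer_iff.2 fun a ha => ?_
    conv_lhs => rw [← h a ha, inv_mul_cancel_right]
  have hZtop : Z < ⊤ := by
    refine lt_top_iff_ne_top.2 fun h => hnc fun a ha => Subgroup.mem_center_iff.2 fun g => ?_
    have hg : g ∈ Z := h ▸ Subgroup.mem_top g
    exact (Subgroup.mem_centralizer_iff.1 hg a ha).symm
  obtain ⟨L, hLn, hZL, -, -, q, hq, hLs⟩ := exists_minimal_section hZi (IsInv.top β) hZtop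
  -- `L` has no fixed points on `N`
  have hfix : ∀ a ∈ N, (∀ l ∈ L, l * a * l⁻¹ = a) → a = 1 := by
    intro a ha hla
    by_contra hne
    let N' : Subgroup G := N ⊓ Subgroup.centralizer (L : Set G)
    have haN' : a ∈ N' := ⟨ha, Subgroup.mem_centralizer_iff.2 fun l hl => by
      conv_rhs => rw [← hla l hl, inv_mul_cancel_right]⟩
    have h1 : N' = N := hmin N' inferInstance (hs.inv_top.inf (hLs.inv_top.centralizer hβ))
      (bot_lt_iff_ne_bot.2 fun h => hne (by
        rw [h] at haN'
        exact Subgroup.mem_bot.1 haN')) inf_le_left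
    have h2 : N ≤ Subgroup.centralizer (L : Set G) := inf_eq_left.1 h1
    refine hZL.not_ge fun l hl => Subgroup.mem_centralizer_iff.2 fun n hn => ?_
    exact (Subgroup.mem_centralizer_iff.1 (h2 hn) l hl).symm
  have hqp : q ≠ p := by
    rintro rfl
    obtain ⟨a, ha, ha1, hla⟩ := exists_fixed_of_pow (p := q)
      (fun a ha => Subgroup.mem_bot.1 (hs.pow a ha)) hN1
      (fun l hl => hZmem _ (hLs.pow l hl))
    exact ha1 (hfix a ha hla)
  have hqG : q ∣ Nat.card G := by
    obtain ⟨x, hxL, hxZ⟩ := SetLike.exists_of_lt hZL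
    by_contra hnd
    have hcop : (orderOf x).Coprime q :=
      ((Nat.Prime.coprime_iff_not_dvd hq).2 fun h => hnd (h.trans (orderOf_dvd_natCard x))).symm
    obtain ⟨k, hk⟩ := exists_pow_eq_self_of_coprime hcop.symm
    exact hxZ (hk ▸ Z.pow_mem (hLs.pow x hxL) k)
  obtain ⟨M, _, φ, hφ⟩ := exists_isSecMap hs.le hs.comm
  have hpM := hφ.nsmul_eq_zero hs.pow
  obtain ⟨_⟩ : Nonempty (Module (ZMod p) M) := ⟨AddCommGroup.zmodModule hpM⟩
  have hfin : Finite M := Finite.of_surjective (fun a : N => φ a) fun m => by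
    obtain ⟨a, ha, rfl⟩ := hφ.surj m
    exact ⟨⟨a, ha⟩, rfl⟩
  have hfd : FiniteDimensional (ZMod p) M := Module.Finite.of_finite
  obtain ⟨T, hT⟩ := hφ.exists_end hs.inv_top hs.inv_bot
  obtain ⟨ρ, hρ⟩ := exists_conj_representation (p := p) hφ
  have hρZ : ∀ z ∈ Z, ρ z = ρ 1 := fun z hz => by
    refine LinearMap.ext fun v => ?_
    obtain ⟨a, ha, rfl⟩ := hφ.surj v
    rw [hρ z a ha, hZmem z hz a ha, map_one]
    rfl
  have hρeq : ∀ g g' : G, g⁻¹ * g' ∈ Z → ρ g = ρ g' := by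
    intro g g' h
    rw [← mul_inv_cancel_left g g', map_mul ρ g, hρZ _ h, map_one, mul_one]
  have hβm : ∀ (g h : G), β^[m] (g * h) = β^[m] g * β^[m] h := fun g h => iterate_map_mul β m g h
  let σ₀ : L →* L :=
    { toFun := fun l => ⟨β^[m] l, hLs.inv_top.iterate l.2 m⟩
      map_one' := Subtype.ext (iterate_map_one β m)
      map_mul' := fun l l' => Subtype.ext (hβm l l') }
  have hσ₀ : Function.Injective σ₀ := fun l l' h =>
    Subtype.ext ((hβ.iterate m) (congrArg Subtype.val h))
  let σ : L ≃* L := MulEquiv.ofBijective σ₀ ⟨hσ₀, Finite.surjective_of_injective hσ₀⟩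
  have hkill := hφ.forall_orderedEval_mem_iff hs.inv_top hT
  have hTb : aeval (zmodEnd p M (T ^ m)) b = 0 := by
    rw [aeval_zmodEnd, ← expand_aeval,
      (hkill _).1 fun a ha => hb p hp.out ⊥ N hs le_rfl le_top a ha, map_zero]
  have hTs : aeval (zmodEnd p M (T ^ m)) s = 0 := by
    refine aeval_eq_zero_of_exponent (ρ.comp L.subtype) (fun l l' => ?_) (q := q) ?_ ?_ ?_ σ
      (zmodEnd p M (T ^ m)) (fun l => ?_) (fun l => ?_) hTb fun n hn => ?_
    · change ρ l * ρ l' = ρ l' * ρ l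
      rw [← map_mul, ← map_mul]
      refine hρeq _ _ ?_
      have h1 : (l' : G)⁻¹ * (l : G)⁻¹ * (l' : G)⁻¹⁻¹ * (l : G)⁻¹⁻¹ ∈ Z :=
        hLs.comm (Subgroup.commutator_mem_commutator (L.inv_mem l'.2) (L.inv_mem l.2))
      simpa [mul_assoc] using h1
    · rw [Ne, ZMod.natCast_eq_zero_iff]
      exact fun h => hqp ((Nat.prime_dvd_prime_iff_eq hp.out hq).1 h).symm
    · intro l
      change ρ l ^ q = 1
      rw [← map_pow]
      rw [hρZ _ (hLs.pow l l.2), map_one]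
    · intro v hv
      obtain ⟨a, ha, rfl⟩ := hφ.surj v
      rw [hφ.eq_zero_iff a ha, Subgroup.mem_bot]
      refine hfix a ha fun l hl => ?_
      have h1 : ρ l (φ a) = φ a := hv ⟨l, hl⟩
      rw [hρ l a ha, hφ.eq_iff (hN.conj_mem a ha l) ha, Subgroup.mem_bot, inv_mul_eq_one] at h1
      exact h1
    · refine hφ.ext_end fun a ha => ?_
      change ρ (β^[m] l) ((T ^ m) (φ a)) = (T ^ m) (ρ l (φ a))
      have hmem := hN.conj_mem a ha l
      rw [hρ l a ha, ← map_iterate_apply hs.inv_top hT m ha,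
        ← map_iterate_apply hs.inv_top hT m hmem, hρ _ _ (hs.inv_top.iterate ha m),
        hβm, hβm, iterate_map_inv]
    · obtain ⟨l', hl', h⟩ := exists_eq_inv_mul hq hLs (hb q hq) (hb1 q hq hqG) l.2
      exact ⟨⟨l', hl'⟩, hρeq _ _ h⟩
    · obtain ⟨r, hr0, hrs⟩ := hr n hn
      exact ⟨r, fun h => hr0 ((ZMod.intCast_zmod_eq_zero_iff_dvd _ _).1 h), hrs⟩
  have hTs' : aeval T (expand ℤ m s) = 0 := by
    rw [expand_aeval]
    rw [aeval_zmodEnd] at hTs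
    exact LinearMap.ext fun v => LinearMap.congr_fun hTs v
  intro a ha
  exact Subgroup.mem_bot.1 ((hkill _).2 hTs' a ha)

end ChiefFactors

/-! ### Vanishing on the residual of `p`-power index -/

section Residual

universe u
variable {G : Type u} [Group G]

theorem eq_one_of_coprime_of_isPGroup {A : Type*} [Group A] {p : ℕ} [Fact p.Prime]
    (hA : IsPGroup p A) (τ : G →* A) {x : G} (hx : (orderOf x).Coprime p) : τ x = 1 := by
  obtain ⟨k, hk⟩ := hA (τ x)
  have h1 : orderOf (τ x) ∣ 1 := (hx.pow_right k).gcd_eq_one ▸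
    Nat.dvd_gcd (orderOf_map_dvd τ x) (orderOf_dvd_of_pow_eq_one hk)
  exact orderOf_eq_one_iff.1 (Nat.dvd_one.1 h1)

/-- If `G` has no proper normal subgroup of `p`-power index, then the transfer into the
abelianization of a Sylow `p`-subgroup is trivial. On a central element it is a power
with exponent prime to `p`, so that the central elements of the Sylow subgroup lie in its
commutator subgroup. -/
theorem mem_commutator_sylow_of_mem_center [Finite G] {p : ℕ} [hp : Fact p.Prime]
    (hres : pResidual p G = ⊤) (P : Sylow p G) {z : G} (hz : z ∈ Subgroup.center G) (hzP : z ∈ P) :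
    (⟨z, hzP⟩ : (P : Subgroup G)) ∈ commutator (P : Subgroup G) := by
  let τ := MonoidHom.transfer (Abelianization.of : (P : Subgroup G) →* _)
  have hA : IsPGroup p (Abelianization (P : Subgroup G)) :=
    P.isPGroup'.of_surjective Abelianization.of (QuotientGroup.mk'_surjective _)
  have hτ : τ z = 1 := by
    have h1 : pResidual p G ≤ τ.ker := by
      rw [pResidual, Subgroup.closure_le]
      exact fun x hx => eq_one_of_coprime_of_isPGroup hA τ hx
    exact h1 (hres ▸ Subgroup.mem_top z)
  have hcomm : ∀ (k : ℕ) (g : G), g⁻¹ * z ^ k * g = z ^ k := by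
    intro k g
    have h1 := Subgroup.mem_center_iff.1 ((Subgroup.center G).pow_mem hz k) g
    rw [mul_assoc, ← h1, inv_mul_cancel_left]
  have h2 := MonoidHom.transfer_eq_pow (Abelianization.of : (P : Subgroup G) →* _) z
    fun k g _ => hcomm k g
  have h2' := h2.symm.trans hτ
  have h3 : (⟨z, hzP⟩ : (P : Subgroup G)) ^ (P : Subgroup G).index ∈
      commutator (P : Subgroup G) := by
    rw [← Abelianization.ker_of, MonoidHom.mem_ker, ← h2']
    rfl
  obtain ⟨k, hk⟩ := P.isPGroup' ⟨z, hzP⟩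
  have hcop : ((P : Subgroup G).index).Coprime (orderOf (⟨z, hzP⟩ : (P : Subgroup G))) :=
    Nat.Coprime.coprime_dvd_right (orderOf_dvd_of_pow_eq_one hk)
      (((Nat.Prime.coprime_iff_not_dvd hp.out).2 P.not_dvd_index).symm.pow_right k)
  obtain ⟨j, hj⟩ := exists_pow_eq_self_of_coprime hcop
  rw [← hj]
  exact Subgroup.pow_mem _ h3 j

/-- A central chief factor of a group without proper normal subgroups of `p`-power index: it lies
in the commutator subgroup of an invariant Sylow subgroup. -/
theorem orderedEval_eq_one_of_central [Finite G] {p : ℕ} [hp : Fact p.Prime] {β : G →* G}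
    (hβ : Function.Injective β) (hfix : ∀ x, β x = x → x = 1) (hres : pResidual p G = ⊤)
    {N : Subgroup G} [N.Normal] (hs : IsSection p β ⊥ N) (hc : N ≤ Subgroup.center G)
    {s t : ℤ[X]} (hst : IsCoprime (red p s) (red p t)) (hpp : HasProductPolynomial.{u} p s t)
    {m : ℕ} (h : Kills p β (expand ℤ m s * expand ℤ m t) ⊥ ⊤)
    (hN : Kills p β (expand ℤ m s) N ⊤) :
    ∀ a ∈ N, orderedEval β (expand ℤ m s) a = 1 := by
  obtain ⟨P, hP⟩ := exists_isInv_sylow p hβ hfix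
  have hNp : IsPGroup p N := fun a =>
    ⟨1, Subtype.ext (by simpa using hs.pow a a.2)⟩
  have hNP : N ≤ P := hNp.le_sylow_of_normal P
  have hψ := subtype_restrictEnd β hP
  have hker : ∀ L : Subgroup (P : Subgroup G), (P : Subgroup G).subtype.ker ≤ L := fun L => by
    rw [Subgroup.ker_subtype]
    exact bot_le
  have h₁ : Kills p (restrictEnd β hP) (expand ℤ m s) (commutator (P : Subgroup G)) ⊤ := by
    refine hN.comap _ hψ (fun z hz => ?_) le_top (hker _)
    exact ⟨_, mem_commutator_sylow_of_mem_center hres P (hc hz) (hNP hz), rfl⟩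
  have h₀ : Kills p (restrictEnd β hP) (expand ℤ m s * expand ℤ m t) ⊥ ⊤ :=
    h.comap _ hψ bot_le le_top (hker _)
  obtain ⟨e, he⟩ := IsPGroup.iff_card.1 P.isPGroup'
  have hnil : Group.IsNilpotent (P : Subgroup G) := P.isPGroup'.isNilpotent
  have h₂ := Kills.of_commutator (e := e) (fun a => he ▸ pow_card_eq_one') hst hpp h₀ h₁
  have h₃ : Kills p β (expand ℤ m s) ⊥ N :=
    h₂.map _ hψ bot_le le_top (by rwa [Subgroup.range_subtype])
  exact fun a ha => Subgroup.mem_bot.1 (h₃ ⊥ N hs le_rfl le_rfl a ha)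

theorem IsSection.eq_of_coprime {p r : ℕ} (hpr : p.Coprime r) {β : G →* G} {B A : Subgroup G}
    (hs : IsSection p β B A) (hA : ∀ a ∈ A, a ^ r = 1) : B = A := by
  refine le_antisymm hs.le fun a ha => ?_
  obtain ⟨k, hk⟩ := exists_pow_eq_self_of_coprime
    (Nat.Coprime.coprime_dvd_right (orderOf_dvd_of_pow_eq_one (hA a ha)) hpr)
  rw [← hk]
  exact B.pow_mem (hs.pow a ha) k

/-- The polynomial `s` annihilates all `p`-sections below `pResidual p G`, by induction along a
chief series. -/
theorem kills_pResidual {p : ℕ} [hp : Fact p.Prime] {s t : ℤ[X]} {m : ℕ}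
    (hst : IsCoprime (red p s) (red p t)) (hpp : HasProductPolynomial.{u} p s t)
    (hr : ∀ n : ℕ, 2 ≤ n → ∃ r : ℤ, ¬ (p : ℤ) ∣ r ∧
      C r * s ∈ Ideal.span {q | ∃ i < n, q = part (s * t) n i})
    (n : ℕ) : ∀ (G : Type u) [Group G] [Finite G] [Group.IsSolvable G] (_ : Nat.card G = n)
      {β : G →* G} (_ : Function.Injective β)
      (_ : ∀ q : ℕ, q.Prime → q ∣ Nat.card G → ¬ (q : ℤ) ∣ (s * t).eval 1)
      (_ : ∀ q : ℕ, q.Prime → Kills q β (expand ℤ m (s * t)) ⊥ ⊤),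
      Kills p β (expand ℤ m s) ⊥ (pResidual p G) := by
  induction n using Nat.strong_induction_on with
  | _ n ih =>
  intro G _ _ _ hG β hβ hb1 hb
  rcases eq_bot_or_bot_lt (pResidual p G) with hR | hR
  · rw [hR]
    intro B A hs _ hA a ha
    exact bot_le (a := B) (hA (hs.inv_top.orderedEval_mem _ ha))
  obtain ⟨N, hN, hN0, hNR, hmin, r, hrp, hs⟩ :=
    exists_minimal_section (IsInv.bot β) (isInv_pResidual p β) hR
  have hst' := isCoprime_red_expand hst m
  have hbp : Kills p β (expand ℤ m s * expand ℤ m t) ⊥ ⊤ := by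
    rw [← map_mul]
    exact hb p hp.out
  have hNi := hs.inv_top
  have hfix : ∀ x, β x = x → x = 1 := fun x hx =>
    eq_one_of_fixed hb (fun q hq hqG => by
      rw [expand_eval, one_pow]
      exact hb1 q hq hqG) hx
  -- the part above `N`
  have h₂ : Kills p β (expand ℤ m s) N (pResidual p G) := by
    let γ : G ⧸ N →* G ⧸ N := QuotientGroup.map N N β hNi
    have hγ : ∀ x, QuotientGroup.mk' N (β x) = γ (QuotientGroup.mk' N x) := fun x => rfl
    have hγi : Function.Injective γ := by
      rw [injective_iff_map_eq_one]
      intro x hx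
      induction x using QuotientGroup.induction_on with | H x =>
      have h3 : β x ∈ N := (QuotientGroup.eq_one_iff _).1 hx
      obtain ⟨y, hy, hyx⟩ := hNi.exists_eq hβ h3
      rw [hβ hyx] at hy
      exact (QuotientGroup.eq_one_iff _).2 hy
    have hcard : Nat.card (G ⧸ N) < n := by
      rw [← hG, Subgroup.card_eq_card_quotient_mul_card_subgroup N]
      exact lt_mul_of_one_lt_right Nat.card_pos
        ((Subgroup.one_lt_card_iff_ne_bot N).2 hN0.ne')
    have h3 := ih _ hcard (G ⧸ N) rfl hγi
      (fun q hq hqN => hb1 q hq (hqN.trans (Subgroup.card_quotient_dvd_card N)))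
      (fun q hq => (hb q hq).map (QuotientGroup.mk' N) hγ bot_le le_top
        (by rw [QuotientGroup.range_mk']))
    exact h3.comap (QuotientGroup.mk' N) hγ bot_le (map_pResidual_le p _)
      (by rw [QuotientGroup.ker_mk'])
  refine Kills.trans hst' hNi hN0.le hNR (hbp.mono le_rfl le_top) ?_ h₂
  by_cases hrp' : r = p
  swap
  · intro B A hBA _ hA a ha
    rw [hBA.eq_of_coprime ((Nat.coprime_primes hp.out hrp).2 (Ne.symm hrp'))
      fun a ha => Subgroup.mem_bot.1 (hs.pow a (hA ha))]
    exact hBA.inv_top.orderedEval_mem _ ha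
  subst hrp'
  suffices h : ∀ a ∈ N, orderedEval β (expand ℤ m s) a = 1 by
    intro B A _ _ hA a ha
    rw [h a (hA ha)]
    exact B.one_mem
  by_cases hc : N ≤ Subgroup.center G
  swap
  · exact orderedEval_eq_one_of_noncentral hβ hs hN0.ne'
      (fun N' h1 h2 h3 h4 => hmin N' h1 h2 h3 h4) hc hb1 hb hr
  let Y : Subgroup G := pResidual r G
  have hY : IsInv β Y := isInv_pResidual r β
  have hψ := subtype_restrictEnd β hY
  have hker : ∀ L : Subgroup Y, Y.subtype.ker ≤ L := fun L => by
    rw [Subgroup.ker_subtype]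
    exact bot_le
  have hsY : IsSection r (restrictEnd β hY) ⊥ (N.subgroupOf Y) := by
    refine ⟨bot_le, fun a ha => hNi a ha, IsInv.bot _, ?_, fun a ha => ?_⟩
    · rw [Subgroup.commutator_le]
      intro a ha b hb
      have h3 := Subgroup.mem_bot.1 (hs.comm (Subgroup.commutator_mem_commutator ha hb))
      exact Subgroup.mem_bot.2 (Subtype.ext h3)
    · exact Subgroup.mem_bot.2 (Subtype.ext (Subgroup.mem_bot.1 (hs.pow a ha)))
  have h₃ := orderedEval_eq_one_of_central (restrictEnd_injective hβ hY)
    (fun x hx => Subtype.ext (hfix x (congrArg Subtype.val hx))) (pResidual_pResidual r) hsY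
    (fun a ha => Subgroup.mem_center_iff.2 fun g =>
      Subtype.ext (Subgroup.mem_center_iff.1 (hc ha) g)) hst hpp
    (hbp.comap Y.subtype hψ bot_le le_top (hker _))
    (h₂.comap Y.subtype hψ (fun a ha => ⟨⟨a, hNR ha⟩, ha, rfl⟩)
      (by rw [← MonoidHom.range_eq_map, Subgroup.range_subtype]) (hker _))
  intro a ha
  have h4 := congrArg Y.subtype (h₃ ⟨a, hNR ha⟩ ha)
  rwa [map_orderedEval Y.subtype hψ, map_one] at h4

end Residual

/-! ### Characteristic series with nilpotent factors -/

section Series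

universe u

/-- A series `1 = N 0 ≤ ⋯ ≤ N n = G` of characteristic subgroups of `G` with nilpotent factors;
the nilpotency of `N (i + 1) / N i` is expressed by a term of the lower central series of
`N (i + 1)` that is contained in `N i`. -/
def HasCharacteristicSeries (G : Type*) [Group G] (n : ℕ) : Prop :=
  ∃ N : ℕ → Subgroup G, (∀ i, (N i).Characteristic) ∧ N 0 = ⊥ ∧ N n = ⊤ ∧
    ∀ i < n, N i ≤ N (i + 1) ∧ ∃ j, (N (i + 1)).lowerCentralSeries j ≤ N i

theorem HasCharacteristicSeries.hasNilpotentSeries {G : Type*} [Group G] {n : ℕ}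
    (h : HasCharacteristicSeries G n) : HasNilpotentSeries G n := by
  obtain ⟨N, hN, h0, hn, h⟩ := h
  refine ⟨N, fun i => inferInstance, h0, hn, fun i hi => ⟨(h i hi).1, ?_⟩⟩
  obtain ⟨j, hj⟩ := (h i hi).2
  refine Subgroup.nilpotent_iff_lowerCentralSeries.2 ⟨j, ?_⟩
  have h1 := Subgroup.map_lowerCentralSeries (⊤ : Subgroup (N (i + 1)))
    (QuotientGroup.mk' ((N i).subgroupOf (N (i + 1)))) j
  rw [Subgroup.map_top_of_surjective _ (QuotientGroup.mk'_surjective _)] at h1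
  rw [← h1, Subgroup.map_eq_bot_iff, QuotientGroup.ker_mk', Subgroup.subgroupOf,
    ← Subgroup.map_le_iff_le_comap, Subgroup.map_lowerCentralSeries, ← MonoidHom.range_eq_map,
    Subgroup.range_subtype]
  exact hj

theorem hasCharacteristicSeries_of_subsingleton (G : Type*) [Group G] [Subsingleton G] (n : ℕ) :
    HasCharacteristicSeries G n :=
  ⟨fun _ => ⊥, fun _ => inferInstance, rfl, Subsingleton.elim _ _, fun _ _ =>
    ⟨le_rfl, 0, le_of_eq (Subsingleton.elim _ _)⟩⟩

theorem HasCharacteristicSeries.of_subgroup {G : Type*} [Group G] {K : Subgroup G}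
    [K.Characteristic] {n m : ℕ} (h : HasCharacteristicSeries K n)
    {j : ℕ} (hj : (⊤ : Subgroup G).lowerCentralSeries j ≤ K) (hm : n < m) :
    HasCharacteristicSeries G m := by
  obtain ⟨N, hN, h0, hn, h⟩ := h
  refine ⟨fun i => if i ≤ n then (N i).map K.subtype else ⊤, fun i => ?_, ?_, ?_, fun i _ => ?_⟩
  · dsimp only
    split_ifs
    · infer_instance
    · infer_instance
  · simp [h0]
  · simp [hm]
  · dsimp only
    rcases lt_trichotomy i n with hi | rfl | hi
    · obtain ⟨h1, k, hk⟩ := h i hi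
      rw [if_pos hi.le, if_pos (Nat.succ_le_of_lt hi)]
      refine ⟨Subgroup.map_mono h1, k, ?_⟩
      rw [← Subgroup.map_lowerCentralSeries]
      exact Subgroup.map_mono hk
    · rw [if_pos le_rfl, if_neg (by omega), hn, ← MonoidHom.range_eq_map, Subgroup.range_subtype]
      exact ⟨le_top, j, hj⟩
    · rw [if_neg (by omega), if_neg (by omega)]
      exact ⟨le_rfl, 0, le_top⟩

instance characteristic_nilpotentResidual (G : Type*) [Group G] :
    (nilpotentResidual G).Characteristic := by
  rw [nilpotentResidual]
  infer_instance

/-- If a constant prime to the order annihilates all sections, then the group is trivial. -/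
theorem subsingleton_of_kills_C {G : Type*} [Group G] [Finite G] {β : G →* G} {c : ℤ}
    (hsolv : Group.IsSolvable G)
    (hc : ∀ q : ℕ, q.Prime → q ∣ Nat.card G → ¬ (q : ℤ) ∣ c)
    (h : ∀ q : ℕ, q.Prime → Kills q β (C c) ⊥ ⊤) : Subsingleton G := by
  by_contra hG
  rw [not_subsingleton_iff_nontrivial] at hG
  obtain ⟨N, -, hN, -, -, q, hq, hs⟩ :=
    exists_minimal_section (IsInv.bot β) (IsInv.top β) bot_lt_top
  obtain ⟨a, ha, ha1⟩ := SetLike.exists_of_lt hN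
  have h1 := h q hq ⊥ N hs le_rfl le_top a ha
  have h2 : orderedEval β (C c) a = a ^ c := by simp [orderedEval]
  rw [h2, Subgroup.mem_bot] at h1
  have := Fact.mk hq
  have hq1 : orderOf a = q := orderOf_eq_prime (Subgroup.mem_bot.1 (hs.pow a ha)) ha1
  exact hc q hq (hq1 ▸ orderOf_dvd_natCard a) (hq1 ▸ orderOf_dvd_iff_zpow_eq_one.2 h1)

theorem dvd_invAux_succ (l : ℕ) (f : ℤ[X]) :
    f.eval 1 ∣ invAux (l + 1) f ∧ f.leadingCoeff ∣ invAux (l + 1) f ∧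
      rho₁ f ∣ invAux (l + 1) f ∧ rho₂ f ∣ invAux (l + 1) f ∧ prodant f ∣ invAux (l + 1) f := by
  rw [invAux]
  generalize f.eval 1 = a, f.leadingCoeff = b, rho₁ f = c, rho₂ f = d, rho₃ f = e,
    discrStar f = u, prodant f = v, invAux l (Delta f) = w
  exact ⟨⟨b * c * d * e * u * v * w, by ring⟩, ⟨a * c * d * e * u * v * w, by ring⟩,
    ⟨a * b * d * e * u * v * w, by ring⟩, ⟨a * b * c * e * u * v * w, by ring⟩,
    ⟨a * b * c * d * e * u * w, by ring⟩⟩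

/-- The recursion `f ↦ f_*`: on the last term of the lower central series the polynomial `f` can be
replaced by `f_*`, which has fewer irreducible factors. -/
theorem hasCharacteristicSeries_irr (l : ℕ) : ∀ (f : ℤ[X]) (_ : (Delta^[l] f).natDegree = 0)
    (_ : ∀ i < l, (Delta^[i] f).natDegree ≠ 0) (k : ℕ)
    (G : Type u) [Group G] [Finite G] [Group.IsSolvable G] {β : G →* G}
    (_ : Function.Injective β) (_ : ∀ q : ℕ, q.Prime → q ∣ Nat.card G → ¬ (q : ℤ) ∣ invAux l f)
    (_ : ∀ q : ℕ, q.Prime → Kills q β (expand ℤ k f) ⊥ ⊤),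
    HasCharacteristicSeries G (irr f) := by
  induction l with
  | zero =>
    intro f hf _ k G _ _ hG β hβ hc h
    have hfC := eq_C_of_natDegree_eq_zero hf
    rw [Function.iterate_zero_apply] at hfC
    have := subsingleton_of_kills_C hG (c := f.coeff 0) hc fun q hq => by
      have h1 := h q hq
      rwa [hfC, expand_C] at h1
    exact hasCharacteristicSeries_of_subsingleton G _
  | succ l ih =>
    intro f hf hne k G _ _ _ β hβ hc h
    have hf0 : f.natDegree ≠ 0 := hne 0 l.succ_pos
    have hKi : IsInv β (nilpotentResidual G) := isInv_nilpotentResidual β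
    obtain ⟨j, hj⟩ := exists_lowerCentralSeries_eq_nilpotentResidual (G := G)
    have hstar := star_mul_quo hf0
    have hψ := subtype_restrictEnd β hKi
    have hker : (nilpotentResidual G).subtype.ker ≤ ⊥ := by rw [Subgroup.ker_subtype]
    have hrange : (⊤ : Subgroup (nilpotentResidual G)).map (nilpotentResidual G).subtype =
        nilpotentResidual G := by rw [← MonoidHom.range_eq_map, Subgroup.range_subtype]
    have hb : ∀ q : ℕ, q.Prime →
        Kills q β (expand ℤ (k * norm f) (star f * quo (bar f) (star f))) ⊥ ⊤ := by
      intro q hq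
      rw [hstar, expand_mul, expand_norm_bar hf0]
      exact h q hq
    have hdvd : ∀ {q : ℕ} {c : ℤ}, q.Prime → q ∣ Nat.card G → c ∣ invAux (l + 1) f →
        ¬ (q : ℤ) ∣ c := fun hq hqG hcf hqc => hc _ hq hqG (hqc.trans hcf)
    obtain ⟨deval, dlc, d₁, d₂, dprod⟩ := dvd_invAux_succ l f
    have key : ∀ p : ℕ, p.Prime →
        Kills p β (expand ℤ (k * norm f) (star f)) ⊥ (nilpotentResidual G) := by
      intro p hp
      by_cases hpG : p ∣ Nat.card G
      · have := Fact.mk hp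
        have h2 : ¬ (p : ℤ) ∣ rho₂ f := hdvd hp hpG d₂
        refine (kills_pResidual (isCoprime_red_star_quo h2) (hasProductPolynomial_star hf0 ?_ h2 ?_)
          (fun n hn => ?_) _ G rfl hβ (fun q hq hqG => ?_) hb).mono le_rfl
          (nilpotentResidual_le_pResidual p)
        · exact hdvd hp hpG dlc
        · exact hdvd hp hpG dprod
        · rw [hstar]
          exact exists_rho₁ (hdvd hp hpG d₁) n hn
        · rw [hstar, eval_one_bar hf0]
          exact hdvd hq hqG deval
      · intro B A hs _ _ a ha
        rw [hs.eq_of_coprime ((Nat.Prime.coprime_iff_not_dvd hp).2 hpG)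
          fun a _ => pow_card_eq_one']
        exact hs.inv_top.orderedEval_mem _ ha
    refine (ih (star f) hf (fun i hi => hne (i + 1) (Nat.succ_lt_succ hi)) (k * norm f)
      (nilpotentResidual G) (restrictEnd_injective hβ hKi) (fun q hq hqK => ?_)
      fun q hq => (key q hq).comap _ hψ bot_le hrange.le hker).of_subgroup hj.le
        (irr_star_lt hf0 ⟨l + 1, hf⟩)
    exact hdvd hq (hqK.trans (Subgroup.card_subgroup_dvd_card _))
      (by rw [invAux]; exact dvd_mul_left _ _)

end Series

end HigmanSolvable

theorem mainTheorem1 {G : Type*} [Group G] [Finite G] [Group.IsSolvable G]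
    (α : G ≃* G) (hα : MonoidHom.FixedPointFree α)
    (f : ℤ[X]) (hf : HigmanSolvable.IsOrderedIdentity α.toMonoidHom f)
    (hsolv : HigmanSolvable.IsHigmanSolvable f)
    (hcop : Int.gcd (Nat.card G : ℤ) (HigmanSolvable.inv f) = 1) :
    HigmanSolvable.fittingHeight G ≤ (HigmanSolvable.irr f : ℕ∞) := by
  refine sInf_le ⟨HigmanSolvable.irr f, rfl,
    HigmanSolvable.HasCharacteristicSeries.hasNilpotentSeries
    (HigmanSolvable.hasCharacteristicSeries_irr (HigmanSolvable.len f) f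
      (Nat.sInf_mem hsolv.2) (fun i hi h => Nat.notMem_of_lt_sInf hi h) 1 G
      (β := α.toMonoidHom) α.injective (fun q hq hqG hqf => ?_) fun q _ B A _ _ _ a _ => ?_)⟩
  · have h1 := Int.dvd_coe_gcd (Int.natCast_dvd_natCast.2 hqG) hqf
    rw [← HigmanSolvable.inv, hcop] at h1
    exact hq.one_lt.ne' (Nat.dvd_one.1 (Int.natCast_dvd_natCast.1 h1))
  · rw [expand_one, HigmanSolvable.orderedEval, hf a]
    exact B.one_mem
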